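/- Let $H:\mathbb R\to\mathbb R$ be a smooth, nonnegative, even double-well potential with $xH'(x)<0$ for $0<|x|<1$, $xH'(x)>0$ for $|x|>1$, $H(\pm1)=H'(\pm1)=H'(0)=0$, $H(0)=H(\pm2)=1$, $H''(0)<0<H''(\pm1)$. For $\varepsilon>0$ put $$\tau_\varepsilon=\varepsilon^{-2}e^{-1/\varepsilon^2},\qquad k=\pi^{-1}\sqrt{|H''(0)|\,H''(1)},\qquad \gamma_\varepsilon=Z_\varepsilon^{-1}e^{-H/\varepsilon^2},\quad Z_\varepsilon=\int_{\mathbb R}e^{-H(y)/\varepsilon^2}\,dy ,$$ where $Z_\varepsilon<\infty$ for all $\varepsilon\in(0,\varepsilon_0)$, for some $\varepsilon_0>0$. For each $\varepsilon\in(0,\varepsilon_0)$ let $\rho_\varepsilon:[0,\infty)\times\mathbb R\to[0,\infty)$ be a weak solution of $$\tau_\varepsilon\,\partial_t\rho_\varepsilon=\partial_x\big(\partial_x\rho_\varepsilon+\varepsilon^{-2}\rho_\varepsilon H'\big)$$ with initial datum $\rho_\varepsilon^0$, in the energy class: $u_\varepsilon=\rho_\varepsilon/\gamma_\varepsilon$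 belongs to $C([0,\infty);L^2(\gamma_\varepsilon\,dx))$, and $\int_0^T\!\int_{\mathbb R}\gamma_\varepsilon|\partial_xu_\varepsilon|^2\,dx\,dt<\infty$ for all $T>0$. Assume that the $\rho^0_\varepsilon$ are probability densities that converge weakly-$*$, as $\varepsilon\to0$, to a probability measure $\rho^0$, and that, with constants $C$ and $c>0$ independent of $\varepsilon$, $u^0_\varepsilon=\rho^0_\varepsilon/\gamma_\varepsilon$ satisfies $$\int_{\mathbb R}\gamma_\varepsilon|u^0_\varepsilon|^2\,dx+\int_{\mathbb R}\frac{\gamma_\varepsilon|\partial_xu^0_\varepsilon|^2}{\tau_\varepsilon}\,dx\le C,\qquad u^0_\varepsilon(x)\ge c\quad\text{for all }x\in\mathbb R .$$ Let $0<T<\infty$. For a sequence $\varepsilon_n\to0$ in $(0,\varepsilon_0)$, say that $u\in H^1(0,T)$, with weak derivative $\dot u\in L^2(0,T)$, is the limit of $(\rho_{\varepsilon_n})$ if, for every $t\in[0,T]$, the $\rho_{\varepsilon_n}(t,\cdot)$ are probability densities that converge weakly-$*$ to $\tfrac12\big(u(t)\delta_{+1}+(2-u(t))\delta_{-1}\big)$,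 and if the weak derivatives $\partial_t\rho_{\varepsilon_n}$ exist on $(0,T)\times\mathbb R$, satisfy $\int_0^T\!\int_{\mathbb R}|\partial_t\rho_{\varepsilon_n}|^2/\gamma_{\varepsilon_n}\,dx\,dt<\infty$, and converge weakly-$*$, as measures tested against bounded continuous functions, to $\tfrac12\big(\dot u\,\delta_{+1}-\dot u\,\delta_{-1}\big)$. For $u\in(0,2)$ and $v,w\in\mathbb R$ put $$g_u(v,w)=\frac{v\,w\,\ln\big(u/(2-u)\big)}{2k(u-1)}\quad(u\neq1),\qquad g_1(v,w)=\frac{v\,w}{k},\qquad E(u)=\tfrac12\big(u\ln u+(2-u)\ln(2-u)\big),$$ and $DE(u)v=E'(u)\,v$. Then: (1) Every sequence $\varepsilon_n\to0$ in $(0,\varepsilon_0)$ has a subsequence along which the solutions have a limit $u\in H^1(0,T)$ in this sense. (2) If $u$ is the limit of the solutions along some sequence $\varepsilon_n\to0$ in $(0,\varepsilon_0)$, then there is $\delta>0$ with $\delta\le u(t)\le2-\delta$ for all $t\in[0,T]$, and $\dot u$ minimizes the time-integrated limit Rayleigh functional over $L^2(0,T)$: all the integrals are finite, and $$\int_0^T\Big(\tfrac12g_u(\dot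 u,\dot u)+DE(u)\dot u\Big)dt\;\le\;\int_0^T\Big(\tfrac12g_u(v,v)+DE(u)v\Big)dt\qquad\text{for all }v\in L^2(0,T).$$ Moreover $u$ is differentiable on $[0,T]$ (one-sidedly at the end points) and is the $g$-gradient flow of $E$, i.e. $g_{u(t)}(\dot u(t),v)+DE(u(t))v=0$ for all $v\in\mathbb R$ and $t\in[0,T]$; hence $\dot u=-k(u-1)$ on $[0,T]$, and $u(0)=2\rho^0\big((0,\infty)\big)$. -/

import Mathlib

open MeasureTheory Set Filter Topology
open scoped ContDiff BoundedContinuousFunction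

noncomputable section

namespace KramersLimit

/-- The double-well enthalpy functions `H`. -/
structure IsDoubleWell (H : ℝ → ℝ) : Prop where
  smooth : ContDiff ℝ ∞ H
  nonneg : ∀ x, 0 ≤ H x
  even : ∀ x, H (-x) = H x
  decreasing_inside : ∀ x, 0 < |x| → |x| < 1 → x * deriv H x < 0
  increasing_outside : ∀ x, 1 < |x| → 0 < x * deriv H x
  at_wells : H 1 = 0 ∧ H (-1) = 0
  deriv_at_wells : deriv H 1 = 0 ∧ deriv H (-1) = 0
  deriv_at_zero : deriv H 0 = 0
  at_barrier : H 0 = 1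
  at_two : H 2 = 1 ∧ H (-2) = 1
  barrier_nondegenerate : deriv (deriv H) 0 < 0
  wells_nondegenerate : 0 < deriv (deriv H) 1 ∧ 0 < deriv (deriv H) (-1)

/-- The time scale `τ_ε = ε⁻² exp (-1/ε²)`. -/
def tau (ε : ℝ) : ℝ := (ε ^ 2)⁻¹ * Real.exp (-1 / ε ^ 2)

/-- The rate constant `k = π⁻¹ √(|H''(0)| H''(1))`. -/
def rate (H : ℝ → ℝ) : ℝ :=
  Real.pi⁻¹ * Real.sqrt (|deriv (deriv H) 0| * deriv (deriv H) 1)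

/-- The normalisation `Z_ε = ∫ exp (-H/ε²)`. -/
def partitionFn (H : ℝ → ℝ) (ε : ℝ) : ℝ := ∫ y, Real.exp (-H y / ε ^ 2)

/-- The density `γ_ε = Z_ε⁻¹ exp (-H/ε²)` of the invariant measure. -/
def gam (H : ℝ → ℝ) (ε : ℝ) (x : ℝ) : ℝ :=
  (partitionFn H ε)⁻¹ * Real.exp (-H x / ε ^ 2)

/-- `g` is the weak derivative of `f` on the open set `Ω ⊆ ℝ`. -/
def HasWeakDerivOn (f g : ℝ → ℝ) (Ω : Set ℝ) : Prop :=
  LocallyIntegrableOn f Ω ∧ LocallyIntegrableOn g Ω ∧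
    ∀ ψ : ℝ → ℝ, ContDiff ℝ ∞ ψ → HasCompactSupport ψ → tsupport ψ ⊆ Ω →
      ∫ x in Ω, f x * deriv ψ x = -∫ x in Ω, g x * ψ x

/-- Lebesgue measure on the space-time strip `(0, T) × ℝ`. -/
def stripMeasure (T : ℝ) : Measure (ℝ × ℝ) := (volume.restrict (Ioo 0 T)).prod volume

/-- The weighted space of `f : (0, T) × ℝ → ℝ` with `∫_0^T ∫ f² / γ_ε dx dt < ∞`. -/
def MemL2Strip (H : ℝ → ℝ) (ε T : ℝ) (f : ℝ → ℝ → ℝ) : Prop :=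
  AEStronglyMeasurable (Function.uncurry f) (stripMeasure T) ∧
    Integrable (fun p : ℝ × ℝ => f p.1 p.2 ^ 2 / gam H ε p.2) (stripMeasure T)

/-- The flux `∂_x ρ + ε⁻² ρ H'`, where `r` stands for `∂_x ρ`. -/
def flux (H : ℝ → ℝ) (ε : ℝ) (ρ r : ℝ → ℝ → ℝ) (t x : ℝ) : ℝ :=
  r t x + (ε ^ 2)⁻¹ * ρ t x * deriv H x

/-- `ρ : [0, ∞) × ℝ → [0, ∞)` is a weak solution, in the usual energy class, of
`τ_ε ∂_t ρ = ∂_x (∂_x ρ + ε⁻² ρ H')` with initial datum `ρ0`: with `u = ρ / γ_ε`,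
`u` belongs to `C([0, ∞); L²(γ_ε))` and, because `γ_ε ∂_x u = ∂_x ρ + ε⁻² ρ H'`, the
condition on the flux says that `∂_x u` belongs to `L²((0, T) × ℝ; γ_ε)` for all `T`.
Values of `ρ` at negative times are irrelevant. -/
structure IsSolution (H : ℝ → ℝ) (ε : ℝ) (ρ0 : ℝ → ℝ) (ρ : ℝ → ℝ → ℝ) : Prop where
  nonneg : ∀ t, 0 ≤ t → ∀ x, 0 ≤ ρ t x
  meas : AEStronglyMeasurable (Function.uncurry ρ) ((volume.restrict (Ioi 0)).prod volume)
  meas_slice : ∀ t, 0 ≤ t → AEStronglyMeasurable (ρ t) volume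
  sq_integrable : ∀ t, 0 ≤ t → Integrable (fun x => ρ t x ^ 2 / gam H ε x)
  continuous : ∀ s, 0 ≤ s →
    Tendsto (fun t => ∫ x, (ρ t x - ρ s x) ^ 2 / gam H ε x) (𝓝[Ici 0] s) (𝓝 0)
  initial : ρ 0 =ᵐ[volume] ρ0
  weak_form : ∃ r : ℝ → ℝ → ℝ,
    (∀ᵐ t ∂(volume.restrict (Ioi (0 : ℝ))), HasWeakDerivOn (ρ t) (r t) univ) ∧
    (∀ T, 0 < T → MemL2Strip H ε T (flux H ε ρ r)) ∧
    ∀ ψ : ℝ → ℝ, ContDiff ℝ ∞ ψ → HasCompactSupport ψ → ∀ t, 0 ≤ t →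
      tau ε * ((∫ x, ρ t x * ψ x) - (∫ x, ρ0 x * ψ x))
        = -∫ p, flux H ε ρ r p.1 p.2 * deriv ψ p.2 ∂(stripMeasure t)

/-- The well-preparedness of a probability density `ρ0` with constants `C`, `c`:
for `u0 = ρ0 / γ_ε`,
`∫ γ_ε |u0|² + ∫ γ_ε |∂_x u0|² / τ_ε ≤ C` and `u0 ≥ c`. -/
def WellPrepared (H : ℝ → ℝ) (ε C c : ℝ) (ρ0 : ℝ → ℝ) : Prop :=
  Integrable ρ0 ∧ ∫ x, ρ0 x = 1 ∧
    (∀ x, c ≤ ρ0 x / gam H ε x) ∧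
    ∃ d : ℝ → ℝ, HasWeakDerivOn (fun x => ρ0 x / gam H ε x) d univ ∧
      Integrable (fun x => gam H ε x * (ρ0 x / gam H ε x) ^ 2) ∧
      Integrable (fun x => gam H ε x * d x ^ 2 / tau ε) ∧
      (∫ x, gam H ε x * (ρ0 x / gam H ε x) ^ 2) + (∫ x, gam H ε x * d x ^ 2 / tau ε) ≤ C

/-- `w` is the weak time derivative `∂_t ρ` on `(0, T) × ℝ`. -/
def HasWeakTimeDeriv (T : ℝ) (ρ w : ℝ → ℝ → ℝ) : Prop :=
  ∀ ψ : ℝ × ℝ → ℝ, ContDiff ℝ ∞ ψ → HasCompactSupport ψ →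
    tsupport ψ ⊆ Ioo 0 T ×ˢ univ →
      ∫ p, ρ p.1 p.2 * deriv (fun t => ψ (t, p.2)) p.1 ∂(stripMeasure T)
        = -∫ p, w p.1 p.2 * ψ p ∂(stripMeasure T)

/-- Along the sequence `e n → 0`, the solutions `ρ_ε` have the limit `u ∈ H¹(0, T)` with weak
derivative `du`: for all `t ∈ [0, T]` the probability densities `ρ_ε(t, ·)` converge weakly-* to
`½ (u(t) δ₁ + (2 - u(t)) δ₋₁)`, and `∂_t ρ_ε` (which belongs to the weighted space `L²_ε`)
converges weakly-* as a measure on `[0, T] × ℝ` to `½ (du δ₁ - du δ₋₁)`. -/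
structure IsLimit (H : ℝ → ℝ) (T : ℝ) (ρ : ℝ → ℝ → ℝ → ℝ) (e : ℕ → ℝ) (u du : ℝ → ℝ) :
    Prop where
  memLp : MemLp u 2 (volume.restrict (Ioo 0 T))
  memLp_deriv : MemLp du 2 (volume.restrict (Ioo 0 T))
  weak_deriv : HasWeakDerivOn u du (Ioo 0 T)
  mass : ∀ n, ∀ t ∈ Icc 0 T, ∫ x, ρ (e n) t x = 1
  tendsto_density : ∀ t ∈ Icc 0 T, ∀ ψ : ℝ →ᵇ ℝ,
    Tendsto (fun n => ∫ x, ρ (e n) t x * ψ x) atTop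
      (𝓝 ((1 / 2) * (u t * ψ 1 + (2 - u t) * ψ (-1))))
  tendsto_time_deriv : ∃ w : ℕ → ℝ → ℝ → ℝ,
    (∀ n, MemL2Strip H (e n) T (w n) ∧ HasWeakTimeDeriv T (ρ (e n)) (w n)) ∧
    ∀ ψ : (ℝ × ℝ) →ᵇ ℝ,
      Tendsto (fun n => ∫ p, w n p.1 p.2 * ψ p ∂(stripMeasure T)) atTop
        (𝓝 (∫ t in Ioo 0 T, (1 / 2) * (du t * ψ (t, 1) - du t * ψ (t, -1))))

/-- The limit metric tensor `g_u(v, w) = v w ln (u / (2 - u)) / (2 k (u - 1))`, with its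
continuous extension `g_1(v, w) = v w / k`. -/
def limitMetric (k u v w : ℝ) : ℝ :=
  if u = 1 then v * w / k else v * w * Real.log (u / (2 - u)) / (2 * k * (u - 1))

/-- The limit energy `E(u) = ½ (u ln u + (2 - u) ln (2 - u))`. -/
def limitEnergy (u : ℝ) : ℝ := (1 / 2) * (u * Real.log u + (2 - u) * Real.log (2 - u))

/-- The integrand `½ g_u(v, v) + DE(u) v` of the limit Rayleigh functional. -/
def rayleighDensity (k u v : ℝ) : ℝ :=
  (1 / 2) * limitMetric k u v v + deriv limitEnergy u * v

/-- `d` minimizes `∫_0^T (½ g_u(v, v) + DE(u) v) dt` over all `v ∈ L²(0, T)`, the integrals being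
finite. -/
def IsRayleighMinimizer (k T : ℝ) (u d : ℝ → ℝ) : Prop :=
  MemLp d 2 (volume.restrict (Ioo 0 T)) ∧
  IntegrableOn (fun t => rayleighDensity k (u t) (d t)) (Ioo 0 T) ∧
  ∀ v : ℝ → ℝ, MemLp v 2 (volume.restrict (Ioo 0 T)) →
    IntegrableOn (fun t => rayleighDensity k (u t) (v t)) (Ioo 0 T) ∧
    ∫ t in Ioo 0 T, rayleighDensity k (u t) (d t)
      ≤ ∫ t in Ioo 0 T, rayleighDensity k (u t) (v t)

/-- `u : [0, T] → (0, 2)` is the `g`-gradient flow of the limit energy: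
`g_u(u̇, v) + DE(u) v = 0` for all `v ∈ ℝ` and all times (one-sided derivatives at the end
points). -/
def IsLimitGradientFlow (k T : ℝ) (u : ℝ → ℝ) : Prop :=
  ∀ t ∈ Icc 0 T, u t ∈ Ioo (0 : ℝ) 2 ∧
    ∃ d, HasDerivWithinAt u d (Icc 0 T) t ∧
      ∀ v, limitMetric k (u t) d v + deriv limitEnergy (u t) * v = 0

end KramersLimit

end

/-! The limit is identified explicitly; no variational problem is passed to the limit. The
difference of the well masses, m(t) = ∫ ρ(t) sign, satisfies m' = -k m up to errors vanishing with
ε, and the L²(γ) bound on u = ρ/γ leaves no other degree of freedom.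

Energy estimates. Integrated in time, the equation becomes τ (V' - a) = -D*D V in L²(dx), with V(t)
= √γ ∫_0^t u, a = √γ u⁰ and D the weighted derivative (`IsSolution.exists_isFormFlow`). Since V is
C¹ and stays in the domain of D, elementary Hilbert space arguments (`IsFormFlow`) give three
bounds, with norms in L²(γ) and Q = D V: ‖u(t)‖ ≤ ‖u⁰‖, ‖Q(t)‖ ≤ t ‖∂ₓu⁰‖, and ∫_0^T ‖u(t+r) -
u(t)‖² dt ≤ r² ‖∂ₓu⁰‖² / (2τ). Well-preparedness makes them O(1), O(t √τ) and O(r²), uniformly in ε.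

Concentration. By Cauchy-Schwarz |∫ ρ g| ≤ ‖u‖ (∫ γ g²)^{1/2}, and Laplace's method shows that γ
tends to half the sum of the Dirac masses at ±1. Observables vanishing at the wells are therefore
negligible, and with unit mass the limit of ρ(t) is determined by that of m(t).

Slow dynamics. Let φ be the committor, with φ' = κ/γ on [-1, 1], and let U = ∫_0^t u. Testing with φ
gives τ (∫ ρ(t) φ - ∫ ρ(0) φ) = -κ (U(1) - U(-1)). The point values of U are replaced by well
averages, which turns the right side into -κ N⁻¹ ∫_0^t m with N = ∫_0^2 γ. This exchanges the
indicator of [-1, 1] for a plateau function at distance at most γ/N, so the error is at most κ N⁻¹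
‖Q‖ (`IsSolution.abs_committor_balance_le`). Since φ is close to the truncated sign in L²(γ), N →
1/2 and κ/τ → k/2 (Kramers' formula), Gronwall's inequality yields m(t) → m(0) e^{-kt}
(`IsFamily.tendsto_wellSign`).

Time derivatives. The third bound produces ∂ₜρ in L²(1/γ), bounded by √C. Concentration reduces a
test function to its values at the wells; approximating in L²(0, T) and integrating by parts reduces
the claim to convergence of the densities.

Conclusion. The whole family converges to one curve, kept in [c, 2 - c] by u⁰ ≥ c. The metric is
g_u(v, w) = A(u) v w with A ≥ 0, and E'(u) = A(u) k (u - 1), so the Rayleigh integrand is minimal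
pointwise at v = -k (u - 1), where the gradient flow equation also holds. -/

noncomputable section

namespace KramersLimit

open scoped RealInnerProductSpace

/-! ### Absolutely continuous functions and weak derivatives on the line -/

/-- `f` is an (absolutely continuous) primitive of the locally integrable function `f'`. -/
structure IsPrimitive (f f' : ℝ → ℝ) : Prop where
  locallyIntegrable : LocallyIntegrable f'
  eq_add_integral : ∀ x, f x = f 0 + ∫ y in (0 : ℝ)..x, f' y

namespace IsPrimitive

variable {f f' g g' : ℝ → ℝ}

lemma intervalIntegrable (hf : IsPrimitive f f') (a b : ℝ) : IntervalIntegrable f' volume a b :=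
  (hf.locallyIntegrable.integrableOn_isCompact isCompact_uIcc).intervalIntegrable

lemma integral_eq_sub (hf : IsPrimitive f f') (a b : ℝ) : ∫ y in a..b, f' y = f b - f a := by
  rw [hf.eq_add_integral a, hf.eq_add_integral b, add_sub_add_left_eq_sub,
    intervalIntegral.integral_interval_sub_left] <;> exact hf.intervalIntegrable _ _

lemma absolutelyContinuous (hf : IsPrimitive f f') (a b : ℝ) :
    AbsolutelyContinuousOnInterval f a b := by
  have h := (hf.intervalIntegrable a b).absolutelyContinuousOnInterval_intervalIntegral
    (c := a) (by simp)
  have h2 : f = fun x => f a - -∫ y in a..x, f' y := by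
    ext x; rw [hf.integral_eq_sub]; ring
  rw [h2]
  exact (LipschitzOnWith.absolutelyContinuousOnInterval (K := 0)
    (LipschitzOnWith.of_dist_le_mul (by simp))).sub h.neg

lemma continuous (hf : IsPrimitive f f') : Continuous f := by
  have h2 : f = fun x => f 0 + ∫ y in (0 : ℝ)..x, f' y := funext hf.eq_add_integral
  rw [h2]
  exact continuous_const.add
    (intervalIntegral.continuous_primitive (fun a b => hf.intervalIntegrable a b) 0)

lemma ae_hasDerivAt (hf : IsPrimitive f f') : ∀ᵐ x, HasDerivAt f (f' x) x := by
  have h : ∀ᵐ x, HasDerivAt (fun x => ∫ y in (0 : ℝ)..x, f' y) (f' x) x := by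
    filter_upwards [_root_.LocallyIntegrable.ae_hasDerivAt_integral hf.locallyIntegrable] with x hx using hx 0
  have h2 : f = fun x => f 0 + ∫ y in (0 : ℝ)..x, f' y := funext hf.eq_add_integral
  filter_upwards [h] with x hx
  rw [h2]
  exact hx.const_add _

/-- The product rule for absolutely continuous functions. -/
lemma integral_mul_eq_sub (hf : IsPrimitive f f') (hg : IsPrimitive g g') (a b : ℝ) :
    ∫ x in a..b, (f' x * g x + f x * g' x) = f b * g b - f a * g a := by
  rw [← AbsolutelyContinuousOnInterval.integral_deriv_mul_eq_sub (hf.absolutelyContinuous a b)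
    (hg.absolutelyContinuous a b)]
  refine intervalIntegral.integral_congr_ae ?_
  filter_upwards [hf.ae_hasDerivAt, hg.ae_hasDerivAt] with x h1 h2 _
  rw [h1.deriv, h2.deriv]

/-- Integration by parts on the whole line, without boundary terms. -/
lemma integral_mul_eq_zero (hf : IsPrimitive f f') (hg : IsPrimitive g g')
    (h1 : Integrable (fun x => f' x * g x)) (h2 : Integrable (fun x => f x * g' x))
    (h0 : Integrable (fun x => f x * g x)) :
    (∫ x, f' x * g x) + ∫ x, f x * g' x = 0 := by
  have hi : Integrable (fun x => f' x * g x + f x * g' x) := h1.add h2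
  have hF : ∀ x, f x * g x = f 0 * g 0 + ∫ y in (0 : ℝ)..x, (f' y * g y + f y * g' y) := by
    intro x; rw [integral_mul_eq_sub hf hg]; ring
  have htop : Tendsto (fun x => f x * g x) atTop
      (𝓝 (f 0 * g 0 + ∫ y in Ioi (0 : ℝ), (f' y * g y + f y * g' y))) := by
    refine Tendsto.congr (fun x => (hF x).symm) ?_
    exact (intervalIntegral_tendsto_integral_Ioi 0 hi.integrableOn tendsto_id).const_add _
  have hbot : Tendsto (fun x => f x * g x) atBot
      (𝓝 (f 0 * g 0 - ∫ y in Iic (0 : ℝ), (f' y * g y + f y * g' y))) := by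
    refine Tendsto.congr (fun x => (hF x).symm) ?_
    have := (intervalIntegral_tendsto_integral_Iic 0 hi.integrableOn tendsto_id)
    refine (this.neg.const_add (f 0 * g 0)).congr fun x => ?_
    simp only [id]
    rw [intervalIntegral.integral_symm]
    ring
  -- An integrable function with a limit at infinity has limit zero: otherwise it would exceed `|L|
  -- / 2` on a set of infinite measure. This removes the boundary terms.
  have key : ∀ l : Filter ℝ, ∀ L, Tendsto (fun x => f x * g x) l (𝓝 L) →
      (∀ s ∈ l, volume s = ⊤) → L = 0 := by
    intro l L hL hl
    by_contra hne
    have h3 : ∀ᶠ x in l, |L| / 2 < |f x * g x| :=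
      hL.abs.eventually (lt_mem_nhds (by have := abs_pos.2 hne; linarith))
    have h4 := hl _ h3
    have h5 := h0.measure_norm_ge_lt_top (ε := |L| / 2) (by have := abs_pos.2 hne; linarith)
    have h6 : volume {x | |L| / 2 < |f x * g x|} ≤ volume {x | |L| / 2 ≤ ‖f x * g x‖} :=
      measure_mono fun x hx => by
        simp only [mem_ofPred_eq] at hx ⊢
        exact le_of_lt hx
    exact absurd (h6.trans_lt h5) (by rw [h4]; simp)
  have e1 := key _ _ htop (by
    intro s hs
    obtain ⟨a, ha⟩ := mem_atTop_sets.1 hs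
    exact measure_mono_top (s₁ := Ici a) (fun x hx => ha x hx) (by simp))
  have e2 := key _ _ hbot (by
    intro s hs
    obtain ⟨a, ha⟩ := mem_atBot_sets.1 hs
    exact measure_mono_top (s₁ := Iic a) (fun x hx => ha x hx) (by simp))
  rw [← integral_add h1 h2, ← intervalIntegral.integral_Iic_add_Ioi hi.integrableOn hi.integrableOn (b := 0)]
  linarith

lemma of_integral (hf : LocallyIntegrable f') (a : ℝ) :
    IsPrimitive (fun x => a + ∫ y in (0 : ℝ)..x, f' y) f' := ⟨hf, fun x => by simp⟩

lemma of_contDiff (hf : ContDiff ℝ 1 f) : IsPrimitive f (deriv f) := by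
  have hc : Continuous (deriv f) := hf.continuous_deriv le_rfl
  refine ⟨hc.locallyIntegrable, fun x => ?_⟩
  rw [intervalIntegral.integral_deriv_eq_sub (fun y _ => (hf.differentiable one_ne_zero) y)
    (hc.intervalIntegrable _ _)]
  ring

end IsPrimitive

lemma integrable_mul_of_hasCompactSupport {f g : ℝ → ℝ} (hf : LocallyIntegrable f)
    (hg : Continuous g) (hgs : HasCompactSupport g) : Integrable (fun x => f x * g x) := by
  simpa [mul_comm] using hf.integrable_smul_left_of_hasCompactSupport hg hgs

/-- The du Bois-Reymond lemma: a function with vanishing weak derivative is a constant. -/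
lemma ae_eq_const_of_integral_mul_deriv_eq_zero {f : ℝ → ℝ} (hf : LocallyIntegrable f)
    (h : ∀ ψ : ℝ → ℝ, ContDiff ℝ ∞ ψ → HasCompactSupport ψ → ∫ x, f x * deriv ψ x = 0) :
    ∃ a : ℝ, f =ᵐ[volume] fun _ => a := by
  obtain ⟨b⟩ : Nonempty (ContDiffBump (0 : ℝ)) := inferInstance
  set η : ℝ → ℝ := b.normed volume with hη
  have hηc : ContDiff ℝ ∞ η := b.contDiff_normed
  have hηs : HasCompactSupport η := b.hasCompactSupport_normed
  have hη1 : ∫ x, η x = 1 := b.integral_normed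
  refine ⟨∫ x, f x * η x, ?_⟩
  refine ae_eq_of_integral_contDiff_smul_eq hf (continuous_const.locallyIntegrable) ?_
  intro g hg hgs
  have hgi : Integrable g := hg.continuous.integrable_of_hasCompactSupport hgs
  have hηi : Integrable η := hηc.continuous.integrable_of_hasCompactSupport hηs
  -- Subtracting a multiple of the normalised bump makes the integral vanish, which is exactly what
  -- gives `G` a compactly supported primitive `ψ`, an admissible test function.
  set G : ℝ → ℝ := fun x => g x - (∫ y, g y) * η x with hG
  have hGc : ContDiff ℝ ∞ G := hg.sub (contDiff_const.mul hηc)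
  have hGs : HasCompactSupport G := hgs.sub (hηs.mul_left)
  have hGi : Integrable G := hgi.sub (hηi.const_mul _)
  have hG0 : ∫ x, G x = 0 := by
    rw [hG, integral_sub hgi (hηi.const_mul _), integral_const_mul, hη1]; simp
  set ψ : ℝ → ℝ := fun x => ∫ y in Iic x, G y with hψ
  have hψd : ∀ x, HasDerivAt ψ (G x) x := by
    intro x
    have e : ψ = fun x => (∫ y in Iic (0 : ℝ), G y) + ∫ y in (0 : ℝ)..x, G y := by
      ext x
      rw [intervalIntegral.integral_Iic_sub_Iic hGi.integrableOn hGi.integrableOn |>.symm]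
      ring
    rw [e]
    exact (intervalIntegral.integral_hasDerivAt_right (hGc.continuous.intervalIntegrable _ _)
      (hGc.continuous.stronglyMeasurableAtFilter _ _) hGc.continuous.continuousAt).const_add _
  have hψderiv : deriv ψ = G := funext fun x => (hψd x).deriv
  have hψc : ContDiff ℝ ∞ ψ := by
    rw [contDiff_infty_iff_deriv]
    exact ⟨fun x => (hψd x).differentiableAt, hψderiv ▸ hGc⟩
  have hψs : HasCompactSupport ψ := by
    obtain ⟨R, hR⟩ := hGs.isCompact.isBounded.subset_closedBall 0
    refine HasCompactSupport.intro (isCompact_closedBall 0 R) fun x hx => ?_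
    have hz : ∀ y, y ∉ Metric.closedBall (0 : ℝ) R → G y = 0 := fun y hy =>
      image_eq_zero_of_notMem_tsupport fun h' => hy (hR h')
    simp only [Metric.mem_closedBall, dist_zero_right, Real.norm_eq_abs, not_le] at hx hz
    rcases lt_abs.1 hx with hx | hx
    · rw [hψ]
      simp only
      rw [setIntegral_eq_integral_of_forall_compl_eq_zero, hG0]
      intro y hy
      exact hz y (lt_abs.2 (Or.inl (hx.trans (by simpa using hy))))
    · refine setIntegral_eq_zero_of_forall_eq_zero fun y hy => ?_
      exact hz y (lt_abs.2 (Or.inr (by simp only [mem_Iic] at hy; linarith)))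
  have h3 := h ψ hψc hψs
  rw [hψderiv] at h3
  have i1 := integrable_mul_of_hasCompactSupport hf hg.continuous hgs
  have i2 := integrable_mul_of_hasCompactSupport hf hηc.continuous hηs
  have h4 : ∫ x, f x * G x = (∫ x, f x * g x) - (∫ y, g y) * ∫ x, f x * η x := by
    rw [← integral_const_mul, ← integral_sub i1 (i2.const_mul _)]
    congr 1; ext x; simp only [hG]; ring
  simp only [smul_eq_mul, integral_mul_const]
  rw [h4] at h3
  rw [show (fun x => g x * f x) = fun x => f x * g x from funext fun x => mul_comm _ _]
  linarith

/-- A function with a weak derivative agrees a.e. with a primitive of the latter. -/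
lemma exists_isPrimitive_of_weakDeriv {f g : ℝ → ℝ} (hf : LocallyIntegrable f)
    (hg : LocallyIntegrable g)
    (h : ∀ ψ : ℝ → ℝ, ContDiff ℝ ∞ ψ → HasCompactSupport ψ →
      ∫ x, f x * deriv ψ x = -∫ x, g x * ψ x) :
    ∃ F, IsPrimitive F g ∧ f =ᵐ[volume] F := by
  set F₀ : ℝ → ℝ := fun x => 0 + ∫ y in (0 : ℝ)..x, g y with hF₀
  have hP : IsPrimitive F₀ g := IsPrimitive.of_integral hg 0
  have hFl : LocallyIntegrable F₀ := hP.continuous.locallyIntegrable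
  obtain ⟨a, ha⟩ := ae_eq_const_of_integral_mul_deriv_eq_zero (hf.sub hFl) (by
    intro ψ hψ hψs
    have hψd : Continuous (deriv ψ) := hψ.continuous_deriv (by simp)
    have i1 := integrable_mul_of_hasCompactSupport hf hψd hψs.deriv
    have i2 := integrable_mul_of_hasCompactSupport hFl hψd hψs.deriv
    have i3 := integrable_mul_of_hasCompactSupport hg hψ.continuous hψs
    have i4 := integrable_mul_of_hasCompactSupport hFl hψ.continuous hψs
    have := hP.integral_mul_eq_zero (IsPrimitive.of_contDiff (hψ.of_le (by simp))) i3 i2 i4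
    simp only [Pi.sub_apply, sub_mul]
    rw [integral_sub i1 i2, h ψ hψ hψs]
    linarith)
  refine ⟨fun x => a + ∫ y in (0 : ℝ)..x, g y, IsPrimitive.of_integral hg a, ?_⟩
  filter_upwards [ha] with x hx
  simp only [Pi.sub_apply, hF₀] at hx
  linarith

/-! ### Laplace's method -/

/-- Quadratic behaviour at a critical zero. -/
lemma tendsto_div_sq_of_contDiff {f : ℝ → ℝ} (hf : ContDiff ℝ 2 f) {x₀ : ℝ} (h0 : f x₀ = 0)
    (h1 : deriv f x₀ = 0) :
    Tendsto (fun x => f x / (x - x₀) ^ 2) (𝓝[≠] x₀) (𝓝 (deriv (deriv f) x₀ / 2)) := by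
  have h := Real.taylor_tendsto (n := 2) (s := univ) convex_univ (mem_univ x₀) hf.contDiffOn
  rw [nhdsWithin_univ] at h
  have h' := (h.mono_left (nhdsWithin_le_nhds (s := {x₀}ᶜ))).add_const (deriv (deriv f) x₀ / 2)
  rw [zero_add] at h'
  refine h'.congr' ?_
  filter_upwards [self_mem_nhdsWithin] with x hx
  have hx' : x - x₀ ≠ 0 := sub_ne_zero.2 hx
  rw [taylorWithinEval_succ, taylorWithinEval_succ, taylor_within_zero_eval]
  simp only [iteratedDerivWithin_univ, iteratedDeriv_succ, iteratedDeriv_zero, h0, h1]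
  field_simp
  norm_num
  ring

/-- From `e^y ≥ y` at `y = m / ε²`. It shows that the tails in Laplace's method stay negligible
after division by `ε`. -/
lemma inv_mul_exp_neg_div_sq_le {m ε : ℝ} (hm : 0 < m) (hε : 0 < ε) :
    ε⁻¹ * Real.exp (-m / ε ^ 2) ≤ ε / m := by
  have h1 : m / ε ^ 2 ≤ Real.exp (m / ε ^ 2) := by
    have := Real.add_one_le_exp (m / ε ^ 2); linarith
  have h2 : Real.exp (-m / ε ^ 2) ≤ ε ^ 2 / m := by
    rw [neg_div, Real.exp_neg, ← inv_div m]
    exact inv_anti₀ (by positivity) h1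
  calc ε⁻¹ * Real.exp (-m / ε ^ 2) ≤ ε⁻¹ * (ε ^ 2 / m) := by gcongr
    _ = ε / m := by field_simp

/-- Laplace's method at an interior nondegenerate minimum. -/
lemma tendsto_laplace {f g : ℝ → ℝ} {I : Set ℝ} {x₀ a ε₁ M : ℝ} (hf : Measurable f)
    (hI : MeasurableSet I) (hIx : I ∈ 𝓝 x₀) (ha : 0 < a) (hf0 : f x₀ = 0)
    (hfx : Tendsto (fun x => f x / (x - x₀) ^ 2) (𝓝[≠] x₀) (𝓝 (a / 2)))
    (hfm : ∀ r > 0, ∃ m > 0, ∀ x ∈ I, r ≤ |x - x₀| → m ≤ f x)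
    (hε₁ : 0 < ε₁) (hint : IntegrableOn (fun x => Real.exp (-f x / ε₁ ^ 2)) I)
    (hg : Measurable g) (hgM : ∀ x, |g x| ≤ M) (hgc : ContinuousAt g x₀) :
    Tendsto (fun ε => ε⁻¹ * ∫ x in I, g x * Real.exp (-f x / ε ^ 2)) (𝓝[>] 0)
      (𝓝 (g x₀ * Real.sqrt (2 * Real.pi / a))) := by
  have hM : 0 ≤ M := (abs_nonneg _).trans (hgM 0)
  -- The quotient tends to `a / 2`, so it exceeds `a / 4` nearby; this gives a Gaussian majorant
  -- after rescaling.
  obtain ⟨r, hr, hrI, hrf⟩ : ∃ r > 0, Metric.ball x₀ r ⊆ I ∧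
      ∀ x ∈ Metric.ball x₀ r, a / 4 * (x - x₀) ^ 2 ≤ f x := by
    have h1 : ∀ᶠ x in 𝓝[≠] x₀, a / 4 < f x / (x - x₀) ^ 2 :=
      hfx.eventually (lt_mem_nhds (by linarith))
    rw [eventually_nhdsWithin_iff] at h1
    obtain ⟨r, hr, h⟩ := Metric.eventually_nhds_iff_ball.1 (h1.and hIx)
    refine ⟨r, hr, fun x hx => (h x hx).2, fun x hx => ?_⟩
    by_cases hxx : x = x₀
    · simp [hxx, hf0]
    · have hpos : 0 < (x - x₀) ^ 2 := by have := sub_ne_zero.2 hxx; positivity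
      exact ((lt_div_iff₀ hpos).1 ((h x hx).1 hxx)).le
  obtain ⟨m, hm, hmf⟩ := hfm r hr
  set B := Metric.ball x₀ r with hB
  have hBm : MeasurableSet B := Metric.isOpen_ball.measurableSet
  have hmeas : ∀ ε : ℝ, Measurable fun x => g x * Real.exp (-f x / ε ^ 2) := fun ε =>
    hg.mul ((hf.neg.div_const _).exp)
  have hfI : ∀ x ∈ I, 0 ≤ f x := fun x hx => by
    by_cases hxr : r ≤ |x - x₀|
    · exact hm.le.trans (hmf x hx hxr)
    · refine le_trans ?_ (hrf x (by simpa [hB, Real.dist_eq] using hxr))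
      positivity
  -- Away from the minimum `(f - m) (ε⁻² - ε₁⁻²) ≥ 0`, so the small factor `exp (-m / ε²)` splits
  -- off and the fixed integrable function `exp (-f / ε₁²)` remains.
  have hbd : ∀ ε, 0 < ε → ε ≤ ε₁ → ∀ x ∈ I \ B, |g x * Real.exp (-f x / ε ^ 2)| ≤
      M * Real.exp (m / ε₁ ^ 2) * Real.exp (-m / ε ^ 2) * Real.exp (-f x / ε₁ ^ 2) := by
    intro ε hε hεε x hx
    have hx2 : m ≤ f x := hmf x hx.1 (by simpa [hB, Real.dist_eq] using hx.2)
    rw [abs_mul, Real.abs_exp]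
    have : Real.exp (-f x / ε ^ 2) ≤
        Real.exp (m / ε₁ ^ 2) * Real.exp (-m / ε ^ 2) * Real.exp (-f x / ε₁ ^ 2) := by
      rw [← Real.exp_add, ← Real.exp_add, Real.exp_le_exp]
      have h1 : (ε₁ ^ 2)⁻¹ ≤ (ε ^ 2)⁻¹ := by gcongr
      simp only [div_eq_mul_inv]
      nlinarith
    calc |g x| * Real.exp (-f x / ε ^ 2) ≤ M * (Real.exp (m / ε₁ ^ 2) * Real.exp (-m / ε ^ 2) *
          Real.exp (-f x / ε₁ ^ 2)) := mul_le_mul (hgM x) this (Real.exp_pos _).le hM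
      _ = _ := by ring
  have hintD : ∀ ε, 0 < ε → ε ≤ ε₁ →
      IntegrableOn (fun x => g x * Real.exp (-f x / ε ^ 2)) (I \ B) := by
    intro ε hε hεε
    refine Integrable.mono' ((hint.mono_set sdiff_subset).const_mul
      (M * Real.exp (m / ε₁ ^ 2) * Real.exp (-m / ε ^ 2))) (hmeas ε).aestronglyMeasurable ?_
    exact (ae_restrict_iff' (hI.diff hBm)).2 (ae_of_all _ fun x hx => hbd ε hε hεε x hx)
  have hintB : ∀ ε, 0 < ε → IntegrableOn (fun x => g x * Real.exp (-f x / ε ^ 2)) B := by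
    intro ε hε
    refine Measure.integrableOn_of_bounded (M := M) Metric.isBounded_ball.measure_lt_top.ne
      (hmeas ε).aestronglyMeasurable ?_
    refine (ae_restrict_iff' hBm).2 (ae_of_all _ fun x hx => ?_)
    rw [norm_mul, Real.norm_eq_abs, Real.norm_eq_abs, Real.abs_exp]
    have : Real.exp (-f x / ε ^ 2) ≤ 1 := by
      rw [Real.exp_le_one_iff, neg_div]
      have := hfI x (hrI hx)
      have : 0 ≤ f x / ε ^ 2 := by positivity
      linarith
    nlinarith [hgM x, Real.exp_pos (-f x / ε ^ 2), abs_nonneg (g x)]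
  have hpos : ∀ᶠ ε : ℝ in 𝓝[>] 0, 0 < ε := self_mem_nhdsWithin
  have hle : ∀ᶠ ε : ℝ in 𝓝[>] 0, ε ≤ ε₁ :=
    mem_nhdsWithin_of_mem_nhds (Iic_mem_nhds hε₁)
  have hout : Tendsto (fun ε => ε⁻¹ * ∫ x in I \ B, g x * Real.exp (-f x / ε ^ 2)) (𝓝[>] 0)
      (𝓝 0) := by
    set K := M * Real.exp (m / ε₁ ^ 2) * ∫ x in I \ B, Real.exp (-f x / ε₁ ^ 2) with hK
    have hlim : Tendsto (fun ε : ℝ => K * (ε / m)) (𝓝[>] 0) (𝓝 0) := by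
      have : Tendsto (fun ε : ℝ => K * (ε / m)) (𝓝 0) (𝓝 (K * (0 / m))) :=
        (continuous_const.mul (continuous_id.div_const m)).tendsto 0
      simpa using this.mono_left nhdsWithin_le_nhds
    refine squeeze_zero_norm' ?_ hlim
    filter_upwards [hpos, hle] with ε hε hεε
    have hK0 : 0 ≤ K := by positivity
    have h1 : ‖∫ x in I \ B, g x * Real.exp (-f x / ε ^ 2)‖ ≤ K * Real.exp (-m / ε ^ 2) := by
      refine (norm_integral_le_of_norm_le ((hint.mono_set sdiff_subset).const_mul
        (M * Real.exp (m / ε₁ ^ 2) * Real.exp (-m / ε ^ 2)))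
        ((ae_restrict_iff' (hI.diff hBm)).2 (ae_of_all _ fun x hx => hbd ε hε hεε x hx))).trans ?_
      rw [integral_const_mul, hK]
      exact le_of_eq (by ring)
    rw [norm_mul, norm_inv, Real.norm_of_nonneg hε.le]
    calc ε⁻¹ * ‖∫ x in I \ B, g x * Real.exp (-f x / ε ^ 2)‖
        ≤ ε⁻¹ * (K * Real.exp (-m / ε ^ 2)) := by gcongr
      _ = K * (ε⁻¹ * Real.exp (-m / ε ^ 2)) := by ring
      _ ≤ K * (ε / m) := by gcongr; exact inv_mul_exp_neg_div_sq_le hm hε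
  -- The substitution `x = x₀ + ε y` absorbs the prefactor `ε⁻¹`.
  have hscale : ∀ ε, 0 < ε → ε⁻¹ * ∫ x in B, g x * Real.exp (-f x / ε ^ 2) =
      ∫ y, B.indicator (fun x => g x * Real.exp (-f x / ε ^ 2)) (x₀ + ε * y) := by
    intro ε hε
    rw [Measure.integral_comp_mul_left
      (fun z => B.indicator (fun x => g x * Real.exp (-f x / ε ^ 2)) (x₀ + z)),
      integral_add_left_eq_self, integral_indicator hBm, abs_of_pos (by positivity), smul_eq_mul]
  have hin : Tendsto (fun ε => ε⁻¹ * ∫ x in B, g x * Real.exp (-f x / ε ^ 2)) (𝓝[>] 0)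
      (𝓝 (∫ y, g x₀ * Real.exp (-(a / 2) * y ^ 2))) := by
    refine Tendsto.congr' (f₁ := fun ε =>
      ∫ y, B.indicator (fun x => g x * Real.exp (-f x / ε ^ 2)) (x₀ + ε * y)) ?_ ?_
    · filter_upwards [hpos] with ε hε using (hscale ε hε).symm
    · refine tendsto_integral_filter_of_dominated_convergence
        (fun y => M * Real.exp (-(a / 4) * y ^ 2)) ?_ ?_ ?_ ?_
      · refine Eventually.of_forall fun ε => ?_
        exact (((hmeas ε).indicator hBm).comp (by fun_prop)).aestronglyMeasurable
      · filter_upwards [hpos] with ε hε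
        refine ae_of_all _ fun y => ?_
        by_cases hy : x₀ + ε * y ∈ B
        · rw [indicator_of_mem hy, norm_mul, Real.norm_eq_abs, Real.norm_eq_abs, Real.abs_exp]
          refine mul_le_mul (hgM _) ?_ (Real.exp_pos _).le hM
          rw [Real.exp_le_exp, neg_div, neg_mul, neg_le_neg_iff, le_div_iff₀ (by positivity)]
          have := hrf _ hy
          rw [add_sub_cancel_left] at this
          linarith
        · rw [indicator_of_notMem hy, norm_zero]; positivity
      · exact (integrable_exp_neg_mul_sq (by positivity)).const_mul M
      · refine ae_of_all _ fun y => ?_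
        have hlin : Tendsto (fun ε : ℝ => x₀ + ε * y) (𝓝[>] 0) (𝓝 x₀) := by
          have : Tendsto (fun ε : ℝ => x₀ + ε * y) (𝓝 0) (𝓝 (x₀ + 0 * y)) :=
            (Continuous.tendsto (by fun_prop) 0)
          simpa using this.mono_left nhdsWithin_le_nhds
        have hmem : ∀ᶠ ε : ℝ in 𝓝[>] 0, x₀ + ε * y ∈ B :=
          hlin.eventually (Metric.ball_mem_nhds x₀ hr)
        refine Tendsto.congr' (f₁ := fun ε : ℝ =>
          g (x₀ + ε * y) * Real.exp (-f (x₀ + ε * y) / ε ^ 2)) ?_ ?_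
        · filter_upwards [hmem] with ε hε
          rw [indicator_of_mem hε]
        · refine (hgc.tendsto.comp hlin).mul ((Real.continuous_exp.tendsto _).comp ?_)
          by_cases hy : y = 0
          · simp [hy, hf0]
          · have h2 : Tendsto (fun ε : ℝ => x₀ + ε * y) (𝓝[>] 0) (𝓝[≠] x₀) := by
              refine tendsto_nhdsWithin_iff.2 ⟨hlin, ?_⟩
              filter_upwards [hpos] with ε hε
              simp [hε.ne', hy]
            have h3 := (hfx.comp h2).mul_const (-y ^ 2)
            rw [show a / 2 * -y ^ 2 = -(a / 2) * y ^ 2 by ring] at h3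
            refine h3.congr' ?_
            filter_upwards [hpos] with ε hε
            simp only [Function.comp]
            field_simp
            ring
  have hsum := hin.add hout
  rw [integral_const_mul, integral_gaussian, add_zero,
    show Real.pi / (a / 2) = 2 * Real.pi / a by field_simp] at hsum
  refine hsum.congr' ?_
  filter_upwards [hpos, hle] with ε hε hεε
  rw [← mul_add, ← setIntegral_union disjoint_sdiff_right (hI.diff hBm) (hintB ε hε)
    (hintD ε hε hεε), union_sdiff_cancel hrI]

/-! ### The double well and its Gibbs measure -/

lemma gam_le_gam {H : ℝ → ℝ} {ε x y : ℝ} (h : H y ≤ H x) : gam H ε x ≤ gam H ε y := by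
  have hZ : 0 ≤ partitionFn H ε := integral_nonneg fun x => (Real.exp_pos _).le
  unfold gam
  gcongr

namespace IsDoubleWell

variable {H : ℝ → ℝ}

lemma continuous (hH : IsDoubleWell H) : Continuous H := hH.smooth.continuous

lemma differentiable (hH : IsDoubleWell H) : Differentiable ℝ H :=
  hH.smooth.differentiable (by simp)

lemma abs_eq (hH : IsDoubleWell H) (x : ℝ) : H |x| = H x := by
  rcases abs_choice x with h | h <;> rw [h]
  exact hH.even x

lemma strictAntiOn (hH : IsDoubleWell H) : StrictAntiOn H (Icc 0 1) := by
  refine strictAntiOn_of_deriv_neg (convex_Icc 0 1) hH.continuous.continuousOn fun x hx => ?_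
  rw [interior_Icc] at hx
  have := hH.decreasing_inside x (abs_pos.2 hx.1.ne') (by rw [abs_of_pos hx.1]; exact hx.2)
  by_contra! h
  exact absurd this (not_lt.2 (mul_nonneg hx.1.le h))

lemma strictMonoOn (hH : IsDoubleWell H) : StrictMonoOn H (Ici 1) := by
  refine strictMonoOn_of_deriv_pos (convex_Ici 1) hH.continuous.continuousOn fun x hx => ?_
  rw [interior_Ici] at hx
  have hx1 : (1 : ℝ) < x := hx
  have := hH.increasing_outside x (by rw [abs_of_pos (by linarith)]; exact hx1)
  exact (pos_iff_pos_of_mul_pos this).1 (by linarith)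

/-- By monotonicity of `H` on `[0, 1]` and on `[1, ∞)`, the infimum off the ball is attained at its
end points. Truncating `r` at `1` keeps `1 - r` in `[0, 1]`. This is the separation hypothesis of
`tendsto_laplace` at the well. -/
lemma exists_pos_le_of_le_abs_sub_one (hH : IsDoubleWell H) {r : ℝ} (hr : 0 < r) :
    ∃ m > 0, ∀ x ∈ Ioi (0 : ℝ), r ≤ |x - 1| → m ≤ H x := by
  set r' := min r 1
  have hr' : 0 < r' := lt_min hr one_pos
  have hr1 : r' ≤ 1 := min_le_right _ _
  have h1 : 0 < H (1 - r') := by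
    rw [← hH.at_wells.1]
    exact hH.strictAntiOn ⟨by linarith, by linarith⟩ ⟨zero_le_one, le_rfl⟩ (by linarith)
  have h2 : 0 < H (1 + r') := by
    rw [← hH.at_wells.1]
    exact hH.strictMonoOn (mem_Ici.2 le_rfl) (mem_Ici.2 (by linarith)) (by linarith)
  refine ⟨min (H (1 - r')) (H (1 + r')), lt_min h1 h2, fun x hx hxr => ?_⟩
  have hxr' : r' ≤ |x - 1| := (min_le_left _ _).trans hxr
  rcases le_abs.1 hxr' with h | h
  · exact (min_le_right _ _).trans (hH.strictMonoOn.monotoneOn (mem_Ici.2 (by linarith))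
      (mem_Ici.2 (by linarith)) (by linarith))
  · exact (min_le_left _ _).trans (hH.strictAntiOn.antitoneOn ⟨(mem_Ioi.1 hx).le, by linarith⟩
      ⟨by linarith, by linarith⟩ (by linarith))

/-- The separation hypothesis of `tendsto_laplace` for `1 - H` at the barrier top, by evenness and
monotonicity on `[0, 1]`. -/
lemma exists_pos_le_one_sub (hH : IsDoubleWell H) {r : ℝ} (hr : 0 < r) :
    ∃ m > 0, ∀ x ∈ Ioc (-1 : ℝ) 1, r ≤ |x - 0| → m ≤ 1 - H x := by
  set r' := min r 1
  have hr' : 0 < r' := lt_min hr one_pos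
  have hr1 : r' ≤ 1 := min_le_right _ _
  have h1 : H r' < 1 := by
    rw [← hH.at_barrier]
    exact hH.strictAntiOn ⟨le_rfl, zero_le_one⟩ ⟨hr'.le, hr1⟩ hr'
  refine ⟨1 - H r', by linarith, fun x hx hxr => ?_⟩
  rw [sub_zero] at hxr
  have := hH.strictAntiOn.antitoneOn ⟨hr'.le, hr1⟩ ⟨abs_nonneg x, abs_le.2 ⟨hx.1.le, hx.2⟩⟩
    ((min_le_left _ _).trans hxr)
  rw [hH.abs_eq] at this
  linarith

/-- Laplace asymptotics at the well `1`. -/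
lemma tendsto_right_well (hH : IsDoubleWell H) {ε₁ : ℝ} (hε₁ : 0 < ε₁)
    (hint : Integrable (fun x => Real.exp (-H x / ε₁ ^ 2))) {g : ℝ → ℝ} {M : ℝ}
    (hg : Measurable g) (hgM : ∀ x, |g x| ≤ M) (hgc : ContinuousAt g 1) :
    Tendsto (fun ε => ε⁻¹ * ∫ x in Ioi 0, g x * Real.exp (-H x / ε ^ 2)) (𝓝[>] 0)
      (𝓝 (g 1 * Real.sqrt (2 * Real.pi / deriv (deriv H) 1))) :=
  tendsto_laplace hH.continuous.measurable measurableSet_Ioi (Ioi_mem_nhds one_pos)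
    hH.wells_nondegenerate.1 hH.at_wells.1
    (tendsto_div_sq_of_contDiff (hH.smooth.of_le (by norm_cast)) hH.at_wells.1
      hH.deriv_at_wells.1) (fun _ hr => hH.exists_pos_le_of_le_abs_sub_one hr) hε₁
    hint.integrableOn hg hgM hgc

/-- Evenness of `H` reflects the left half-line onto the right one. Continuity of `g` is asked only
at the wells, so that sign and indicator functions are admissible. -/
lemma tendsto_both_wells (hH : IsDoubleWell H) {ε₁ : ℝ} (hε₁ : 0 < ε₁)
    (hint : Integrable (fun x => Real.exp (-H x / ε₁ ^ 2))) {g : ℝ → ℝ} {M : ℝ}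
    (hg : Measurable g) (hgM : ∀ x, |g x| ≤ M) (hgc : ContinuousAt g 1)
    (hgc' : ContinuousAt g (-1)) :
    Tendsto (fun ε => ε⁻¹ * ∫ x, g x * Real.exp (-H x / ε ^ 2)) (𝓝[>] 0)
      (𝓝 ((g 1 + g (-1)) * Real.sqrt (2 * Real.pi / deriv (deriv H) 1))) := by
  have h1 := hH.tendsto_right_well hε₁ hint hg hgM hgc
  have h2 := hH.tendsto_right_well hε₁ hint (g := fun x => g (-x)) (hg.comp measurable_neg)
    (fun x => hgM (-x)) (ContinuousAt.comp (f := fun x : ℝ => -x) hgc' continuousAt_neg)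
  have h3 := h1.add h2
  rw [← add_mul] at h3
  refine h3.congr' ?_
  have hpos : ∀ᶠ ε : ℝ in 𝓝[>] 0, 0 < ε := self_mem_nhdsWithin
  have hle : ∀ᶠ ε : ℝ in 𝓝[>] 0, ε ≤ ε₁ := mem_nhdsWithin_of_mem_nhds (Iic_mem_nhds hε₁)
  filter_upwards [hpos, hle] with ε hε hεε
  have hi : Integrable (fun x => g x * Real.exp (-H x / ε ^ 2)) := by
    refine Integrable.mono' (hint.const_mul M) (hg.mul
      ((hH.continuous.measurable.neg.div_const _).exp)).aestronglyMeasurable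
      (ae_of_all _ fun x => ?_)
    rw [norm_mul, Real.norm_eq_abs, Real.norm_eq_abs, Real.abs_exp]
    refine mul_le_mul (hgM x) ?_ (Real.exp_pos _).le ((abs_nonneg _).trans (hgM x))
    rw [Real.exp_le_exp, neg_div, neg_div, neg_le_neg_iff]
    have := hH.nonneg x
    gcongr
  rw [← mul_add, ← intervalIntegral.integral_Iic_add_Ioi hi.integrableOn hi.integrableOn (b := 0),
    add_comm]
  congr 2
  have := integral_comp_neg_Iic (0 : ℝ) (fun x => g (-x) * Real.exp (-H x / ε ^ 2))
  simpa [hH.even] using this.symm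

lemma exp_integrable_of_le (hH : IsDoubleWell H) {ε₁ ε : ℝ} (hε : 0 < ε) (hε₁ : ε ≤ ε₁)
    (hint : Integrable (fun x => Real.exp (-H x / ε₁ ^ 2))) :
    Integrable (fun x => Real.exp (-H x / ε ^ 2)) := by
  refine Integrable.mono' hint (hH.continuous.neg.div_const _).rexp.aestronglyMeasurable
    (ae_of_all _ fun x => ?_)
  rw [Real.norm_eq_abs, Real.abs_exp, Real.exp_le_exp, neg_div, neg_div, neg_le_neg_iff]
  have := hH.nonneg x
  gcongr

lemma contDiff_gam (hH : IsDoubleWell H) (ε : ℝ) : ContDiff ℝ ∞ (gam H ε) :=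
  contDiff_const.mul (hH.smooth.neg.div_const _).exp

lemma continuous_gam (hH : IsDoubleWell H) (ε : ℝ) : Continuous (gam H ε) :=
  (hH.contDiff_gam ε).continuous

lemma gam_neg (hH : IsDoubleWell H) (ε x : ℝ) : gam H ε (-x) = gam H ε x := by
  simp [gam, hH.even]

lemma gam_monotoneOn (hH : IsDoubleWell H) (ε : ℝ) : MonotoneOn (gam H ε) (Icc 0 1) :=
  fun _ hx _ hy hxy => gam_le_gam (hH.strictAntiOn.antitoneOn hx hy hxy)

lemma gam_antitoneOn (hH : IsDoubleWell H) (ε : ℝ) : AntitoneOn (gam H ε) (Ici 1) :=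
  fun _ hx _ hy hxy => gam_le_gam (hH.strictMonoOn.monotoneOn hx hy hxy)

end IsDoubleWell

section Gibbs

variable {H : ℝ → ℝ} {ε : ℝ}

lemma partitionFn_pos (hint : Integrable (fun x => Real.exp (-H x / ε ^ 2))) :
    0 < partitionFn H ε := integral_exp_pos hint

lemma gam_pos (hint : Integrable (fun x => Real.exp (-H x / ε ^ 2))) (x : ℝ) : 0 < gam H ε x :=
  mul_pos (inv_pos.2 (partitionFn_pos hint)) (Real.exp_pos _)

lemma integrable_gam (hint : Integrable (fun x => Real.exp (-H x / ε ^ 2))) :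
    Integrable (gam H ε) := hint.const_mul _

lemma integral_gam (hint : Integrable (fun x => Real.exp (-H x / ε ^ 2))) :
    ∫ x, gam H ε x = 1 := by
  unfold gam
  rw [integral_const_mul]
  exact inv_mul_cancel₀ (partitionFn_pos hint).ne'

lemma tau_pos (hε : 0 < ε) : 0 < tau ε := mul_pos (by positivity) (Real.exp_pos _)

end Gibbs

lemma tendsto_tau : Tendsto tau (𝓝[>] 0) (𝓝 0) := by
  have h1 : Tendsto (fun ε : ℝ => (ε ^ 2)⁻¹) (𝓝[>] 0) atTop := by
    refine Tendsto.inv_tendsto_nhdsGT_zero ?_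
    refine tendsto_nhdsWithin_iff.2 ⟨?_, ?_⟩
    · have : Tendsto (fun ε : ℝ => ε ^ 2) (𝓝 0) (𝓝 (0 ^ 2)) := (continuous_pow 2).tendsto 0
      simpa using this.mono_left nhdsWithin_le_nhds
    · filter_upwards [self_mem_nhdsWithin] with ε hε
      have : (0 : ℝ) < ε := hε
      simpa using (by positivity : 0 < ε ^ 2)
  have h2 := (Real.tendsto_pow_mul_exp_neg_atTop_nhds_zero 1).comp h1
  refine h2.congr fun ε => ?_
  simp [tau, neg_div]

/-! ### Concentration of the Gibbs measure and Kramers' formula -/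

namespace IsDoubleWell

variable {H : ℝ → ℝ}

lemma tendsto_partitionFn (hH : IsDoubleWell H) {ε₁ : ℝ} (hε₁ : 0 < ε₁)
    (hint : Integrable (fun x => Real.exp (-H x / ε₁ ^ 2))) :
    Tendsto (fun ε => ε⁻¹ * partitionFn H ε) (𝓝[>] 0)
      (𝓝 (2 * Real.sqrt (2 * Real.pi / deriv (deriv H) 1))) := by
  have := hH.tendsto_both_wells hε₁ hint (g := fun _ => 1) (M := 1) measurable_const (by simp)
    continuousAt_const continuousAt_const
  simpa [partitionFn, one_add_one_eq_two] using this

lemma sqrt_well_pos (hH : IsDoubleWell H) :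
    0 < Real.sqrt (2 * Real.pi / deriv (deriv H) 1) :=
  Real.sqrt_pos.2 (div_pos (by positivity) hH.wells_nondegenerate.1)

/-- The invariant measures concentrate equally on the two wells. -/
lemma tendsto_integral_mul_gam (hH : IsDoubleWell H) {ε₁ : ℝ} (hε₁ : 0 < ε₁)
    (hint : Integrable (fun x => Real.exp (-H x / ε₁ ^ 2))) {g : ℝ → ℝ} {M : ℝ}
    (hg : Measurable g) (hgM : ∀ x, |g x| ≤ M) (hgc : ContinuousAt g 1)
    (hgc' : ContinuousAt g (-1)) :
    Tendsto (fun ε => ∫ x, g x * gam H ε x) (𝓝[>] 0) (𝓝 ((g 1 + g (-1)) / 2)) := by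
  have hs := hH.sqrt_well_pos
  rw [show (g 1 + g (-1)) / 2 = (g 1 + g (-1)) * Real.sqrt (2 * Real.pi / deriv (deriv H) 1) /
    (2 * Real.sqrt (2 * Real.pi / deriv (deriv H) 1)) by field_simp]
  refine ((hH.tendsto_both_wells hε₁ hint hg hgM hgc hgc').div
    (hH.tendsto_partitionFn hε₁ hint) (by positivity)).congr' ?_
  filter_upwards [self_mem_nhdsWithin] with ε hε
  have hε' : (0 : ℝ) < ε := hε
  simp only [gam, Pi.div_apply]
  rw [mul_div_mul_left _ _ (by positivity), div_eq_inv_mul, ← integral_const_mul]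
  congr 1; ext x; ring

/-- The effective conductance `2 / ∫_{-1}^1 γ⁻¹` of the barrier. -/
def _root_.KramersLimit.conductance (H : ℝ → ℝ) (ε : ℝ) : ℝ :=
  2 / ∫ x in (-1 : ℝ)..1, (gam H ε x)⁻¹

/-- Kramers' formula for the conductance of the barrier. -/
lemma tendsto_conductance_div_tau (hH : IsDoubleWell H) {ε₁ : ℝ} (hε₁ : 0 < ε₁)
    (hint : Integrable (fun x => Real.exp (-H x / ε₁ ^ 2))) :
    Tendsto (fun ε => conductance H ε / tau ε) (𝓝[>] 0) (𝓝 (rate H / 2)) := by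
  have hs := hH.sqrt_well_pos
  have ha : 0 < -deriv (deriv H) 0 := neg_pos.2 hH.barrier_nondegenerate
  have hb := hH.wells_nondegenerate.1
  have hd1 : deriv (fun x => 1 - H x) = fun x => -deriv H x := by
    ext x; rw [deriv_const_sub]
  have hd2 : deriv (deriv fun x => 1 - H x) 0 = -deriv (deriv H) 0 := by
    rw [hd1]; exact deriv.fun_neg
  have hL := tendsto_laplace (f := fun x => 1 - H x) (g := fun _ => 1) (I := Ioc (-1) 1) (x₀ := 0)
    (a := -deriv (deriv H) 0) (ε₁ := 1) (M := 1) (measurable_const.sub hH.continuous.measurable)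
    measurableSet_Ioc (Ioc_mem_nhds (by norm_num) (by norm_num)) ha (by simp [hH.at_barrier])
    (hd2 ▸ tendsto_div_sq_of_contDiff (contDiff_const.sub (hH.smooth.of_le
      (by norm_cast))) (by simp [hH.at_barrier]) (by rw [hd1]; simp [hH.deriv_at_zero]))
    (fun r hr => hH.exists_pos_le_one_sub hr) one_pos
    ((by have := hH.continuous; fun_prop : Continuous fun x => Real.exp (-(1 - H x) / 1 ^ 2)).integrableOn_Ioc)
    measurable_const (by simp) continuousAt_const
  set s₀ := Real.sqrt (2 * Real.pi / -deriv (deriv H) 0) with hs₀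
  set s₁ := Real.sqrt (2 * Real.pi / deriv (deriv H) 1) with hs₁
  have hs₀pos : 0 < s₀ := Real.sqrt_pos.2 (div_pos (by positivity) ha)
  -- The two Gaussian factors multiply to `2π / √(|H''(0)| H''(1))`, which is `2 / k`.
  have hr : rate H / 2 = 2 / ((2 * s₁) * (1 * s₀)) := by
    have e1 : s₁ * s₀ * Real.sqrt (|deriv (deriv H) 0| * deriv (deriv H) 1) = 2 * Real.pi := by
      rw [hs₀, hs₁, ← Real.sqrt_mul (by positivity), ← Real.sqrt_mul (by positivity),
        abs_of_neg hH.barrier_nondegenerate]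
      rw [Real.sqrt_eq_iff_mul_self_eq_of_pos (by positivity)]
      have hne := hH.barrier_nondegenerate.ne
      field_simp
    unfold rate
    have hpi := Real.pi_pos
    field_simp
    linarith
  rw [hr]
  refine (tendsto_const_nhds.div ((hH.tendsto_partitionFn hε₁ hint).mul hL)
    (by positivity)).congr' ?_
  have hle : ∀ᶠ ε : ℝ in 𝓝[>] 0, ε ≤ ε₁ := mem_nhdsWithin_of_mem_nhds (Iic_mem_nhds hε₁)
  filter_upwards [self_mem_nhdsWithin, hle] with ε hε hεε
  have hε' : (0 : ℝ) < ε := hε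
  have hZ := partitionFn_pos (hH.exp_integrable_of_le hε' hεε hint)
  -- Since `H = 1` at the barrier top, `γ⁻¹ = Z e^{1/ε²} e^{-(1-H)/ε²}`. The factor `e^{1/ε²}`
  -- cancels against `τ`, whose `ε⁻²` supplies one power of `ε⁻¹` for each of the two Laplace
  -- integrals.
  have e2 : ∫ x in (-1 : ℝ)..1, (gam H ε x)⁻¹ =
      partitionFn H ε * Real.exp (1 / ε ^ 2) * ∫ x in Ioc (-1 : ℝ) 1,
        1 * Real.exp (-(1 - H x) / ε ^ 2) := by
    rw [intervalIntegral.integral_of_le (by norm_num), ← integral_const_mul]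
    congr 1; ext x
    rw [gam, mul_inv, inv_inv, one_mul, mul_assoc, ← Real.exp_add, ← Real.exp_neg]
    congr 2
    ring
  simp only [conductance, tau, e2, Pi.div_apply]
  rw [neg_div, Real.exp_neg]
  have := (Real.exp_pos (1 / ε ^ 2)).ne'
  rw [div_div]
  congr 1
  field_simp

lemma rate_pos (hH : IsDoubleWell H) : 0 < rate H :=
  mul_pos (inv_pos.2 Real.pi_pos) (Real.sqrt_pos.2 (mul_pos
    (abs_pos.2 hH.barrier_nondegenerate.ne) hH.wells_nondegenerate.1))

end IsDoubleWell

/-! ### Gradient flows of quadratic forms in a Hilbert space, integrated in time -/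

section

variable {X : Type*} [NormedAddCommGroup X] [InnerProductSpace ℝ X]

/-- A `C¹` path `V` with derivative `V'` that solves `τ V' = τ a - D* D V`, where `G` is the graph
of the operator `D` and `Q = D V`. -/
structure IsFormFlow (G : Submodule ℝ (X × X)) (τ : ℝ) (a : X) (V V' Q : ℝ → X) : Prop where
  hasDerivAt : ∀ t, HasDerivAt V (V' t) t
  continuous : Continuous V'
  mem_graph : ∀ t, 0 ≤ t → (V t, Q t) ∈ G
  weak : ∀ t, 0 ≤ t → ∀ p ∈ G, τ * ⟪V' t - a, p.1⟫ = -⟪Q t, p.2⟫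

namespace IsFormFlow

variable {G : Submodule ℝ (X × X)} {τ : ℝ} {a : X} {V V' Q : ℝ → X}

lemma continuous_path (h : IsFormFlow G τ a V V' Q) : Continuous V :=
  continuous_iff_continuousAt.2 fun t => (h.hasDerivAt t).continuousAt

/-- The equations at `s` and `t` are both tested with the increment `(V s - V t, Q s - Q t)`, and
`⟪Q s + Q t, Q s - Q t⟫` telescopes. The right side involves `V` and `V'` only, so `‖Q‖²` becomes
differentiable without any assumed regularity of `Q`. -/
lemma norm_sq_sub (h : IsFormFlow G τ a V V' Q) {s t : ℝ} (hs : 0 ≤ s) (ht : 0 ≤ t) :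
    ‖Q s‖ ^ 2 = ‖Q t‖ ^ 2 - τ * ⟪(V' s - a) + (V' t - a), V s - V t⟫ := by
  have hm : (V s - V t, Q s - Q t) ∈ G := G.sub_mem (h.mem_graph s hs) (h.mem_graph t ht)
  have h1 := h.weak s hs _ hm
  have h2 := h.weak t ht _ hm
  simp only at h1 h2
  rw [inner_add_left, mul_add, h1, h2]
  simp only [inner_sub_right, real_inner_self_eq_norm_sq]
  rw [real_inner_comm (Q s) (Q t)]
  ring

lemma continuousOn_norm_sq (h : IsFormFlow G τ a V V' Q) :
    ContinuousOn (fun t => ‖Q t‖ ^ 2) (Ici 0) := by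
  have h1 : Continuous fun s => ‖Q 0‖ ^ 2 - τ * ⟪(V' s - a) + (V' 0 - a), V s - V 0⟫ := by
    have := h.continuous
    have := h.continuous_path
    fun_prop
  exact h1.continuousOn.congr fun s hs => h.norm_sq_sub hs le_rfl

/-- Divide `norm_sq_sub` by `s - t`: the sum of velocities is continuous and the difference quotient
of `V` converges. -/
lemma hasDerivAt_norm_sq (h : IsFormFlow G τ a V V' Q) {t : ℝ} (ht : 0 < t) :
    HasDerivAt (fun t => ‖Q t‖ ^ 2) (-2 * τ * ⟪V' t - a, V' t⟫) t := by
  have key : HasDerivAt (fun s => ⟪(V' s - a) + (V' t - a), V s - V t⟫)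
      (2 * ⟪V' t - a, V' t⟫) t := by
    rw [hasDerivAt_iff_tendsto_slope]
    have h1 := hasDerivAt_iff_tendsto_slope.1 (h.hasDerivAt t)
    have h2 : Tendsto (fun s => (V' s - a) + (V' t - a)) (𝓝[≠] t)
        (𝓝 ((V' t - a) + (V' t - a))) := by
      have hc : Continuous fun s => (V' s - a) + (V' t - a) := by
        have := h.continuous
        fun_prop
      exact (hc.tendsto t).mono_left nhdsWithin_le_nhds
    have h3 := h2.inner h1 (𝕜 := ℝ)
    rw [inner_add_left, ← two_mul] at h3
    refine h3.congr fun s => ?_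
    simp [slope, inner_smul_right]
  have h2 := (key.const_mul τ).const_sub (‖Q t‖ ^ 2)
  refine (h2.congr_deriv (by ring)).congr_of_eventuallyEq ?_
  filter_upwards [lt_mem_nhds ht] with s hs using h.norm_sq_sub hs.le ht.le

/-- The dissipation estimate for initial data in the form domain. -/
lemma norm_le_mul (h : IsFormFlow G τ a V V' Q) (hτ : 0 ≤ τ) (hQ : Q 0 = 0) {b : X}
    (hab : (a, b) ∈ G) {t : ℝ} (ht : 0 ≤ t) : ‖Q t‖ ≤ t * ‖b‖ := by
  refine le_of_forall_pos_le_add fun δ hδ => ?_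
  have hpos : ∀ s, 0 < ‖Q s‖ ^ 2 + δ ^ 2 := fun s => by positivity
  -- Formally `d‖Q‖/dt ≤ ‖b‖`. The `δ²` under the root keeps it differentiable where `Q` vanishes,
  -- in particular at time `0`.
  have hanti : AntitoneOn (fun s => Real.sqrt (‖Q s‖ ^ 2 + δ ^ 2) - s * ‖b‖) (Ici 0) := by
    refine antitoneOn_of_hasDerivWithinAt_nonpos (f' := fun s =>
        -2 * τ * ⟪V' s - a, V' s⟫ / (2 * Real.sqrt (‖Q s‖ ^ 2 + δ ^ 2)) - 1 * ‖b‖) (convex_Ici 0)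
      ((h.continuousOn_norm_sq.add continuousOn_const).sqrt.sub (by fun_prop)) ?_ ?_
    · intro s hs
      rw [interior_Ici] at hs
      exact (((h.hasDerivAt_norm_sq hs).add_const _).sqrt (hpos s).ne').sub
        ((hasDerivAt_id s).mul_const _) |>.hasDerivWithinAt
    · intro s hs
      rw [interior_Ici] at hs
      have hs' : 0 < s := hs
      have hsq : 0 < Real.sqrt (‖Q s‖ ^ 2 + δ ^ 2) := Real.sqrt_pos.2 (hpos s)
      have hw := h.weak s hs'.le _ hab
      simp only at hw
      have e : ⟪V' s - a, V' s⟫ = ‖V' s - a‖ ^ 2 + ⟪V' s - a, a⟫ := by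
        rw [← real_inner_self_eq_norm_sq, ← inner_add_right, sub_add_cancel]
      -- The square is dissipated. The cross term is controlled by testing with `(a, b)`, which
      -- gives `-τ⟪V' - a, a⟫ = ⟪Q, b⟫`.
      have h1 : -2 * τ * ⟪V' s - a, V' s⟫ ≤ 2 * (‖Q s‖ * ‖b‖) := by
        have h3 := real_inner_le_norm (Q s) b
        have : 0 ≤ τ * ‖V' s - a‖ ^ 2 := by positivity
        rw [e]
        nlinarith
      have h2 : ‖Q s‖ ≤ Real.sqrt (‖Q s‖ ^ 2 + δ ^ 2) :=
        Real.le_sqrt_of_sq_le (by nlinarith [sq_nonneg δ])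
      rw [sub_nonpos, div_le_iff₀ (by positivity)]
      nlinarith [mul_le_mul_of_nonneg_right h2 (norm_nonneg b)]
  have h1 := hanti (mem_Ici.2 le_rfl) (mem_Ici.2 ht) ht
  have h2 : ‖Q t‖ ≤ Real.sqrt (‖Q t‖ ^ 2 + δ ^ 2) :=
    Real.le_sqrt_of_sq_le (by nlinarith [sq_nonneg δ])
  simp only [hQ, norm_zero, zero_mul, sub_zero] at h1
  rw [zero_pow two_ne_zero, zero_add, Real.sqrt_sq hδ.le] at h1
  linarith

/-- Testing with the flow itself, `τ d‖V‖²/dt = -2 ‖Q‖² ≤ 0`. -/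
lemma norm_path_le (h : IsFormFlow G τ 0 V V' Q) (hτ : 0 < τ) {t : ℝ} (ht : 0 ≤ t) :
    ‖V t‖ ≤ ‖V 0‖ := by
  have hanti : AntitoneOn (fun s => ‖V s‖ ^ 2) (Ici 0) := by
    refine antitoneOn_of_hasDerivWithinAt_nonpos (f' := fun s => 2 * ⟪V s, V' s⟫) (convex_Ici 0)
      (h.continuous_path.norm.pow 2).continuousOn
      (fun s _ => (h.hasDerivAt s).norm_sq.hasDerivWithinAt) ?_
    intro s hs
    rw [interior_Ici] at hs
    have hw := h.weak s (le_of_lt hs) _ (h.mem_graph s (le_of_lt hs))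
    simp only [sub_zero, real_inner_self_eq_norm_sq] at hw
    rw [real_inner_comm]
    have : τ * ⟪V' s, V s⟫ ≤ 0 := by rw [hw]; simp
    by_contra! hc
    have : 0 < τ * ⟪V' s, V s⟫ := mul_pos hτ (by linarith)
    linarith
  have h1 := hanti (mem_Ici.2 le_rfl) (mem_Ici.2 ht) ht
  exact (pow_le_pow_iff_left₀ (norm_nonneg _) (norm_nonneg _) two_ne_zero).1 h1

/-- For `a = 0` the derivative of `‖Q‖²` is exactly `-2τ‖V'‖²`; integrate and drop `‖Q T‖²`. -/
lemma integral_norm_sq_deriv_le (h : IsFormFlow G τ 0 V V' Q) {T : ℝ} (hT : 0 ≤ T) :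
    2 * τ * ∫ t in (0 : ℝ)..T, ‖V' t‖ ^ 2 ≤ ‖Q 0‖ ^ 2 := by
  have h1 := intervalIntegral.integral_eq_sub_of_hasDerivAt_of_le
    (f := fun t => ‖Q t‖ ^ 2) (f' := fun t => -2 * τ * ⟪V' t - 0, V' t⟫) hT
    (h.continuousOn_norm_sq.mono Icc_subset_Ici_self)
    (fun t ht => h.hasDerivAt_norm_sq ht.1)
    (Continuous.intervalIntegrable (by have := h.continuous; fun_prop) _ _)
  simp only [sub_zero, real_inner_self_eq_norm_sq, intervalIntegral.integral_const_mul] at h1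
  nlinarith [sq_nonneg ‖Q T‖]

/-- Time increments of a flow are flows. -/
lemma increment (h : IsFormFlow G τ a V V' Q) {r : ℝ} (hr : 0 ≤ r) :
    IsFormFlow G τ 0 (fun t => V (t + r) - V t) (fun t => V' (t + r) - V' t)
      (fun t => Q (t + r) - Q t) where
  hasDerivAt t := ((h.hasDerivAt (t + r)).comp_add_const t r).sub (h.hasDerivAt t)
  continuous := by have := h.continuous; fun_prop
  mem_graph t ht := G.sub_mem (h.mem_graph (t + r) (by linarith)) (h.mem_graph t ht)
  weak t ht p hp := by
    have h1 := h.weak (t + r) (by linarith) p hp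
    have h2 := h.weak t ht p hp
    rw [sub_zero, show V' (t + r) - V' t = (V' (t + r) - a) - (V' t - a) by abel,
      inner_sub_left (V' (t + r) - a), inner_sub_left (Q (t + r)), mul_sub, h1, h2]
    ring

/-- Increments solve the flow with `a = 0`, so they do not grow in norm (`norm_path_le`); divide by
`r` and let `r → 0`. No second derivative of `V` is needed. -/
lemma norm_deriv_le (h : IsFormFlow G τ a V V' Q) (hτ : 0 < τ) {t : ℝ}
    (ht : 0 ≤ t) : ‖V' t‖ ≤ ‖V' 0‖ := by
  have key : ∀ s, Tendsto (fun r : ℝ => ‖r⁻¹ • (V (s + r) - V s)‖) (𝓝[>] 0) (𝓝 ‖V' s‖) :=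
    fun s => ((h.hasDerivAt s).tendsto_slope_zero.mono_left
      (nhdsWithin_mono _ fun x hx => (ne_of_gt hx))).norm
  refine le_of_tendsto_of_tendsto (key t) (key 0) ?_
  filter_upwards [self_mem_nhdsWithin] with r hr
  have hr' : (0 : ℝ) < r := hr
  rw [norm_smul, norm_smul]
  exact mul_le_mul_of_nonneg_left ((h.increment hr'.le).norm_path_le hτ ht) (norm_nonneg _)

/-- Square-integrability of difference quotients. -/
lemma integral_norm_sq_increment_le (h : IsFormFlow G τ a V V' Q) (hτ : 0 < τ)
    (hQ : Q 0 = 0) {b : X} (hab : (a, b) ∈ G) {r T : ℝ} (hr : 0 ≤ r) (hT : 0 ≤ T) :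
    ∫ t in (0 : ℝ)..T, ‖V' (t + r) - V' t‖ ^ 2 ≤ r ^ 2 * ‖b‖ ^ 2 / (2 * τ) := by
  have h1 := (h.increment hr).integral_norm_sq_deriv_le hT
  have h2 := h.norm_le_mul hτ.le hQ hab hr
  -- The increment flow starts from `Q r - Q 0 = Q r`, which is at most `r ‖b‖` by `norm_le_mul`.
  simp only [zero_add, hQ, sub_zero] at h1
  rw [le_div_iff₀ (by positivity), ← mul_pow]
  have := pow_le_pow_left₀ (norm_nonneg _) h2 2
  linarith

end IsFormFlow

/-- Weak sequential compactness: a bounded sequence in a Hilbert space has a weak cluster point. -/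
lemma exists_weak_limit [CompleteSpace X] {x : ℕ → X} {R : ℝ} (hx : ∀ n, ‖x n‖ ≤ R) :
    ∃ y, ‖y‖ ≤ R ∧ ∀ z l, Tendsto (fun n => ⟪x n, z⟫) atTop (𝓝 l) → ⟪y, z⟫ = l := by
  have hK := WeakDual.isCompact_closedBall (𝕜 := ℝ) (E := X) 0 R
  let F : ℕ → WeakDual ℝ X := fun n => StrongDual.toWeakDual (InnerProductSpace.toDual ℝ X (x n))
  have hF : ∀ n, F n ∈ WeakDual.toStrongDual ⁻¹' Metric.closedBall (0 : StrongDual ℝ X) R := by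
    intro n
    simp only [F, mem_preimage, Metric.mem_closedBall, dist_zero_right]
    simpa using hx n
  -- Banach-Alaoglu along one ultrafilter, so no subsequence is extracted: a pairing that converges
  -- along the full sequence has the same limit along the ultrafilter.
  obtain ⟨f, hf, hfl⟩ := hK.ultrafilter_le_nhds ((hyperfilter ℕ : Ultrafilter ℕ).map F) (by
    simp only [Ultrafilter.coe_map, le_principal_iff, mem_map]
    exact univ_mem' hF)
  refine ⟨(InnerProductSpace.toDual ℝ X).symm (WeakDual.toStrongDual f), ?_, fun z l hz => ?_⟩
  · rw [LinearIsometryEquiv.norm_map]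
    simpa using hf
  · rw [InnerProductSpace.toDual_symm_apply]
    have h1 : Tendsto F (hyperfilter ℕ : Filter ℕ) (𝓝 f) := hfl
    have h2 := ((WeakDual.eval_continuous z).tendsto f).comp h1
    have h3 : Tendsto (fun n => ⟪x n, z⟫) (hyperfilter ℕ : Filter ℕ) (𝓝 l) :=
      hz.mono_left Nat.hyperfilter_le_atTop
    exact tendsto_nhds_unique h2 h3

end

/-! ### Square-integrable functions as elements of `L²` -/

section L2

variable {α : Type*} [MeasurableSpace α] {μ : Measure α}

open Classical in
/-- The class in `L²` of a square-integrable function (and `0` for other functions). -/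
def toL2 (μ : Measure α) (f : α → ℝ) : Lp ℝ 2 μ := if h : MemLp f 2 μ then h.toLp f else 0

lemma coeFn_toL2 {f : α → ℝ} (h : MemLp f 2 μ) : toL2 μ f =ᵐ[μ] f := by
  rw [toL2, dif_pos h]; exact h.coeFn_toLp

lemma inner_eq_integral {F G : Lp ℝ 2 μ} {f g : α → ℝ} (hf : F =ᵐ[μ] f) (hg : G =ᵐ[μ] g) :
    ⟪F, G⟫ = ∫ x, f x * g x ∂μ := by
  rw [L2.inner_def]
  refine integral_congr_ae ?_
  filter_upwards [hf, hg] with x h1 h2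
  rw [h1, h2]
  simp [mul_comm]

lemma inner_toL2 {f g : α → ℝ} (hf : MemLp f 2 μ) (hg : MemLp g 2 μ) :
    ⟪toL2 μ f, toL2 μ g⟫ = ∫ x, f x * g x ∂μ :=
  inner_eq_integral (coeFn_toL2 hf) (coeFn_toL2 hg)

lemma norm_toL2_sq {f : α → ℝ} (hf : MemLp f 2 μ) : ‖toL2 μ f‖ ^ 2 = ∫ x, f x ^ 2 ∂μ := by
  rw [← real_inner_self_eq_norm_sq, inner_toL2 hf hf]
  simp only [sq]

lemma toL2_sub {f g : α → ℝ} (hf : MemLp f 2 μ) (hg : MemLp g 2 μ) :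
    toL2 μ f - toL2 μ g = toL2 μ (fun x => f x - g x) := by
  refine Lp.ext ?_
  filter_upwards [Lp.coeFn_sub (toL2 μ f) (toL2 μ g), coeFn_toL2 hf, coeFn_toL2 hg,
    coeFn_toL2 (hf.sub hg)] with x h1 h2 h3 h4
  rw [h1, Pi.sub_apply, h2, h3]
  exact h4.symm

lemma toL2_const_mul {f : α → ℝ} (a : ℝ) (hf : MemLp f 2 μ) :
    toL2 μ (fun x => a * f x) = a • toL2 μ f := by
  refine Lp.ext ?_
  filter_upwards [Lp.coeFn_smul a (toL2 μ f), coeFn_toL2 hf, coeFn_toL2 (hf.const_mul a)]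
    with x h1 h2 h3
  rw [h1, Pi.smul_apply, h2, h3, smul_eq_mul]

lemma integrable_mul_of_memLp {f g : α → ℝ} (hf : MemLp f 2 μ) (hg : MemLp g 2 μ) :
    Integrable (fun x => f x * g x) μ := hf.integrable_mul hg

/-- The Cauchy-Schwarz inequality. -/
lemma abs_integral_mul_le {f g : α → ℝ} (hf : MemLp f 2 μ) (hg : MemLp g 2 μ) :
    |∫ x, f x * g x ∂μ| ≤ Real.sqrt (∫ x, f x ^ 2 ∂μ) * Real.sqrt (∫ x, g x ^ 2 ∂μ) := by
  rw [← inner_toL2 hf hg, ← norm_toL2_sq hf, ← norm_toL2_sq hg, Real.sqrt_sq (norm_nonneg _),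
    Real.sqrt_sq (norm_nonneg _)]
  exact abs_real_inner_le_norm _ _

lemma sq_integral_le [IsFiniteMeasure μ] {f : α → ℝ} (hf : MemLp f 2 μ) :
    (∫ x, f x ∂μ) ^ 2 ≤ μ.real univ * ∫ x, f x ^ 2 ∂μ := by
  have h := abs_integral_mul_le hf (memLp_const (1 : ℝ))
  have h0 : 0 ≤ ∫ x, f x ^ 2 ∂μ := integral_nonneg fun x => sq_nonneg _
  simp only [mul_one, one_pow, integral_const, smul_eq_mul] at h
  rw [← Real.sqrt_mul h0] at h
  have h1 := (Real.le_sqrt (abs_nonneg _) (by positivity)).1 h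
  rw [sq_abs] at h1
  linarith

lemma memLp_two_of_integrable_sq {f : α → ℝ} (hf : AEStronglyMeasurable f μ)
    (h : Integrable (fun x => f x ^ 2) μ) : MemLp f 2 μ :=
  (memLp_two_iff_integrable_sq hf).2 h

variable {β : Type*} [MeasurableSpace β] {ν : Measure β} [IsFiniteMeasure μ] [SFinite ν]

/-- Integration over a finite first factor preserves square-integrability. -/
lemma MemLp.integral_fst {F : α × β → ℝ} (hF : MemLp F 2 (μ.prod ν)) :
    MemLp (fun y => ∫ x, F (x, y) ∂μ) 2 ν := by
  have hm : AEStronglyMeasurable (fun y => ∫ x, F (x, y) ∂μ) ν :=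
    hF.aestronglyMeasurable.prod_swap.integral_prod_right'
  refine memLp_two_of_integrable_sq hm ?_
  have hsq : Integrable (fun p => F p ^ 2) (μ.prod ν) := hF.integrable_sq
  refine Integrable.mono' (hsq.integral_prod_right.const_mul (μ.real univ)) (hm.pow 2) ?_
  have h1 : ∀ᵐ y ∂ν, AEStronglyMeasurable (fun x => F (x, y)) μ :=
    hF.aestronglyMeasurable.prod_swap.prodMk_left
  filter_upwards [hsq.prod_left_ae, h1] with y hy hy1
  rw [Real.norm_of_nonneg (sq_nonneg _)]
  exact sq_integral_le (memLp_two_of_integrable_sq hy1 hy)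

/-- Fubini's theorem for square-integrable functions. -/
lemma integral_integral_fst_mul {F : α × β → ℝ} (hF : MemLp F 2 (μ.prod ν)) {q : β → ℝ}
    (hq : MemLp q 2 ν) :
    ∫ y, (∫ x, F (x, y) ∂μ) * q y ∂ν = ∫ p, F p * q p.2 ∂(μ.prod ν) := by
  have hq' : MemLp (fun p : α × β => q p.2) 2 (μ.prod ν) := hq.comp_snd μ
  rw [integral_prod_symm _ (integrable_mul_of_memLp hF hq')]
  simp only [integral_mul_const]

end L2

/-! ### The weight `√γ` and the graph of the weighted weak derivative -/

/-- The weight `√γ_ε`. -/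
def wt (H : ℝ → ℝ) (ε x : ℝ) : ℝ := Real.sqrt (gam H ε x)

/-- The state space: densities `f` are represented by `f / √γ_ε`. -/
abbrev L2Line := Lp ℝ 2 (volume : Measure ℝ)

section Weight

variable {H : ℝ → ℝ} {ε : ℝ}

lemma wt_pos (hint : Integrable (fun x => Real.exp (-H x / ε ^ 2))) (x : ℝ) : 0 < wt H ε x :=
  Real.sqrt_pos.2 (gam_pos hint x)

lemma wt_sq (hint : Integrable (fun x => Real.exp (-H x / ε ^ 2))) (x : ℝ) :
    wt H ε x ^ 2 = gam H ε x := Real.sq_sqrt (gam_pos hint x).le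

lemma continuous_wt (hH : IsDoubleWell H) (ε : ℝ) : Continuous (wt H ε) :=
  (hH.continuous_gam ε).sqrt

lemma div_wt_sq (hint : Integrable (fun x => Real.exp (-H x / ε ^ 2))) (a x : ℝ) :
    (a / wt H ε x) ^ 2 = a ^ 2 / gam H ε x := by rw [div_pow, wt_sq hint]

lemma mul_wt_sq (hint : Integrable (fun x => Real.exp (-H x / ε ^ 2))) (a x : ℝ) :
    (wt H ε x * a) ^ 2 = gam H ε x * a ^ 2 := by rw [mul_pow, wt_sq hint]

lemma memLp_div_wt (hH : IsDoubleWell H) (hint : Integrable (fun x => Real.exp (-H x / ε ^ 2)))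
    {f : ℝ → ℝ} (hf : AEStronglyMeasurable f) (h : Integrable (fun x => f x ^ 2 / gam H ε x)) :
    MemLp (fun x => f x / wt H ε x) 2 := by
  refine memLp_two_of_integrable_sq
    (hf.aemeasurable.div (continuous_wt hH ε).measurable.aemeasurable).aestronglyMeasurable ?_
  simpa only [div_wt_sq hint] using h

lemma memLp_wt_mul (hH : IsDoubleWell H) (hint : Integrable (fun x => Real.exp (-H x / ε ^ 2)))
    {f : ℝ → ℝ} (hf : AEStronglyMeasurable f) (h : Integrable (fun x => gam H ε x * f x ^ 2)) :
    MemLp (fun x => wt H ε x * f x) 2 := by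
  refine memLp_two_of_integrable_sq ((continuous_wt hH ε).aestronglyMeasurable.mul hf) ?_
  simpa only [mul_wt_sq hint] using h

lemma memLp_wt_mul_of_bounded (hH : IsDoubleWell H)
    (hint : Integrable (fun x => Real.exp (-H x / ε ^ 2))) {f : ℝ → ℝ} {M : ℝ}
    (hf : AEStronglyMeasurable f) (h : ∀ x, |f x| ≤ M) :
    MemLp (fun x => wt H ε x * f x) 2 := by
  refine memLp_wt_mul hH hint hf (Integrable.mono' ((integrable_gam hint).const_mul (M ^ 2))
    ((hH.continuous_gam ε).aestronglyMeasurable.mul (hf.pow 2)) (ae_of_all _ fun x => ?_))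
  have := (gam_pos hint x).le
  rw [Real.norm_of_nonneg (by positivity), mul_comm]
  exact mul_le_mul_of_nonneg_right (sq_le_sq' (abs_le.1 (h x)).1 (abs_le.1 (h x)).2) this

lemma memLp_div_wt_of_hasCompactSupport (hH : IsDoubleWell H)
    (hint : Integrable (fun x => Real.exp (-H x / ε ^ 2))) {f : ℝ → ℝ}
    (hf : Continuous f) (h : HasCompactSupport f) :
    MemLp (fun x => f x / wt H ε x) 2 := by
  have hc : Continuous fun x => f x / wt H ε x :=
    hf.div (continuous_wt hH ε) fun x => (wt_pos hint x).ne'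
  exact hc.memLp_of_hasCompactSupport (h.mono fun x hx => by
    simp only [Function.mem_support] at hx ⊢
    intro h0; simp [h0] at hx)

lemma locallyIntegrable_of_memLp_div_wt (hH : IsDoubleWell H)
    (hint : Integrable (fun x => Real.exp (-H x / ε ^ 2))) {f : ℝ → ℝ}
    (h : MemLp (fun x => f x / wt H ε x) 2) : LocallyIntegrable f := by
  have h1 : LocallyIntegrable (fun x => f x / wt H ε x) := h.locallyIntegrable one_le_two
  rw [← locallyIntegrableOn_univ] at h1 ⊢
  refine (h1.continuousOn_mul (continuous_wt hH ε).continuousOn isOpen_univ.isLocallyClosed).congr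
    (ae_of_all _ fun x => ?_)
  exact mul_div_cancel₀ _ (wt_pos hint x).ne'

lemma locallyIntegrable_of_memLp_wt_mul (hH : IsDoubleWell H)
    (hint : Integrable (fun x => Real.exp (-H x / ε ^ 2))) {f : ℝ → ℝ}
    (h : MemLp (fun x => wt H ε x * f x) 2) : LocallyIntegrable f := by
  have h1 : LocallyIntegrable (fun x => wt H ε x * f x) := h.locallyIntegrable one_le_two
  rw [← locallyIntegrableOn_univ] at h1 ⊢
  refine (h1.continuousOn_mul ((continuous_wt hH ε).inv₀ fun x => (wt_pos hint x).ne').continuousOn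
    isOpen_univ.isLocallyClosed).congr (ae_of_all _ fun x => ?_)
  exact inv_mul_cancel_left₀ (wt_pos hint x).ne' _

end Weight

/-- The graph of the weak derivative in `L²(γ_ε)`: pairs `(√γ F, √γ F')`. -/
def derivGraph (H : ℝ → ℝ) (ε : ℝ) : Submodule ℝ (L2Line × L2Line) where
  carrier := {p | ∃ F f : ℝ → ℝ, IsPrimitive F f ∧ p.1 =ᵐ[volume] (fun x => wt H ε x * F x) ∧
    p.2 =ᵐ[volume] fun x => wt H ε x * f x}
  zero_mem' := ⟨0, 0, ⟨locallyIntegrable_zero, by simp⟩,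
    by filter_upwards [Lp.coeFn_zero ℝ 2 (volume : Measure ℝ)] with x hx; simp,
    by filter_upwards [Lp.coeFn_zero ℝ 2 (volume : Measure ℝ)] with x hx; simp⟩
  add_mem' := by
    rintro p q ⟨F, f, hF, h1, h2⟩ ⟨G, g, hG, h3, h4⟩
    refine ⟨F + G, f + g, ⟨hF.locallyIntegrable.add hG.locallyIntegrable, fun x => ?_⟩, ?_, ?_⟩
    · simp only [Pi.add_apply]
      rw [intervalIntegral.integral_add (hF.intervalIntegrable _ _) (hG.intervalIntegrable _ _),
        hF.eq_add_integral x, hG.eq_add_integral x]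
      ring
    · filter_upwards [Lp.coeFn_add p.1 q.1, h1, h3] with x e e1 e2
      simp only [Prod.fst_add, e, Pi.add_apply, e1, e2, mul_add]
    · filter_upwards [Lp.coeFn_add p.2 q.2, h2, h4] with x e e1 e2
      simp only [Prod.snd_add, e, Pi.add_apply, e1, e2, mul_add]
  smul_mem' := by
    rintro a p ⟨F, f, hF, h1, h2⟩
    refine ⟨fun x => a * F x, fun x => a * f x, ⟨hF.locallyIntegrable.smul a, fun x => ?_⟩, ?_, ?_⟩
    · rw [intervalIntegral.integral_const_mul, hF.eq_add_integral x]
      ring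
    · filter_upwards [Lp.coeFn_smul a p.1, h1] with x e e1
      simp only [Prod.smul_fst, e, Pi.smul_apply, e1, smul_eq_mul]
      ring
    · filter_upwards [Lp.coeFn_smul a p.2, h2] with x e e1
      simp only [Prod.smul_snd, e, Pi.smul_apply, e1, smul_eq_mul]
      ring

section Graph

variable {H : ℝ → ℝ} {ε : ℝ}

lemma IsPrimitive.mem_derivGraph {F f : ℝ → ℝ} (hF : IsPrimitive F f)
    (h1 : MemLp (fun x => wt H ε x * F x) 2) (h2 : MemLp (fun x => wt H ε x * f x) 2) :
    (toL2 volume (fun x => wt H ε x * F x), toL2 volume (fun x => wt H ε x * f x)) ∈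
      derivGraph H ε :=
  ⟨F, f, hF, coeFn_toL2 h1, coeFn_toL2 h2⟩

/-- The hypothesis says that `p.2 / √γ` is the weak derivative of `p.1 / √γ`. Both are locally
integrable because `√γ` is continuous and positive, so du Bois-Reymond supplies the primitive. -/
lemma mem_derivGraph_of_weak (hH : IsDoubleWell H)
    (hint : Integrable (fun x => Real.exp (-H x / ε ^ 2))) {p : L2Line × L2Line}
    (h : ∀ ψ : ℝ → ℝ, ContDiff ℝ ∞ ψ → HasCompactSupport ψ →
      ⟪p.1, toL2 volume (fun x => deriv ψ x / wt H ε x)⟫ =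
        -⟪p.2, toL2 volume (fun x => ψ x / wt H ε x)⟫) : p ∈ derivGraph H ε := by
  have hw := fun x => (wt_pos hint x).ne'
  have key : ∀ P : L2Line, LocallyIntegrable fun x => P x / wt H ε x := fun P => by
    refine locallyIntegrable_of_memLp_wt_mul hH hint ?_
    simpa only [mul_div_cancel₀ _ (hw _)] using Lp.memLp P
  obtain ⟨F, hF, hFe⟩ := exists_isPrimitive_of_weakDeriv (key p.1) (key p.2) (by
    intro ψ hψ hψs
    have h' := h ψ hψ hψs
    rw [inner_eq_integral (ae_eq_refl _) (coeFn_toL2 (memLp_div_wt_of_hasCompactSupport hH hint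
        (hψ.continuous_deriv (by simp)) hψs.deriv)),
      inner_eq_integral (ae_eq_refl _) (coeFn_toL2 (memLp_div_wt_of_hasCompactSupport hH hint
        hψ.continuous hψs))] at h'
    simp only [div_mul_eq_mul_div, mul_div_assoc] at h' ⊢
    exact h')
  refine ⟨F, _, hF, ?_, ae_of_all _ fun x => (mul_div_cancel₀ _ (hw x)).symm⟩
  filter_upwards [hFe] with x hx
  rw [← hx, mul_div_cancel₀ _ (hw x)]

/-- A weak conservation law may be tested with every element of the graph. -/
lemma inner_eq_neg_inner_of_weak (hH : IsDoubleWell H)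
    (hint : Integrable (fun x => Real.exp (-H x / ε ^ 2))) {D Φ : ℝ → ℝ}
    (hD : MemLp (fun x => D x / wt H ε x) 2) (hΦ : MemLp (fun x => Φ x / wt H ε x) 2)
    (h : ∀ ψ : ℝ → ℝ, ContDiff ℝ ∞ ψ → HasCompactSupport ψ →
      ∫ x, D x * ψ x = -∫ x, Φ x * deriv ψ x) {p : L2Line × L2Line} (hp : p ∈ derivGraph H ε) :
    ⟪toL2 volume (fun x => D x / wt H ε x), p.1⟫ =
      -⟪toL2 volume (fun x => Φ x / wt H ε x), p.2⟫ := by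
  have hw := fun x => (wt_pos hint x).ne'
  obtain ⟨F, f, hF, h1, h2⟩ := hp
  have hF2 : MemLp (fun x => wt H ε x * F x) 2 := (memLp_congr_ae h1).1 (Lp.memLp p.1)
  have hf2 : MemLp (fun x => wt H ε x * f x) 2 := (memLp_congr_ae h2).1 (Lp.memLp p.2)
  -- The conservation law says that `Φ` has weak derivative `D`. The weights cancel in the products
  -- with `F` and `f`, which are integrable by Cauchy-Schwarz, so integration by parts on the whole
  -- line has no boundary terms.
  obtain ⟨Φ', hΦ', hΦe⟩ := exists_isPrimitive_of_weakDeriv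
    (locallyIntegrable_of_memLp_div_wt hH hint hΦ) (locallyIntegrable_of_memLp_div_wt hH hint hD)
    (fun ψ hψ hψs => by rw [h ψ hψ hψs, neg_neg])
  have e : ∀ a b x : ℝ, a / wt H ε x * (wt H ε x * b) = a * b := fun a b x => by
    have := hw x
    field_simp
  have i1 : Integrable fun x => D x * F x := by
    simpa only [e] using integrable_mul_of_memLp hD hF2
  have i2 : Integrable fun x => Φ x * f x := by
    simpa only [e] using integrable_mul_of_memLp hΦ hf2
  have i3 : Integrable fun x => Φ x * F x := by
    simpa only [e] using integrable_mul_of_memLp hΦ hF2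
  have c2 : (fun x => Φ x * f x) =ᵐ[volume] fun x => Φ' x * f x := by
    filter_upwards [hΦe] with x hx; rw [hx]
  have c3 : (fun x => Φ x * F x) =ᵐ[volume] fun x => Φ' x * F x := by
    filter_upwards [hΦe] with x hx; rw [hx]
  have := hΦ'.integral_mul_eq_zero hF i1 (i2.congr c2) (i3.congr c3)
  rw [← integral_congr_ae c2] at this
  rw [inner_eq_integral (coeFn_toL2 hD) h1, inner_eq_integral (coeFn_toL2 hΦ) h2]
  simp only [e]
  linarith

end Graph

/-! ### Weak solutions as form flows -/

/-- The state `ρ(t) / √γ_ε` of a solution in `L²`, frozen for negative times. -/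
def state (H : ℝ → ℝ) (ε : ℝ) (ρ : ℝ → ℝ → ℝ) (t : ℝ) : L2Line :=
  toL2 volume fun x => ρ (max t 0) x / wt H ε x

/-- The time-integrated flux `∫_0^t (∂_x ρ + ε⁻² ρ H') / √γ_ε` of a solution in `L²`. -/
def fluxState (H : ℝ → ℝ) (ε : ℝ) (ρ r : ℝ → ℝ → ℝ) (t : ℝ) : L2Line :=
  toL2 volume fun x => (∫ s in Ioo 0 t, flux H ε ρ r s x) / wt H ε x

lemma inner_intervalIntegral {X : Type*} [NormedAddCommGroup X] [InnerProductSpace ℝ X]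
    [CompleteSpace X] {u : ℝ → X} (hu : Continuous u) (a : X) (s t : ℝ) :
    ⟪∫ r in s..t, u r, a⟫ = ∫ r in s..t, ⟪u r, a⟫ := by
  have := ((innerSL ℝ) a).intervalIntegral_comp_comm (hu.intervalIntegrable (μ := volume) s t)
  simp only [innerSL_apply_apply] at this
  rw [real_inner_comm, ← this]
  simp only [real_inner_comm]

section

variable {H : ℝ → ℝ} {ε : ℝ} {ρ0 : ℝ → ℝ} {ρ r : ℝ → ℝ → ℝ}

lemma MemL2Strip.memLp (hH : IsDoubleWell H)
    (hint : Integrable (fun x => Real.exp (-H x / ε ^ 2))) {T : ℝ} {f : ℝ → ℝ → ℝ}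
    (h : MemL2Strip H ε T f) :
    MemLp (fun p : ℝ × ℝ => f p.1 p.2 / wt H ε p.2) 2 (stripMeasure T) := by
  have hm : AEMeasurable (fun p : ℝ × ℝ => wt H ε p.2) (stripMeasure T) :=
    ((continuous_wt hH ε).comp continuous_snd).measurable.aemeasurable
  refine memLp_two_of_integrable_sq (h.1.aemeasurable.div hm).aestronglyMeasurable ?_
  simpa only [Pi.div_apply, div_wt_sq hint] using h.2

lemma hasDerivAt_div_gam (hH : IsDoubleWell H)
    (hint : Integrable (fun x => Real.exp (-H x / ε ^ 2))) {ψ : ℝ → ℝ} (hψ : Differentiable ℝ ψ)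
    (x : ℝ) : HasDerivAt (fun x => ψ x / gam H ε x)
      (deriv ψ x / gam H ε x + (ε ^ 2)⁻¹ * deriv H x * (ψ x / gam H ε x)) x := by
  have hg : HasDerivAt (gam H ε) (gam H ε x * (-deriv H x / ε ^ 2)) x := by
    have := (((hH.differentiable x).hasDerivAt.neg.div_const (ε ^ 2)).exp).const_mul
      (partitionFn H ε)⁻¹
    exact this.congr_deriv (by simp only [gam, Pi.neg_apply]; ring)
  have hp := (gam_pos hint x).ne'
  refine ((hψ x).hasDerivAt.div hg hp).congr_deriv ?_
  field_simp
  ring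

/-- The flux is the weak derivative of `ρ / γ_ε`, up to the weight. -/
lemma integral_mul_deriv_div_gam (hH : IsDoubleWell H)
    (hint : Integrable (fun x => Real.exp (-H x / ε ^ 2))) {s : ℝ}
    (hr : HasWeakDerivOn (ρ s) (r s) univ) {ψ : ℝ → ℝ} (hψ : ContDiff ℝ ∞ ψ)
    (hψs : HasCompactSupport ψ) :
    ∫ x, ρ s x * (deriv ψ x / gam H ε x) = -∫ x, flux H ε ρ r s x * (ψ x / gam H ε x) := by
  obtain ⟨h1, h2, h3⟩ := hr
  rw [locallyIntegrableOn_univ] at h1 h2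
  have hp := fun x => (gam_pos hint x).ne'
  have hη : ContDiff ℝ ∞ fun x => ψ x / gam H ε x := hψ.div (hH.contDiff_gam ε) hp
  have hηs : HasCompactSupport fun x => ψ x / gam H ε x := hψs.mono fun x hx => by
    simp only [Function.mem_support] at hx ⊢
    intro h0; simp [h0] at hx
  have hψ's : HasCompactSupport fun x => deriv ψ x / gam H ε x := hψs.deriv.mono fun x hx => by
    simp only [Function.mem_support] at hx ⊢
    intro h0; simp [h0] at hx
  have hd : deriv (fun x => ψ x / gam H ε x) = fun x =>
      deriv ψ x / gam H ε x + (ε ^ 2)⁻¹ * deriv H x * (ψ x / gam H ε x) :=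
    funext fun x => (hasDerivAt_div_gam hH hint (hψ.differentiable (by simp)) x).deriv
  -- With the test function `ψ / γ`, the term from differentiating `1 / γ` is precisely the drift
  -- part of the flux.
  have h4 := h3 _ hη hηs (subset_univ _)
  rw [hd] at h4
  simp only [Measure.restrict_univ] at h4
  have c1 : Continuous fun x => deriv ψ x / gam H ε x :=
    (hψ.continuous_deriv (by simp)).div (hH.continuous_gam ε) hp
  have c2 : Continuous fun x => (ε ^ 2)⁻¹ * deriv H x * (ψ x / gam H ε x) :=
    (continuous_const.mul (hH.smooth.continuous_deriv (by simp))).mul hη.continuous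
  have i1 := integrable_mul_of_hasCompactSupport h1 c1 hψ's
  have i2 := integrable_mul_of_hasCompactSupport h1 c2 hηs.mul_left
  have i3 := integrable_mul_of_hasCompactSupport h2 hη.continuous hηs
  simp only [mul_add] at h4
  rw [integral_add i1 i2] at h4
  have e : (fun x => flux H ε ρ r s x * (ψ x / gam H ε x)) = fun x =>
      r s x * (ψ x / gam H ε x) + ρ s x * ((ε ^ 2)⁻¹ * deriv H x * (ψ x / gam H ε x)) := by
    ext x; simp only [flux]; ring
  rw [e, integral_add i3 i2]
  linarith

namespace IsSolution

lemma memLp (h : IsSolution H ε ρ0 ρ) (hH : IsDoubleWell H)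
    (hint : Integrable (fun x => Real.exp (-H x / ε ^ 2))) {t : ℝ} (ht : 0 ≤ t) :
    MemLp (fun x => ρ t x / wt H ε x) 2 :=
  memLp_div_wt hH hint (h.meas_slice t ht) (h.sq_integrable t ht)

lemma coeFn_state (h : IsSolution H ε ρ0 ρ) (hH : IsDoubleWell H)
    (hint : Integrable (fun x => Real.exp (-H x / ε ^ 2))) {t : ℝ} (ht : 0 ≤ t) :
    state H ε ρ t =ᵐ[volume] fun x => ρ t x / wt H ε x := by
  rw [state, max_eq_left ht]
  exact coeFn_toL2 (h.memLp hH hint ht)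

lemma inner_state (h : IsSolution H ε ρ0 ρ) (hH : IsDoubleWell H)
    (hint : Integrable (fun x => Real.exp (-H x / ε ^ 2))) {t : ℝ} (ht : 0 ≤ t) {b : ℝ → ℝ}
    (hb : MemLp (fun x => wt H ε x * b x) 2) :
    ⟪state H ε ρ t, toL2 volume fun x => wt H ε x * b x⟫ = ∫ x, ρ t x * b x := by
  rw [inner_eq_integral (h.coeFn_state hH hint ht) (coeFn_toL2 hb)]
  congr 1; ext x
  have := (wt_pos hint x).ne'
  field_simp

lemma norm_state_sq (h : IsSolution H ε ρ0 ρ) (hH : IsDoubleWell H)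
    (hint : Integrable (fun x => Real.exp (-H x / ε ^ 2))) {t : ℝ} (ht : 0 ≤ t) :
    ‖state H ε ρ t‖ ^ 2 = ∫ x, ρ t x ^ 2 / gam H ε x := by
  rw [state, max_eq_left ht, norm_toL2_sq (h.memLp hH hint ht)]
  simp only [div_wt_sq hint]

lemma norm_state_sub_sq (h : IsSolution H ε ρ0 ρ) (hH : IsDoubleWell H)
    (hint : Integrable (fun x => Real.exp (-H x / ε ^ 2))) {s t : ℝ} (hs : 0 ≤ s) (ht : 0 ≤ t) :
    ‖state H ε ρ t - state H ε ρ s‖ ^ 2 = ∫ x, (ρ t x - ρ s x) ^ 2 / gam H ε x := by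
  have hm : MemLp (fun x => ρ t x / wt H ε x - ρ s x / wt H ε x) 2 :=
    (h.memLp hH hint ht).sub (h.memLp hH hint hs)
  rw [state, state, max_eq_left ht, max_eq_left hs, toL2_sub (h.memLp hH hint ht)
    (h.memLp hH hint hs), norm_toL2_sq hm]
  simp only [← sub_div, div_wt_sq hint]

lemma continuous_state (h : IsSolution H ε ρ0 ρ) (hH : IsDoubleWell H)
    (hint : Integrable (fun x => Real.exp (-H x / ε ^ 2))) : Continuous (state H ε ρ) := by
  have h1 : ContinuousOn (state H ε ρ) (Ici 0) := by
    intro s hs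
    have h2 : Tendsto (fun t => ‖state H ε ρ t - state H ε ρ s‖ ^ 2) (𝓝[Ici 0] s) (𝓝 0) := by
      refine (h.continuous s hs).congr' ?_
      filter_upwards [self_mem_nhdsWithin] with t ht
      exact (h.norm_state_sub_sq hH hint hs ht).symm
    have h3 := h2.sqrt
    simp only [Real.sqrt_sq (norm_nonneg _), Real.sqrt_zero] at h3
    exact tendsto_iff_norm_sub_tendsto_zero.2 h3
  have h2 := h1.comp_continuous (f := fun t : ℝ => max t 0) (by fun_prop) fun t => le_max_right t 0
  refine h2.congr fun t => ?_
  simp [state]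

/-- With `u = ρ / γ`, take `V = √γ ∫_0^t u`, `V' = √γ u` and `Q = √γ ∂ₓ ∫_0^t u`. Integration in
time makes every condition hold at each time: `V` is `C¹` because `u` is continuous into `L²(γ)`,
graph membership is the time integral of `γ ∂ₓu = flux`, and the equation extends from compactly
supported test functions to the whole graph by `inner_eq_neg_inner_of_weak`. -/
lemma exists_isFormFlow (h : IsSolution H ε ρ0 ρ) (hH : IsDoubleWell H)
    (hint : Integrable (fun x => Real.exp (-H x / ε ^ 2))) :
    ∃ Q : ℝ → L2Line, Q 0 = 0 ∧ IsFormFlow (derivGraph H ε) (tau ε) (state H ε ρ 0)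
      (fun t => ∫ s in (0 : ℝ)..t, state H ε ρ s) (state H ε ρ) Q := by
  obtain ⟨r, hr1, hr2, hr3⟩ := h.weak_form
  have hcont := h.continuous_state hH hint
  have hw := fun x => (wt_pos hint x).ne'
  have hwg := fun x => wt_sq hint x
  have hF : ∀ t, 0 < t → MemLp (fun p : ℝ × ℝ => flux H ε ρ r p.1 p.2 / wt H ε p.2) 2
      (stripMeasure t) := fun t ht => (hr2 t ht).memLp hH hint
  have hΦ : ∀ t, 0 ≤ t → MemLp (fun x => (∫ s in Ioo 0 t, flux H ε ρ r s x) / wt H ε x) 2 := by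
    intro t ht
    rcases ht.eq_or_lt with rfl | ht
    · simp
    · simpa only [integral_div] using MemLp.integral_fst (hF t ht)
  -- Fubini. Time `0` is treated apart, since the flux bound is available only on strips of positive
  -- length.
  have hpair : ∀ t, 0 ≤ t → ∀ q : ℝ → ℝ, MemLp q 2 →
      ∫ x, (∫ s in Ioo 0 t, flux H ε ρ r s x) / wt H ε x * q x =
        ∫ p, flux H ε ρ r p.1 p.2 / wt H ε p.2 * q p.2 ∂(stripMeasure t) := by
    intro t ht q hq
    rcases ht.eq_or_lt with rfl | ht
    · simp [stripMeasure]
    · have := integral_integral_fst_mul (hF t ht) hq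
      simp only [integral_div] at this
      exact this
  refine ⟨fluxState H ε ρ r, ?_, ?_, hcont, ?_, ?_⟩
  · refine Lp.ext ?_
    filter_upwards [coeFn_toL2 (hΦ 0 le_rfl), Lp.coeFn_zero ℝ 2 (volume : Measure ℝ)] with x h1 h2
    rw [fluxState, h1, h2]
    simp
  · exact fun t => intervalIntegral.integral_hasDerivAt_right (hcont.intervalIntegrable _ _)
      (hcont.stronglyMeasurableAtFilter _ _) hcont.continuousAt
  · intro t ht
    refine mem_derivGraph_of_weak hH hint fun ψ hψ hψs => ?_
    have m1 := memLp_div_wt_of_hasCompactSupport hH hint (hψ.continuous_deriv (by simp)) hψs.deriv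
    have m2 := memLp_div_wt_of_hasCompactSupport hH hint hψ.continuous hψs
    rw [inner_intervalIntegral hcont, intervalIntegral.integral_of_le ht, integral_Ioc_eq_integral_Ioo, fluxState,
      inner_toL2 (hΦ t ht) m2, hpair t ht _ m2]
    rcases ht.eq_or_lt with rfl | ht
    · simp [stripMeasure]
    have hae : ∀ᵐ s ∂(volume.restrict (Ioo 0 t)),
        ⟪state H ε ρ s, toL2 volume (fun x => deriv ψ x / wt H ε x)⟫ =
          -∫ x, flux H ε ρ r s x / wt H ε x * (ψ x / wt H ε x) := by
      have h5 := ae_restrict_of_ae_restrict_of_subset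
        (Ioo_subset_Ioi_self : Ioo 0 t ⊆ Ioi 0) hr1
      filter_upwards [h5, ae_restrict_mem measurableSet_Ioo] with s hs hs2
      rw [inner_eq_integral (h.coeFn_state hH hint hs2.1.le) (coeFn_toL2 m1)]
      have h6 := integral_mul_deriv_div_gam hH hint hs hψ hψs
      simp only [← hwg] at h6
      convert h6 using 1
      · congr 1; ext x; have := hw x; field_simp
      · congr 2; ext x; have := hw x; field_simp
    rw [integral_congr_ae hae, integral_neg, stripMeasure,
      integral_prod _ (integrable_mul_of_memLp (hF t ht) (m2.comp_snd _))]
  · intro t ht p hp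
    have hm : MemLp (fun x => (ρ t x - ρ 0 x) / wt H ε x) 2 := by
      simp only [sub_div]
      exact (h.memLp hH hint ht).sub (h.memLp hH hint le_rfl)
    have hm' : MemLp (fun x => tau ε * (ρ t x - ρ 0 x) / wt H ε x) 2 := by
      simpa only [mul_div_assoc] using hm.const_mul (tau ε)
    have key := inner_eq_neg_inner_of_weak hH hint hm' (hΦ t ht) (by
      intro ψ hψ hψs
      have i1 : ∀ s, 0 ≤ s → Integrable fun x => ρ s x * ψ x := fun s hs =>
        integrable_mul_of_hasCompactSupport (locallyIntegrable_of_memLp_div_wt hH hint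
          (h.memLp hH hint hs)) hψ.continuous hψs
      have e0 : ∫ x, ρ0 x * ψ x = ∫ x, ρ 0 x * ψ x := by
        refine integral_congr_ae ?_
        filter_upwards [h.initial] with x hx; rw [hx]
      have h7 := hr3 ψ hψ hψs t ht
      rw [e0, ← integral_sub (i1 t ht) (i1 0 le_rfl), ← integral_const_mul] at h7
      have m3 : MemLp (fun x => wt H ε x * deriv ψ x) 2 :=
        ((continuous_wt hH ε).mul (hψ.continuous_deriv (by simp))).memLp_of_hasCompactSupport
          hψs.deriv.mul_left
      have h8 := hpair t ht _ m3
      have e1 : ∀ a b x : ℝ, a / wt H ε x * (wt H ε x * b) = a * b := fun a b x => by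
        have := hw x
        field_simp
      simp only [e1] at h8
      rw [h8, ← h7]
      congr 1; ext x; ring) hp
    rw [fluxState, ← key]
    simp only [mul_div_assoc]
    rw [toL2_const_mul _ hm, inner_smul_left]
    simp only [sub_div]
    rw [← toL2_sub (h.memLp hH hint ht) (h.memLp hH hint le_rfl), state, state, max_eq_left ht,
      max_self]
    rfl

/-- Well-prepared initial data belong to the form domain, with the right bounds. -/
lemma exists_initial_deriv (h : IsSolution H ε ρ0 ρ) (hH : IsDoubleWell H) (hε : 0 < ε)
    (hint : Integrable (fun x => Real.exp (-H x / ε ^ 2))) {C c : ℝ}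
    (hwp : WellPrepared H ε C c ρ0) :
    ‖state H ε ρ 0‖ ^ 2 ≤ C ∧
      ∃ b, (state H ε ρ 0, b) ∈ derivGraph H ε ∧ ‖b‖ ^ 2 ≤ C * tau ε := by
  obtain ⟨-, -, -, d, hd, hi1, hi2, hC⟩ := hwp
  have hτ := tau_pos hε
  have hw := fun x => (wt_pos hint x).ne'
  have hg := fun x => gam_pos hint x
  have n1 : 0 ≤ ∫ x, gam H ε x * (ρ0 x / gam H ε x) ^ 2 :=
    integral_nonneg fun x => by have := (hg x).le; positivity
  have n2 : 0 ≤ ∫ x, gam H ε x * d x ^ 2 / tau ε :=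
    integral_nonneg fun x => by have := (hg x).le; positivity
  have hi2' : Integrable fun x => gam H ε x * d x ^ 2 := by
    refine (hi2.const_mul (tau ε)).congr (ae_of_all _ fun x => ?_)
    simp only
    field_simp
  have hd2 := hd.2.1
  have hd1 := hd.1
  rw [locallyIntegrableOn_univ] at hd1 hd2
  obtain ⟨F, hF, hFe⟩ := exists_isPrimitive_of_weakDeriv hd1 hd2 (fun ψ hψ hψs => by
    simpa using hd.2.2 ψ hψ hψs (subset_univ _))
  have hb : MemLp (fun x => wt H ε x * d x) 2 :=
    memLp_wt_mul hH hint hd2.aestronglyMeasurable hi2'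
  have hst := h.coeFn_state hH hint le_rfl
  refine ⟨?_, toL2 volume fun x => wt H ε x * d x, ⟨F, d, hF, ?_, coeFn_toL2 hb⟩, ?_⟩
  · rw [h.norm_state_sq hH hint le_rfl]
    refine le_trans (le_of_eq ?_) ((le_add_of_nonneg_right n2).trans hC)
    refine integral_congr_ae ?_
    filter_upwards [h.initial] with x hx
    rw [hx]
    have := (hg x).ne'
    field_simp
  · filter_upwards [hst, hFe, h.initial] with x h1 h2 h3
    rw [h1, h3, ← h2, ← wt_sq hint]
    have := hw x
    field_simp
  · rw [norm_toL2_sq hb]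
    simp only [mul_wt_sq hint]
    have : ∫ x, gam H ε x * d x ^ 2 = (∫ x, gam H ε x * d x ^ 2 / tau ε) * tau ε := by
      rw [← integral_mul_const]
      congr 1; ext x; field_simp
    rw [this]
    gcongr
    linarith

end IsSolution

end

/-! ### The committor and plateau functions -/

/-- The derivative of the committor function: `κ / γ_ε` on `[-1, 1]`. -/
def committorDeriv (H : ℝ → ℝ) (ε : ℝ) : ℝ → ℝ :=
  (Icc (-1) 1).indicator fun x => conductance H ε / gam H ε x

/-- The committor function: odd, equal to `±1` beyond the wells, and harmonic in between. -/
def committor (H : ℝ → ℝ) (ε x : ℝ) : ℝ := 0 + ∫ y in (0 : ℝ)..x, committorDeriv H ε y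

/-- The truncated sign function. -/
def wellSign : ℝ → ℝ := (Icc (-2) 2).indicator Real.sign

/-- The mass `∫_0^2 γ_ε` of one well. -/
def wellMass (H : ℝ → ℝ) (ε : ℝ) : ℝ := ∫ y in (0 : ℝ)..2, gam H ε y

/-- The derivative of the plateau function. -/
def plateauDeriv (H : ℝ → ℝ) (ε x : ℝ) : ℝ := -(wellMass H ε)⁻¹ * (gam H ε x * wellSign x)

/-- The plateau function: even, supported in `[-2, 2]`, with slope proportional to `∓γ_ε`. -/
def plateau (H : ℝ → ℝ) (ε x : ℝ) : ℝ := 1 + ∫ y in (0 : ℝ)..x, plateauDeriv H ε y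

/-- The indicator function of `[-1, 1]`. -/
def barrier : ℝ → ℝ := (Icc (-1) 1).indicator fun _ => 1

section

variable {H : ℝ → ℝ} {ε : ℝ}

lemma measurable_wellSign : Measurable wellSign := by
  refine Measurable.indicator ?_ measurableSet_Icc
  exact Measurable.ite measurableSet_Iio measurable_const
    (Measurable.ite measurableSet_Ioi measurable_const measurable_const)

lemma abs_wellSign_le (x : ℝ) : |wellSign x| ≤ 1 := by
  unfold wellSign
  by_cases hx : x ∈ Icc (-2 : ℝ) 2
  · rw [indicator_of_mem hx]
    rcases Real.sign_apply_eq x with h | h | h <;> simp [h]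
  · simp [indicator_of_notMem hx]

lemma wellSign_neg (x : ℝ) : wellSign (-x) = -wellSign x := by
  unfold wellSign
  by_cases hx : x ∈ Icc (-2 : ℝ) 2
  · have hx' : -x ∈ Icc (-2 : ℝ) 2 := ⟨by linarith [hx.2], by linarith [hx.1]⟩
    rw [indicator_of_mem hx, indicator_of_mem hx', Real.sign_neg]
  · have hx' : -x ∉ Icc (-2 : ℝ) 2 := fun h => hx ⟨by linarith [h.2], by linarith [h.1]⟩
    rw [indicator_of_notMem hx, indicator_of_notMem hx', neg_zero]

lemma wellSign_of_pos {x : ℝ} (h0 : 0 < x) (h2 : x ≤ 2) : wellSign x = 1 := by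
  rw [wellSign, indicator_of_mem (mem_Icc.2 ⟨by linarith, h2⟩), Real.sign_of_pos h0]

lemma wellSign_of_two_lt {x : ℝ} (h2 : 2 < x) : wellSign x = 0 :=
  indicator_of_notMem (fun h => absurd h.2 (not_le.2 h2)) _

lemma wellSign_zero : wellSign 0 = 0 := by simp [wellSign]

lemma integral_zero_neg_of_even {f : ℝ → ℝ} (hf : ∀ x, f (-x) = f x) (x : ℝ) :
    ∫ y in (0 : ℝ)..-x, f y = -∫ y in (0 : ℝ)..x, f y := by
  have := intervalIntegral.integral_comp_neg (a := 0) (b := x) f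
  simp only [hf, neg_zero] at this
  rw [this, intervalIntegral.integral_symm]

lemma integral_zero_neg_of_odd {f : ℝ → ℝ} (hf : ∀ x, f (-x) = -f x) (x : ℝ) :
    ∫ y in (0 : ℝ)..-x, f y = ∫ y in (0 : ℝ)..x, f y := by
  have := intervalIntegral.integral_comp_neg (a := 0) (b := x) f
  simp only [hf, neg_zero, intervalIntegral.integral_neg] at this
  rw [intervalIntegral.integral_symm, ← this, neg_neg]

lemma continuous_inv_gam (hH : IsDoubleWell H)
    (hint : Integrable (fun x => Real.exp (-H x / ε ^ 2))) : Continuous fun x => (gam H ε x)⁻¹ :=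
  (hH.continuous_gam ε).inv₀ fun x => (gam_pos hint x).ne'

lemma integral_inv_gam_pos (hH : IsDoubleWell H)
    (hint : Integrable (fun x => Real.exp (-H x / ε ^ 2))) :
    0 < ∫ x in (-1 : ℝ)..1, (gam H ε x)⁻¹ :=
  intervalIntegral.intervalIntegral_pos_of_pos
    ((continuous_inv_gam hH hint).intervalIntegrable _ _)
    (fun x => inv_pos.2 (gam_pos hint x)) (by norm_num)

lemma conductance_pos (hH : IsDoubleWell H)
    (hint : Integrable (fun x => Real.exp (-H x / ε ^ 2))) : 0 < conductance H ε :=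
  div_pos two_pos (integral_inv_gam_pos hH hint)

/-- By evenness the integral of `γ⁻¹` over `[0, 1]` is half of that over `[-1, 1]`. The factor `2`
in `conductance` thus makes the committor reach the value `1` at the well. -/
lemma conductance_mul_integral (hH : IsDoubleWell H)
    (hint : Integrable (fun x => Real.exp (-H x / ε ^ 2))) :
    ∫ y in (0 : ℝ)..1, conductance H ε / gam H ε y = 1 := by
  have hi : ∀ a b, IntervalIntegrable (fun x => (gam H ε x)⁻¹) volume a b := fun a b =>
    (continuous_inv_gam hH hint).intervalIntegrable a b
  have h1 := intervalIntegral.integral_add_adjacent_intervals (hi (-1) 0) (hi 0 1)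
  have h2 := integral_zero_neg_of_even (f := fun x => (gam H ε x)⁻¹)
    (fun x => by rw [hH.gam_neg]) 1
  rw [intervalIntegral.integral_symm, neg_inj] at h2
  have h3 := integral_inv_gam_pos hH hint
  simp only [div_eq_mul_inv, intervalIntegral.integral_const_mul]
  rw [h2] at h1
  rw [← h1] at h3
  rw [conductance, ← h1, ← two_mul, div_mul_eq_mul_div, mul_comm 2]
  exact div_self (by linarith)

lemma isPrimitive_committor (hH : IsDoubleWell H)
    (hint : Integrable (fun x => Real.exp (-H x / ε ^ 2))) :
    IsPrimitive (committor H ε) (committorDeriv H ε) := by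
  refine IsPrimitive.of_integral (Integrable.locallyIntegrable ?_) 0
  refine (integrable_indicator_iff measurableSet_Icc).2 ?_
  simp only [div_eq_mul_inv]
  exact (continuous_const.mul (continuous_inv_gam hH hint)).integrableOn_Icc

lemma committorDeriv_neg (hH : IsDoubleWell H) (x : ℝ) :
    committorDeriv H ε (-x) = committorDeriv H ε x := by
  unfold committorDeriv
  by_cases hx : x ∈ Icc (-1 : ℝ) 1
  · have hx' : -x ∈ Icc (-1 : ℝ) 1 := ⟨by linarith [hx.2], by linarith [hx.1]⟩
    rw [indicator_of_mem hx, indicator_of_mem hx', hH.gam_neg]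
  · have hx' : -x ∉ Icc (-1 : ℝ) 1 := fun h => hx ⟨by linarith [h.2], by linarith [h.1]⟩
    rw [indicator_of_notMem hx, indicator_of_notMem hx']

lemma committor_neg (hH : IsDoubleWell H) (x : ℝ) : committor H ε (-x) = -committor H ε x := by
  simp only [committor, zero_add]
  exact integral_zero_neg_of_even (committorDeriv_neg hH) x

lemma one_sub_committor (hH : IsDoubleWell H)
    (hint : Integrable (fun x => Real.exp (-H x / ε ^ 2))) {x : ℝ} (h0 : 0 ≤ x) (h1 : x ≤ 1) :
    1 - committor H ε x = ∫ y in x..1, conductance H ε / gam H ε y := by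
  have hi : ∀ a b, IntervalIntegrable (fun y => conductance H ε / gam H ε y) volume a b :=
    fun a b => by
      simp only [div_eq_mul_inv]
      exact (continuous_const.mul (continuous_inv_gam hH hint)).intervalIntegrable a b
  have h2 : committor H ε x = ∫ y in (0 : ℝ)..x, conductance H ε / gam H ε y := by
    rw [committor, zero_add]
    refine intervalIntegral.integral_congr fun y hy => ?_
    rw [uIcc_of_le h0] at hy
    exact indicator_of_mem (mem_Icc.2 ⟨by linarith [hy.1], hy.2.trans h1⟩) _
  have h3 := intervalIntegral.integral_interval_sub_left (hi 0 1) (hi 0 x)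
  rw [conductance_mul_integral hH hint] at h3
  rw [h2, h3]

lemma committor_of_one_le (hH : IsDoubleWell H)
    (hint : Integrable (fun x => Real.exp (-H x / ε ^ 2))) {x : ℝ} (h1 : 1 ≤ x) :
    committor H ε x = 1 := by
  have h2 := one_sub_committor hH hint zero_le_one le_rfl
  rw [intervalIntegral.integral_same] at h2
  have h3 := (isPrimitive_committor hH hint).integral_eq_sub 1 x
  have h4 : ∫ y in (1 : ℝ)..x, committorDeriv H ε y = 0 := by
    rw [intervalIntegral.integral_of_le h1]
    refine setIntegral_eq_zero_of_forall_eq_zero fun y hy => ?_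
    exact indicator_of_notMem (fun h => absurd h.2 (not_le.2 hy.1)) _
  linarith

lemma one_sub_committor_mem (hH : IsDoubleWell H)
    (hint : Integrable (fun x => Real.exp (-H x / ε ^ 2))) {x : ℝ} (h0 : 0 ≤ x) :
    0 ≤ 1 - committor H ε x ∧ 1 - committor H ε x ≤ 1 := by
  rcases le_total 1 x with h1 | h1
  · simp [committor_of_one_le hH hint h1]
  have hκ := conductance_pos hH hint
  constructor
  · rw [one_sub_committor hH hint h0 h1]
    exact intervalIntegral.integral_nonneg h1 fun y _ => by
      have := gam_pos hint y; positivity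
  · have : 0 ≤ committor H ε x := by
      rw [committor, zero_add]
      refine intervalIntegral.integral_nonneg h0 fun y _ => ?_
      refine indicator_nonneg (fun z _ => ?_) _
      have := gam_pos hint z; positivity
    linarith

lemma abs_committor_le (hH : IsDoubleWell H)
    (hint : Integrable (fun x => Real.exp (-H x / ε ^ 2))) (x : ℝ) : |committor H ε x| ≤ 1 := by
  have key : ∀ y, 0 ≤ y → |committor H ε y| ≤ 1 := fun y hy => by
    have := one_sub_committor_mem hH hint hy
    exact abs_le.2 ⟨by linarith, by linarith⟩
  rcases le_total 0 x with h | h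
  · exact key x h
  · rw [← neg_neg x, committor_neg hH, abs_neg]
    exact key _ (by linarith)

/-- The committor function is close to the sign function in `L²(γ_ε)`. -/
lemma gam_mul_committor_sub_wellSign_sq_le (hH : IsDoubleWell H)
    (hint : Integrable (fun x => Real.exp (-H x / ε ^ 2))) (x : ℝ) :
    gam H ε x * (committor H ε x - wellSign x) ^ 2 ≤
      (Icc (-1) 1).indicator (fun _ => conductance H ε) x +
        {x | 2 ≤ |x|}.indicator (fun _ => 1) x * gam H ε x := by
  have hκ := conductance_pos hH hint
  have hg := fun x => gam_pos hint x
  have key : ∀ x, 0 ≤ x → gam H ε x * (committor H ε x - wellSign x) ^ 2 ≤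
      (Icc (-1) 1).indicator (fun _ => conductance H ε) x +
        {x | 2 ≤ |x|}.indicator (fun _ => 1) x * gam H ε x := by
    intro x h0
    have n1 : 0 ≤ (Icc (-1 : ℝ) 1).indicator (fun _ => conductance H ε) x :=
      indicator_nonneg (fun _ _ => hκ.le) _
    have n2 : 0 ≤ {x : ℝ | 2 ≤ |x|}.indicator (fun _ => (1 : ℝ)) x * gam H ε x :=
      mul_nonneg (indicator_nonneg (fun _ _ => zero_le_one) _) (hg x).le
    rcases h0.eq_or_lt with rfl | h0'
    · have : committor H ε 0 = 0 := by simp [committor]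
      rw [this, wellSign_zero]
      simpa using add_nonneg n1 n2
    rcases lt_or_ge 2 x with h2 | h2
    · have hm : x ∈ {x : ℝ | 2 ≤ |x|} := h2.le.trans (le_abs_self x)
      rw [committor_of_one_le hH hint (by linarith), wellSign_of_two_lt h2, indicator_of_mem hm]
      linarith
    rw [wellSign_of_pos h0' h2]
    rcases le_total 1 x with h1 | h1
    · rw [committor_of_one_le hH hint h1]
      simpa using add_nonneg n1 n2
    rw [indicator_of_mem (mem_Icc.2 ⟨by linarith, h1⟩)]
    have hm := one_sub_committor_mem hH hint h0
    -- `γ` increases on `[0, 1]`, so `γ(x) / γ(y) ≤ 1` in `γ(x) (1 - φ(x)) = ∫_x^1 κ γ(x) / γ(y)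
    -- dy`. Hence the conductance bounds the error even where `φ` is far from `1`.
    have h3 : gam H ε x * (1 - committor H ε x) ≤ conductance H ε := by
      rw [one_sub_committor hH hint h0 h1, ← intervalIntegral.integral_const_mul]
      have h4 : ∫ y in x..1, gam H ε x * (conductance H ε / gam H ε y) ≤
          ∫ y in x..1, conductance H ε := by
        refine intervalIntegral.integral_mono_on h1 ?_ (by simp) fun y hy => ?_
        · refine Continuous.intervalIntegrable ?_ _ _
          simp only [div_eq_mul_inv]
          exact continuous_const.mul (continuous_const.mul (continuous_inv_gam hH hint))
        · have h5 := hH.gam_monotoneOn ε ⟨h0, h1⟩ ⟨h0.trans hy.1, hy.2⟩ hy.1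
          rw [← mul_div_assoc, div_le_iff₀ (hg y), mul_comm]
          gcongr
      refine h4.trans ?_
      simp only [intervalIntegral.integral_const, smul_eq_mul]
      nlinarith
    have h6 : (committor H ε x - 1) ^ 2 ≤ 1 - committor H ε x := by nlinarith
    have h7 := mul_le_mul_of_nonneg_left h6 (hg x).le
    linarith
  rcases le_total 0 x with h | h
  · exact key x h
  · have h1 := key (-x) (by linarith)
    rw [hH.gam_neg, committor_neg hH, wellSign_neg, neg_sub_neg, ← neg_sub, neg_sq] at h1
    convert h1 using 2
    · simp only [indicator, mem_Icc]
      congr 1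
      exact propext ⟨fun h => ⟨by linarith, by linarith⟩, fun h => ⟨by linarith, by linarith⟩⟩
    · simp [indicator]

lemma wellMass_pos (hH : IsDoubleWell H)
    (hint : Integrable (fun x => Real.exp (-H x / ε ^ 2))) : 0 < wellMass H ε :=
  intervalIntegral.intervalIntegral_pos_of_pos ((hH.continuous_gam ε).intervalIntegrable _ _)
    (gam_pos hint) two_pos

lemma isPrimitive_plateau (hH : IsDoubleWell H)
    (hint : Integrable (fun x => Real.exp (-H x / ε ^ 2))) :
    IsPrimitive (plateau H ε) (plateauDeriv H ε) := by
  refine IsPrimitive.of_integral (Integrable.locallyIntegrable ?_) 1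
  refine Integrable.const_mul ?_ _
  refine (integrable_gam hint).mono' ((hH.continuous_gam ε).measurable.mul
    measurable_wellSign).aestronglyMeasurable (ae_of_all _ fun x => ?_)
  rw [norm_mul, Real.norm_of_nonneg (gam_pos hint x).le]
  exact mul_le_of_le_one_right (gam_pos hint x).le (abs_wellSign_le x)

lemma plateau_neg (hH : IsDoubleWell H) (x : ℝ) : plateau H ε (-x) = plateau H ε x := by
  unfold plateau
  rw [integral_zero_neg_of_odd fun y => ?_]
  simp only [plateauDeriv, hH.gam_neg, wellSign_neg]
  ring

lemma plateau_of_le_two {x : ℝ} (h0 : 0 ≤ x) (h2 : x ≤ 2) :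
    plateau H ε x = 1 - (wellMass H ε)⁻¹ * ∫ y in (0 : ℝ)..x, gam H ε y := by
  unfold plateau
  rw [← intervalIntegral.integral_const_mul, sub_eq_add_neg, ← intervalIntegral.integral_neg,
    intervalIntegral.integral_of_le h0, intervalIntegral.integral_of_le h0]
  congr 1
  refine setIntegral_congr_fun measurableSet_Ioc fun y hy => ?_
  simp only [plateauDeriv, wellSign_of_pos hy.1 (hy.2.trans h2)]
  ring

lemma plateau_of_two_le (hH : IsDoubleWell H)
    (hint : Integrable (fun x => Real.exp (-H x / ε ^ 2))) {x : ℝ} (h2 : 2 ≤ x) :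
    plateau H ε x = 0 := by
  have h1 : plateau H ε 2 = 0 := by
    rw [plateau_of_le_two zero_le_two le_rfl]
    change 1 - (wellMass H ε)⁻¹ * wellMass H ε = 0
    rw [inv_mul_cancel₀ (wellMass_pos hH hint).ne', sub_self]
  have h3 := (isPrimitive_plateau hH hint).integral_eq_sub 2 x
  have h4 : ∫ y in (2 : ℝ)..x, plateauDeriv H ε y = 0 := by
    rw [intervalIntegral.integral_of_le h2]
    refine setIntegral_eq_zero_of_forall_eq_zero fun y hy => ?_
    rw [plateauDeriv, wellSign_of_two_lt hy.1, mul_zero, mul_zero]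
  linarith

/-- The plateau function is close to the indicator function of `[-1, 1]`. -/
lemma abs_barrier_sub_plateau_le (hH : IsDoubleWell H)
    (hint : Integrable (fun x => Real.exp (-H x / ε ^ 2))) (x : ℝ) :
    |barrier x - plateau H ε x| ≤ (wellMass H ε)⁻¹ * gam H ε x := by
  have hN := wellMass_pos hH hint
  have hg := fun x => gam_pos hint x
  have hi : ∀ a b, IntervalIntegrable (gam H ε) volume a b := fun a b =>
    (hH.continuous_gam ε).intervalIntegrable a b
  have key : ∀ x, 0 ≤ x → |barrier x - plateau H ε x| ≤ (wellMass H ε)⁻¹ * gam H ε x := by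
    intro x h0
    rcases le_or_gt x 1 with h1 | h1
    -- On `[0, 1]` the error is `N⁻¹ ∫_0^x γ` with `γ` increasing; on `[1, 2]` it is `N⁻¹ ∫_x^2 γ`
    -- with `γ` decreasing. In both cases the interval has length at most `1` and `γ` is largest at
    -- `x`.
    · have hb : barrier x = 1 := indicator_of_mem (mem_Icc.2 ⟨by linarith, h1⟩) _
      rw [hb, plateau_of_le_two h0 (by linarith), sub_sub_cancel, abs_mul,
        abs_of_pos (inv_pos.2 hN), abs_of_nonneg (intervalIntegral.integral_nonneg h0
          fun y _ => (hg y).le)]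
      gcongr
      have h4 : ∫ y in (0 : ℝ)..x, gam H ε y ≤ ∫ y in (0 : ℝ)..x, gam H ε x :=
        intervalIntegral.integral_mono_on h0 (hi _ _) (by simp) fun y hy =>
          hH.gam_monotoneOn ε ⟨hy.1, hy.2.trans h1⟩ ⟨h0, h1⟩ hy.2
      simp only [intervalIntegral.integral_const, smul_eq_mul, sub_zero] at h4
      nlinarith [hg x]
    have hb : barrier x = 0 := indicator_of_notMem (fun h => absurd h.2 (not_le.2 h1)) _
    rcases le_or_gt x 2 with h2 | h2
    · have e : plateau H ε x = (wellMass H ε)⁻¹ * ∫ y in x..2, gam H ε y := by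
        rw [plateau_of_le_two h0 h2, ← intervalIntegral.integral_interval_sub_left (hi 0 2)
          (hi 0 x), mul_sub]
        change _ = (wellMass H ε)⁻¹ * wellMass H ε - _
        rw [inv_mul_cancel₀ hN.ne']
      rw [hb, zero_sub, abs_neg, e, abs_mul, abs_of_pos (inv_pos.2 hN),
        abs_of_nonneg (intervalIntegral.integral_nonneg h2 fun y _ => (hg y).le)]
      gcongr
      have h4 : ∫ y in x..2, gam H ε y ≤ ∫ y in x..2, gam H ε x :=
        intervalIntegral.integral_mono_on h2 (hi _ _) (by simp) fun y hy =>
          hH.gam_antitoneOn ε h1.le (h1.le.trans hy.1) hy.1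
      simp only [intervalIntegral.integral_const, smul_eq_mul] at h4
      nlinarith [hg x]
    · rw [hb, plateau_of_two_le hH hint h2.le, sub_zero, abs_zero]
      have := hg x
      positivity
  rcases le_total 0 x with h | h
  · exact key x h
  · have h1 := key (-x) (by linarith)
    rw [hH.gam_neg, plateau_neg hH] at h1
    convert h1 using 3
    simp only [barrier, indicator, mem_Icc]
    congr 1
    exact propext ⟨fun h => ⟨by linarith, by linarith⟩, fun h => ⟨by linarith, by linarith⟩⟩

end

/-! ### A priori bounds and the balance law for the well masses -/

namespace IsSolution

variable {H : ℝ → ℝ} {ε C c : ℝ} {ρ0 : ℝ → ℝ} {ρ : ℝ → ℝ → ℝ}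

/-- The state is the velocity of the form flow, so its norm does not exceed the initial one, bounded
by well-preparedness. -/
lemma norm_state_le (h : IsSolution H ε ρ0 ρ) (hH : IsDoubleWell H) (hε : 0 < ε)
    (hint : Integrable (fun x => Real.exp (-H x / ε ^ 2))) (hwp : WellPrepared H ε C c ρ0)
    {t : ℝ} (ht : 0 ≤ t) : ‖state H ε ρ t‖ ≤ Real.sqrt C := by
  obtain ⟨Q, -, hF⟩ := h.exists_isFormFlow hH hint
  refine (hF.norm_deriv_le (tau_pos hε) ht).trans ?_
  exact Real.le_sqrt_of_sq_le (h.exists_initial_deriv hH hε hint hwp).1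

lemma integrable_mul (h : IsSolution H ε ρ0 ρ) (hH : IsDoubleWell H)
    (hint : Integrable (fun x => Real.exp (-H x / ε ^ 2))) {t : ℝ} (ht : 0 ≤ t) {g : ℝ → ℝ}
    (hg : MemLp (fun x => wt H ε x * g x) 2) : Integrable fun x => ρ t x * g x := by
  refine (integrable_mul_of_memLp (h.memLp hH hint ht) hg).congr (ae_of_all _ fun x => ?_)
  have := (wt_pos hint x).ne'
  field_simp

/-- The source of concentration: an observable small in `L²(γ)` has a small expectation under
`ρ(t)`, uniformly in `t`. -/
lemma abs_integral_mul_le (h : IsSolution H ε ρ0 ρ) (hH : IsDoubleWell H) (hε : 0 < ε)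
    (hint : Integrable (fun x => Real.exp (-H x / ε ^ 2))) (hwp : WellPrepared H ε C c ρ0)
    {t : ℝ} (ht : 0 ≤ t) {g : ℝ → ℝ} (hg : MemLp (fun x => wt H ε x * g x) 2) :
    |∫ x, ρ t x * g x| ≤ Real.sqrt C * Real.sqrt (∫ x, gam H ε x * g x ^ 2) := by
  rw [← h.inner_state hH hint ht hg]
  refine (abs_real_inner_le_norm _ _).trans ?_
  refine mul_le_mul (h.norm_state_le hH hε hint hwp ht) ?_ (norm_nonneg _) (Real.sqrt_nonneg _)
  refine Real.le_sqrt_of_sq_le ?_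
  rw [norm_toL2_sq hg]
  simp only [mul_wt_sq hint]
  exact le_rfl

/-- Conservation of mass. -/
lemma integral_eq_one (h : IsSolution H ε ρ0 ρ) (hH : IsDoubleWell H) (hε : 0 < ε)
    (hint : Integrable (fun x => Real.exp (-H x / ε ^ 2))) (hwp : WellPrepared H ε C c ρ0)
    {t : ℝ} (ht : 0 ≤ t) : ∫ x, ρ t x = 1 := by
  obtain ⟨Q, -, hF⟩ := h.exists_isFormFlow hH hint
  -- The constant `1` is admissible because `γ` is integrable; its derivative vanishes, so its
  -- pairing with the state is conserved.
  have hP : IsPrimitive (fun _ => (1 : ℝ)) (fun _ => 0) := ⟨locallyIntegrable_zero, by simp⟩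
  have m1 : MemLp (fun x => wt H ε x * (1 : ℝ)) 2 :=
    memLp_wt_mul_of_bounded hH hint (M := 1) aestronglyMeasurable_const (by simp)
  have m0 : MemLp (fun x => wt H ε x * (0 : ℝ)) 2 :=
    memLp_wt_mul_of_bounded hH hint (M := 0) aestronglyMeasurable_const (by simp)
  have key := hF.weak t ht _ (hP.mem_derivGraph m1 m0)
  have e0 : toL2 volume (fun x => wt H ε x * (0 : ℝ)) = 0 := by
    refine Lp.ext ?_
    filter_upwards [coeFn_toL2 m0, Lp.coeFn_zero ℝ 2 (volume : Measure ℝ)] with x h1 h2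
    rw [h1, h2]; simp
  simp only [e0, inner_zero_right, neg_zero, mul_eq_zero, (tau_pos hε).ne', false_or] at key
  rw [inner_sub_left, h.inner_state hH hint ht m1, h.inner_state hH hint le_rfl m1] at key
  simp only [mul_one] at key
  rw [integral_congr_ae h.initial, hwp.2.1] at key
  linarith

lemma integrable (h : IsSolution H ε ρ0 ρ) (hH : IsDoubleWell H)
    (hint : Integrable (fun x => Real.exp (-H x / ε ^ 2))) {t : ℝ} (ht : 0 ≤ t) :
    Integrable (ρ t) := by
  have := h.integrable_mul hH hint ht (g := fun _ => 1)
    (memLp_wt_mul_of_bounded hH hint (M := 1) aestronglyMeasurable_const (by simp))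
  simpa using this

lemma memLp_wellSign (hH : IsDoubleWell H)
    (hint : Integrable (fun x => Real.exp (-H x / ε ^ 2))) :
    MemLp (fun x => wt H ε x * wellSign x) 2 :=
  memLp_wt_mul_of_bounded hH hint measurable_wellSign.aestronglyMeasurable abs_wellSign_le

lemma memLp_committor (hH : IsDoubleWell H)
    (hint : Integrable (fun x => Real.exp (-H x / ε ^ 2))) :
    MemLp (fun x => wt H ε x * committor H ε x) 2 :=
  memLp_wt_mul_of_bounded hH hint
    (isPrimitive_committor hH hint).continuous.aestronglyMeasurable (abs_committor_le hH hint)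

/-- The slow dynamics seen by the committor function. -/
lemma abs_committor_balance_le (h : IsSolution H ε ρ0 ρ) (hH : IsDoubleWell H) (hε : 0 < ε)
    (hint : Integrable (fun x => Real.exp (-H x / ε ^ 2))) (hwp : WellPrepared H ε C c ρ0)
    {t : ℝ} (ht : 0 ≤ t) :
    |(∫ x, ρ t x * committor H ε x) - (∫ x, ρ 0 x * committor H ε x) +
      conductance H ε / tau ε * (wellMass H ε)⁻¹ * ∫ s in (0 : ℝ)..t, ∫ x, ρ s x * wellSign x| ≤
      conductance H ε / tau ε * (t * Real.sqrt (C * tau ε) * (wellMass H ε)⁻¹) := by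
  obtain ⟨Q, hQ0, hF⟩ := h.exists_isFormFlow hH hint
  obtain ⟨-, b, hb, hbC⟩ := h.exists_initial_deriv hH hε hint hwp
  have hτ := tau_pos hε
  have hκ := conductance_pos hH hint
  have hN := wellMass_pos hH hint
  have hw := fun x => (wt_pos hint x).ne'
  have hwg := fun x => wt_sq hint x
  have mσ := memLp_wellSign hH hint
  have mφ := memLp_committor hH hint
  have mχ : MemLp (fun x => barrier x / wt H ε x) 2 := by
    have hc : Continuous fun x => (1 : ℝ) / wt H ε x :=
      continuous_const.div (continuous_wt hH ε) hw
    have h1 : MemLp ((Icc (-1 : ℝ) 1).indicator fun x => 1 / wt H ε x) 2 := by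
      refine (memLp_indicator_iff_restrict measurableSet_Icc).2 ?_
      exact memLp_two_of_integrable_sq hc.aestronglyMeasurable (hc.pow 2).integrableOn_Icc
    convert h1 using 2 with x
    by_cases hx : x ∈ Icc (-1 : ℝ) 1 <;> simp [barrier, hx]
  have mdiff : MemLp (fun x => (barrier x - plateau H ε x) / wt H ε x) 2 := by
    refine MemLp.mono (g := fun x => wt H ε x * (wellMass H ε)⁻¹)
      (memLp_wt_mul_of_bounded hH hint (M := |(wellMass H ε)⁻¹|) aestronglyMeasurable_const
        (fun _ => le_rfl)) ?_ (ae_of_all _ fun x => ?_)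
    · have h1 : Measurable barrier := measurable_const.indicator measurableSet_Icc
      exact ((h1.sub (isPrimitive_plateau hH hint).continuous.measurable).div
        (continuous_wt hH ε).measurable).aestronglyMeasurable
    · rw [norm_div, norm_mul, Real.norm_of_nonneg (wt_pos hint x).le,
        Real.norm_of_nonneg (inv_pos.2 hN).le, div_le_iff₀ (wt_pos hint x)]
      have := abs_barrier_sub_plateau_le hH hint x
      rw [← hwg] at this
      rw [Real.norm_eq_abs]
      linarith
  have mθ : MemLp (fun x => plateau H ε x / wt H ε x) 2 := by
    have h1 := mχ.sub mdiff
    refine (memLp_congr_ae (ae_of_all _ fun x => ?_)).1 h1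
    simp only [Pi.sub_apply]
    ring
  have eθ' : (fun x => plateauDeriv H ε x / wt H ε x) =
      fun x => -(wellMass H ε)⁻¹ * (wt H ε x * wellSign x) := by
    ext x
    rw [plateauDeriv, ← hwg]
    have := hw x
    field_simp
  have mθ' : MemLp (fun x => plateauDeriv H ε x / wt H ε x) 2 := by
    rw [eθ']; exact mσ.const_mul _
  have eφ' : (fun x => wt H ε x * committorDeriv H ε x) =
      fun x => conductance H ε * (barrier x / wt H ε x) := by
    ext x
    by_cases hx : x ∈ Icc (-1 : ℝ) 1
    · simp only [committorDeriv, barrier, indicator_of_mem hx]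
      rw [← hwg]
      have := hw x
      field_simp
    · simp only [committorDeriv, barrier, indicator_of_notMem hx]
      simp
  have mφ' : MemLp (fun x => wt H ε x * committorDeriv H ε x) 2 := by
    rw [eφ']; exact mχ.const_mul _
  -- First identity: testing with the committor, `τ` times the change of `∫ ρ φ` is `-κ ⟪Q t,
  -- 1_{[-1,1]} / √γ⟫`.
  have w1 := hF.weak t ht _ ((isPrimitive_committor hH hint).mem_derivGraph mφ mφ')
  -- Second identity: pairing the plateau with `∂ₓU`, `U = ∫_0^t u`, and moving the derivative onto
  -- the plateau produces the time-integrated mass difference divided by `wellMass`.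
  have w2 := inner_eq_neg_inner_of_weak hH hint mθ' mθ (by
    intro ψ hψ hψs
    have hP := isPrimitive_plateau hH hint
    have hd := hψ.continuous_deriv (by simp)
    have := hP.integral_mul_eq_zero (IsPrimitive.of_contDiff (hψ.of_le (by simp)))
      (integrable_mul_of_hasCompactSupport hP.locallyIntegrable hψ.continuous hψs)
      (integrable_mul_of_hasCompactSupport hP.continuous.locallyIntegrable hd hψs.deriv)
      (integrable_mul_of_hasCompactSupport hP.continuous.locallyIntegrable hψ.continuous hψs)
    linarith) (hF.mem_graph t ht)
  simp only at w1 w2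
  rw [eφ', toL2_const_mul _ mχ, inner_smul_right, inner_sub_left, h.inner_state hH hint ht mφ,
    h.inner_state hH hint le_rfl mφ] at w1
  rw [eθ', toL2_const_mul _ mσ, inner_smul_left, real_inner_comm,
    inner_intervalIntegral (h.continuous_state hH hint)] at w2
  have e3 : ∫ s in (0 : ℝ)..t, ⟪state H ε ρ s, toL2 volume fun x => wt H ε x * wellSign x⟫ =
      ∫ s in (0 : ℝ)..t, ∫ x, ρ s x * wellSign x := by
    refine intervalIntegral.integral_congr fun s hs => ?_
    rw [uIcc_of_le ht] at hs
    exact h.inner_state hH hint hs.1 mσ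
  rw [e3] at w2
  have e4 : toL2 volume (fun x => (barrier x - plateau H ε x) / wt H ε x) =
      toL2 volume (fun x => barrier x / wt H ε x) -
        toL2 volume (fun x => plateau H ε x / wt H ε x) := by
    rw [toL2_sub mχ mθ]
    simp only [sub_div]
  -- The pointwise error `N⁻¹ γ` divided by `√γ` is `N⁻¹ √γ`, of norm `N⁻¹` because `γ` has mass
  -- one.
  have n1 : ‖toL2 volume (fun x => (barrier x - plateau H ε x) / wt H ε x)‖ ≤
      (wellMass H ε)⁻¹ := by
    refine le_of_sq_le_sq ?_ (inv_pos.2 hN).le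
    rw [norm_toL2_sq mdiff]
    simp only [div_wt_sq hint]
    have h1 : ∫ x, (barrier x - plateau H ε x) ^ 2 / gam H ε x ≤
        ∫ x, (wellMass H ε)⁻¹ ^ 2 * gam H ε x := by
      refine integral_mono_of_nonneg (ae_of_all _ fun x => ?_)
        ((integrable_gam hint).const_mul _) (ae_of_all _ fun x => ?_)
      · have := (gam_pos hint x).le
        simp only [Pi.zero_apply]
        positivity
      · have hg := gam_pos hint x
        have h2 := pow_le_pow_left₀ (abs_nonneg _) (abs_barrier_sub_plateau_le hH hint x) 2
        rw [sq_abs] at h2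
        simp only
        rw [div_le_iff₀ hg]
        linarith
    rwa [integral_const_mul, integral_gam hint, mul_one] at h1
  have n2 : ‖Q t‖ ≤ t * Real.sqrt (C * tau ε) := by
    refine (hF.norm_le_mul hτ.le hQ0 hb ht).trans ?_
    gcongr
    exact Real.le_sqrt_of_sq_le hbC
  -- After both identities, only the pairing of `Q t` with indicator minus plateau is left.
  have e5 : (∫ x, ρ t x * committor H ε x) - (∫ x, ρ 0 x * committor H ε x) +
      conductance H ε / tau ε * (wellMass H ε)⁻¹ * ∫ s in (0 : ℝ)..t, ∫ x, ρ s x * wellSign x =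
      -(conductance H ε / tau ε) *
        ⟪Q t, toL2 volume (fun x => (barrier x - plateau H ε x) / wt H ε x)⟫ := by
    rw [e4, inner_sub_right]
    simp only [RCLike.conj_to_real] at w2
    rw [real_inner_comm (Q t)] at w2
    field_simp
    field_simp at w2
    linear_combination (wellMass H ε) * w1 - conductance H ε * w2
  rw [e5, abs_mul, abs_neg, abs_of_pos (div_pos hκ hτ)]
  gcongr
  refine (abs_real_inner_le_norm _ _).trans ?_
  exact mul_le_mul n2 n1 (norm_nonneg _) ((norm_nonneg _).trans n2)

/-- The committor may be replaced by the difference of the masses of the wells. -/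
lemma abs_integral_committor_sub_le (h : IsSolution H ε ρ0 ρ) (hH : IsDoubleWell H) (hε : 0 < ε)
    (hint : Integrable (fun x => Real.exp (-H x / ε ^ 2))) (hwp : WellPrepared H ε C c ρ0)
    {t : ℝ} (ht : 0 ≤ t) :
    |(∫ x, ρ t x * committor H ε x) - ∫ x, ρ t x * wellSign x| ≤ Real.sqrt C *
      Real.sqrt (2 * conductance H ε + ∫ x, {x | 2 ≤ |x|}.indicator (fun _ => 1) x * gam H ε x) := by
  have mσ := memLp_wellSign hH hint
  have mφ := memLp_committor hH hint
  have m : MemLp (fun x => wt H ε x * (committor H ε x - wellSign x)) 2 := by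
    simp only [mul_sub]; exact mφ.sub mσ
  have h1 := h.abs_integral_mul_le hH hε hint hwp ht m
  simp only [mul_sub] at h1
  rw [integral_sub (h.integrable_mul hH hint ht mφ) (h.integrable_mul hH hint ht mσ)] at h1
  refine h1.trans ?_
  gcongr
  have i1 : Integrable ((Icc (-1 : ℝ) 1).indicator (fun _ => conductance H ε)) :=
    (integrable_indicator_iff measurableSet_Icc).2 (by simp)
  have i2 : Integrable fun x => {x : ℝ | 2 ≤ |x|}.indicator (fun _ => (1 : ℝ)) x * gam H ε x := by
    refine (integrable_gam hint).mono' ?_ (ae_of_all _ fun x => ?_)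
    · exact ((measurable_const.indicator (measurableSet_le measurable_const
        measurable_id.abs)).mul (hH.continuous_gam ε).measurable).aestronglyMeasurable
    · have hg := (gam_pos hint x).le
      rw [norm_mul, Real.norm_of_nonneg hg]
      refine mul_le_of_le_one_left hg ?_
      refine (norm_indicator_le_norm_self _ _).trans (by simp)
  have h2 : ∫ x, gam H ε x * (committor H ε x - wellSign x) ^ 2 ≤
      ∫ x, ((Icc (-1) 1).indicator (fun _ => conductance H ε) x +
        {x | 2 ≤ |x|}.indicator (fun _ => 1) x * gam H ε x) := by
    refine integral_mono_of_nonneg (ae_of_all _ fun x => ?_) (i1.add i2)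
      (ae_of_all _ fun x => gam_mul_committor_sub_wellSign_sq_le hH hint x)
    have := (gam_pos hint x).le
    simp only [Pi.zero_apply]
    positivity
  rw [integral_add i1 i2, integral_indicator measurableSet_Icc] at h2
  refine h2.trans (le_of_eq ?_)
  simp
  norm_num

end IsSolution

/-- Stability of the integrated form of the equation `D' = -k D`. -/
lemma abs_sub_exp_le_of_integral {D : ℝ → ℝ} {K k η d₀ T : ℝ} (hk : 0 < k)
    (hD : Continuous D) (hD1 : ∀ t ∈ Icc 0 T, |D t| ≤ 1)
    (h : ∀ t ∈ Icc 0 T, |D t - D 0 + K * ∫ s in (0 : ℝ)..t, D s| ≤ η) {t : ℝ}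
    (ht : t ∈ Icc 0 T) :
    |D t - d₀ * Real.exp (-k * t)| ≤ (η + |D 0 - d₀| + |K - k| * T) * Real.exp (k * t) := by
  set ν := η + |D 0 - d₀| + |K - k| * T with hν
  -- The error of the primitive of `D`: `D` itself is only continuous, whereas `E` is differentiable
  -- with the sought error as derivative. Gronwall bounds `k |E|` by `ν (e^{kt} - 1)`, and adding
  -- `ν` gives the claim.
  set E : ℝ → ℝ := fun t => (∫ s in (0 : ℝ)..t, D s) - d₀ / k * (1 - Real.exp (-k * t)) with hE
  have hEd : ∀ t, HasDerivAt E (D t - d₀ * Real.exp (-k * t)) t := by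
    intro t
    have h1 : HasDerivAt (fun t => ∫ s in (0 : ℝ)..t, D s) (D t) t :=
      intervalIntegral.integral_hasDerivAt_right (hD.intervalIntegrable _ _)
        (hD.stronglyMeasurableAtFilter _ _) hD.continuousAt
    have h2 : HasDerivAt (fun t => d₀ / k * (1 - Real.exp (-k * t)))
        (d₀ / k * (0 - Real.exp (-k * t) * (-k * 1))) t :=
      (((hasDerivAt_const t (1 : ℝ)).sub (((hasDerivAt_id t).const_mul (-k)).exp))).const_mul _
    refine (h1.sub h2).congr_deriv ?_
    field_simp
    ring
  have hbd : ∀ t ∈ Icc 0 T, |D t - d₀ * Real.exp (-k * t)| ≤ k * |E t| + ν := by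
    intro t ht
    have e : D t - d₀ * Real.exp (-k * t) = (D t - D 0 + K * ∫ s in (0 : ℝ)..t, D s) +
        (D 0 - d₀) - (K - k) * (∫ s in (0 : ℝ)..t, D s) - k * E t := by
      simp only [hE]
      field_simp
      ring
    have h1 : |∫ s in (0 : ℝ)..t, D s| ≤ T := by
      have := intervalIntegral.norm_integral_le_of_norm_le_const (a := 0) (b := t) (C := 1)
        (f := D) (fun s hs => by
          rw [uIoc_of_le ht.1] at hs
          exact hD1 s ⟨hs.1.le, hs.2.trans ht.2⟩)
      rw [sub_zero, one_mul, abs_of_nonneg ht.1] at this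
      exact this.trans ht.2
    have h2 := h t ht
    have h3 : |(K - k) * ∫ s in (0 : ℝ)..t, D s| ≤ |K - k| * T := by
      rw [abs_mul]; gcongr
    have h4 : |k * E t| = k * |E t| := by rw [abs_mul, abs_of_pos hk]
    rw [e]
    calc _ ≤ |D t - D 0 + K * ∫ s in (0 : ℝ)..t, D s| + |D 0 - d₀| +
          |(K - k) * ∫ s in (0 : ℝ)..t, D s| + |k * E t| :=
          (abs_sub _ _).trans (add_le_add_left ((abs_sub _ _).trans
            (add_le_add_left (abs_add_le _ _) _)) _)
      _ ≤ _ := by rw [h4, hν]; linarith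
  have hE0 : E 0 = 0 := by simp [hE]
  have hg := norm_le_gronwallBound_of_norm_deriv_right_le (f := E)
    (f' := fun t => D t - d₀ * Real.exp (-k * t)) (δ := 0) (K := k) (ε := ν) (a := 0) (b := T)
    (fun t _ => (hEd t).continuousAt.continuousWithinAt)
    (fun t _ => (hEd t).hasDerivWithinAt) (by simp [hE0])
    (fun t ht => hbd t ⟨ht.1, ht.2.le⟩) t ht
  simp only [gronwallBound_of_K_ne_0 hk.ne', zero_mul, zero_add, sub_zero, Real.norm_eq_abs] at hg
  have h5 := hbd t ht
  have h6 : k * |E t| ≤ ν * (Real.exp (k * t) - 1) := by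
    calc k * |E t| ≤ k * (ν / k * (Real.exp (k * t) - 1)) := by gcongr
      _ = _ := by field_simp
  linarith

/-! ### Convergence of the densities -/

/-- A family of well-prepared solutions. -/
structure IsFamily (H : ℝ → ℝ) (ε₀ C c : ℝ) (ρ0 : ℝ → ℝ → ℝ) (ρ : ℝ → ℝ → ℝ → ℝ)
    (μ0 : Measure ℝ) : Prop where
  doubleWell : IsDoubleWell H
  pos : 0 < ε₀
  integrable_exp : ∀ ε ∈ Ioo 0 ε₀, Integrable (fun x => Real.exp (-H x / ε ^ 2))
  isSolution : ∀ ε ∈ Ioo 0 ε₀, IsSolution H ε (ρ0 ε) (ρ ε)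
  const_pos : 0 < c
  wellPrepared : ∀ ε ∈ Ioo 0 ε₀, WellPrepared H ε C c (ρ0 ε)
  tendsto_initial : ∀ ψ : ℝ →ᵇ ℝ,
    Tendsto (fun ε => ∫ x, ρ0 ε x * ψ x) (𝓝[>] 0) (𝓝 (∫ x, ψ x ∂μ0))

/-- The solution of the limit equation `u' = -k (u - 1)`. -/
def limitCurve (k : ℝ) (μ0 : Measure ℝ) (t : ℝ) : ℝ :=
  1 + (2 * μ0.real (Ioi 0) - 1) * Real.exp (-k * t)

namespace IsFamily

variable {H : ℝ → ℝ} {ε₀ C c : ℝ} {ρ0 : ℝ → ℝ → ℝ} {ρ : ℝ → ℝ → ℝ → ℝ} {μ0 : Measure ℝ}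

lemma eventually_mem (F : IsFamily H ε₀ C c ρ0 ρ μ0) : ∀ᶠ ε in 𝓝[>] (0 : ℝ), ε ∈ Ioo 0 ε₀ :=
  Ioo_mem_nhdsGT F.pos

lemma tendsto_integral_mul_gam (F : IsFamily H ε₀ C c ρ0 ρ μ0) {g : ℝ → ℝ} {M : ℝ}
    (hg : Measurable g) (hgM : ∀ x, |g x| ≤ M) (hgc : ContinuousAt g 1)
    (hgc' : ContinuousAt g (-1)) :
    Tendsto (fun ε => ∫ x, g x * gam H ε x) (𝓝[>] 0) (𝓝 ((g 1 + g (-1)) / 2)) :=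
  F.doubleWell.tendsto_integral_mul_gam (half_pos F.pos)
    (F.integrable_exp _ ⟨half_pos F.pos, half_lt_self F.pos⟩) hg hgM hgc hgc'

/-- The bound for `∫ ρ g` in terms of `∫ γ g²` tends to zero if `g` vanishes at the wells. -/
lemma tendsto_concentration_bound (F : IsFamily H ε₀ C c ρ0 ρ μ0) {g : ℝ → ℝ} {M : ℝ}
    (hg : Measurable g) (hgM : ∀ x, |g x| ≤ M) (hgc : ContinuousAt g 1)
    (hgc' : ContinuousAt g (-1)) (h1 : g 1 = 0) (h2 : g (-1) = 0) :
    Tendsto (fun ε => Real.sqrt C * Real.sqrt (∫ x, gam H ε x * g x ^ 2)) (𝓝[>] 0) (𝓝 0) := by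
  have h := F.tendsto_integral_mul_gam (g := fun x => g x ^ 2) (M := M ^ 2) (hg.pow_const 2)
    (fun x => by
      rw [abs_of_nonneg (sq_nonneg _), ← sq_abs]
      exact pow_le_pow_left₀ (abs_nonneg _) (hgM x) 2) (hgc.pow 2) (hgc'.pow 2)
  have h3 := h.sqrt.const_mul (Real.sqrt C)
  simp only [h1, h2, mul_comm (_ ^ 2)] at h3
  simpa using h3

/-- The uniform `L²(γ)` bound forces `ρ` onto the wells as soon as `γ` concentrates there.
Continuity of `g` is needed only at `±1`, which allows the discontinuous `wellSign`. -/
lemma tendsto_integral_mul_of_eq_zero (F : IsFamily H ε₀ C c ρ0 ρ μ0) {t : ℝ} (ht : 0 ≤ t)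
    {g : ℝ → ℝ} {M : ℝ} (hg : Measurable g) (hgM : ∀ x, |g x| ≤ M) (hgc : ContinuousAt g 1)
    (hgc' : ContinuousAt g (-1)) (h1 : g 1 = 0) (h2 : g (-1) = 0) :
    Tendsto (fun ε => ∫ x, ρ ε t x * g x) (𝓝[>] 0) (𝓝 0) := by
  refine squeeze_zero_norm' ?_ (F.tendsto_concentration_bound hg hgM hgc hgc' h1 h2)
  filter_upwards [F.eventually_mem] with ε hε
  exact (F.isSolution ε hε).abs_integral_mul_le F.doubleWell hε.1 (F.integrable_exp ε hε)
    (F.wellPrepared ε hε) ht (memLp_wt_mul_of_bounded F.doubleWell (F.integrable_exp ε hε)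
      hg.aestronglyMeasurable hgM)

lemma integral_initial (F : IsFamily H ε₀ C c ρ0 ρ μ0) {ε : ℝ} (hε : ε ∈ Ioo 0 ε₀) (g : ℝ → ℝ) :
    ∫ x, ρ ε 0 x * g x = ∫ x, ρ0 ε x * g x := by
  refine integral_congr_ae ?_
  filter_upwards [(F.isSolution ε hε).initial] with x hx
  rw [hx]

/-- The initial measure is carried by the wells. -/
lemma ae_abs_eq_one [IsProbabilityMeasure μ0] (F : IsFamily H ε₀ C c ρ0 ρ μ0) :
    ∀ᵐ x ∂μ0, |x| = 1 := by
  -- Bounded, continuous, nonnegative, and zero exactly at `±1`: its integral against the initial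
  -- measure vanishes by concentration.
  set ψ : ℝ →ᵇ ℝ := BoundedContinuousFunction.ofNormedAddCommGroup
    (fun x : ℝ => min 1 |(|x| - 1)|) (by fun_prop) 1 (fun x => by
      rw [Real.norm_of_nonneg (by positivity)]; exact min_le_left _ _) with hψ
  have hψx : ∀ x, ψ x = min 1 |(|x| - 1)| := fun x => rfl
  have h1 := F.tendsto_integral_mul_of_eq_zero le_rfl (g := ψ) (M := ‖ψ‖)
    ψ.continuous.measurable (fun x => ψ.norm_coe_le_norm x) ψ.continuous.continuousAt
    ψ.continuous.continuousAt (by simp [hψx]) (by simp [hψx])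
  have h2 : ∫ x, ψ x ∂μ0 = 0 := by
    refine tendsto_nhds_unique ((F.tendsto_initial ψ).congr' ?_) h1
    filter_upwards [F.eventually_mem] with ε hε using (F.integral_initial hε _).symm
  rw [integral_eq_zero_iff_of_nonneg (fun x => by rw [hψx]; simp) (ψ.integrable μ0)] at h2
  filter_upwards [h2] with x hx
  rw [hψx, Pi.zero_apply] at hx
  rcases min_choice 1 |(|x| - 1)| with h | h
  · rw [h] at hx; norm_num at hx
  · rw [h, abs_eq_zero] at hx; linarith

lemma continuousAt_wellSign : ContinuousAt wellSign 1 ∧ ContinuousAt wellSign (-1) := by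
  have h1 : wellSign =ᶠ[𝓝 1] fun _ => 1 := by
    filter_upwards [Ioo_mem_nhds (zero_lt_one' ℝ) one_lt_two] with x hx
    exact wellSign_of_pos hx.1 hx.2.le
  have h2 : wellSign =ᶠ[𝓝 (-1)] fun _ => -1 := by
    filter_upwards [Ioo_mem_nhds (show (-2 : ℝ) < -1 by norm_num) (show (-1 : ℝ) < 0 by norm_num)]
      with x hx
    rw [← neg_neg x, wellSign_neg, wellSign_of_pos (by linarith [hx.2]) (by linarith [hx.1])]
  exact ⟨continuousAt_const.congr h1.symm, continuousAt_const.congr h2.symm⟩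

lemma wellSign_one : wellSign 1 = 1 := wellSign_of_pos one_pos one_le_two

lemma wellSign_neg_one : wellSign (-1) = -1 := by rw [wellSign_neg, wellSign_one]

/-- Weak convergence cannot be tested with `wellSign` directly. The identity clipped to `[-1, 1]` is
continuous and agrees with it at the wells, so the difference is negligible; the initial measure is
carried by `±1`, which gives the value of the limit. -/
lemma tendsto_initial_wellSign [IsProbabilityMeasure μ0] (F : IsFamily H ε₀ C c ρ0 ρ μ0) :
    Tendsto (fun ε => ∫ x, ρ ε 0 x * wellSign x) (𝓝[>] 0) (𝓝 (2 * μ0.real (Ioi 0) - 1)) := by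
  set ψ : ℝ →ᵇ ℝ := BoundedContinuousFunction.ofNormedAddCommGroup
    (fun x : ℝ => max (-1) (min 1 x)) (by fun_prop) 1 (fun x => by
      rw [Real.norm_eq_abs, abs_le]
      exact ⟨le_max_left _ _, max_le (by norm_num) (min_le_left _ _)⟩) with hψ
  have hψx : ∀ x, ψ x = max (-1) (min 1 x) := fun x => rfl
  have hψ1 : ψ 1 = 1 := by rw [hψx]; norm_num
  have hψ2 : ψ (-1) = -1 := by rw [hψx]; norm_num
  have hψb : ∀ x, |ψ x| ≤ ‖ψ‖ := fun x => ψ.norm_coe_le_norm x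
  have h1 := F.tendsto_integral_mul_of_eq_zero le_rfl (g := fun x => wellSign x - ψ x)
    (M := 1 + ‖ψ‖) (measurable_wellSign.sub ψ.continuous.measurable)
    (fun x => (abs_sub _ _).trans (add_le_add (abs_wellSign_le x) (hψb x)))
    (continuousAt_wellSign.1.sub ψ.continuous.continuousAt)
    (continuousAt_wellSign.2.sub ψ.continuous.continuousAt)
    (by simp [hψ1, wellSign_one]) (by simp [hψ2, wellSign_neg_one])
  have h2 : ∫ x, ψ x ∂μ0 = 2 * μ0.real (Ioi 0) - 1 := by
    have e : ψ =ᵐ[μ0] fun x => 2 * (Ioi (0 : ℝ)).indicator (fun _ => (1 : ℝ)) x - 1 := by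
      filter_upwards [F.ae_abs_eq_one] with x hx
      rcases eq_or_eq_neg_of_abs_eq hx with rfl | rfl
      · rw [hψ1]; simp; norm_num
      · rw [hψ2]; simp
    have hi : Integrable ((Ioi (0 : ℝ)).indicator (fun _ => (1 : ℝ))) μ0 :=
      (integrable_const 1).indicator measurableSet_Ioi
    rw [integral_congr_ae e, integral_sub (hi.const_mul 2) (integrable_const 1),
      integral_const_mul, integral_indicator_const _ measurableSet_Ioi]
    simp
  have h3 := h1.add (F.tendsto_initial ψ)
  rw [zero_add, h2] at h3
  refine h3.congr' ?_
  filter_upwards [F.eventually_mem] with ε hε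
  have hS := F.isSolution ε hε
  have hint := F.integrable_exp ε hε
  rw [← F.integral_initial hε]
  simp only [mul_sub]
  rw [integral_sub (hS.integrable_mul F.doubleWell hint le_rfl
      (IsSolution.memLp_wellSign F.doubleWell hint))
    (hS.integrable_mul F.doubleWell hint le_rfl (memLp_wt_mul_of_bounded F.doubleWell hint
      ψ.continuous.aestronglyMeasurable hψb)), sub_add_cancel]

lemma abs_indicator_one_le (s : Set ℝ) (x : ℝ) : |s.indicator (fun _ => (1 : ℝ)) x| ≤ 1 := by
  by_cases hx : x ∈ s <;> simp [hx]

lemma tendsto_wellMass (F : IsFamily H ε₀ C c ρ0 ρ μ0) :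
    Tendsto (wellMass H) (𝓝[>] 0) (𝓝 (1 / 2)) := by
  have c1 : (Ioc (0 : ℝ) 2).indicator (fun _ => (1 : ℝ)) =ᶠ[𝓝 1] fun _ => 1 := by
    filter_upwards [Ioo_mem_nhds (zero_lt_one' ℝ) one_lt_two] with x hx
    exact indicator_of_mem (mem_Ioc.2 ⟨hx.1, hx.2.le⟩) _
  have c2 : (Ioc (0 : ℝ) 2).indicator (fun _ => (1 : ℝ)) =ᶠ[𝓝 (-1)] fun _ => 0 := by
    filter_upwards [Iio_mem_nhds (show (-1 : ℝ) < 0 by norm_num)] with x hx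
    exact indicator_of_notMem (fun h => absurd h.1 (not_lt.2 (le_of_lt hx))) _
  have h := F.tendsto_integral_mul_gam (g := (Ioc (0 : ℝ) 2).indicator fun _ => (1 : ℝ)) (M := 1)
    (measurable_const.indicator measurableSet_Ioc)
    (abs_indicator_one_le _)
    (continuousAt_const.congr c1.symm) (continuousAt_const.congr c2.symm)
  rw [c1.eq_of_nhds, c2.eq_of_nhds, add_zero] at h
  refine h.congr fun ε => ?_
  rw [wellMass, intervalIntegral.integral_of_le zero_le_two, ← integral_indicator measurableSet_Ioc]
  congr 1; ext x
  by_cases hx : x ∈ Ioc (0 : ℝ) 2 <;> simp [hx]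

lemma tendsto_outer_mass (F : IsFamily H ε₀ C c ρ0 ρ μ0) :
    Tendsto (fun ε => ∫ x, {x | 2 ≤ |x|}.indicator (fun _ => 1) x * gam H ε x) (𝓝[>] 0)
      (𝓝 0) := by
  have key : ∀ y : ℝ, |y| < 2 → {x : ℝ | 2 ≤ |x|}.indicator (fun _ => (1 : ℝ)) =ᶠ[𝓝 y] fun _ => 0 := by
    intro y hy
    filter_upwards [continuous_abs.continuousAt.eventually_lt_const hy] with x hx
    rw [indicator_of_notMem]
    exact not_le.2 hx
  have c1 := key 1 (by norm_num)
  have c2 := key (-1) (by norm_num)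
  have h := F.tendsto_integral_mul_gam (g := {x : ℝ | 2 ≤ |x|}.indicator fun _ => (1 : ℝ)) (M := 1)
    (measurable_const.indicator (measurableSet_le measurable_const measurable_id.abs))
    (abs_indicator_one_le _)
    (continuousAt_const.congr c1.symm) (continuousAt_const.congr c2.symm)
  rwa [c1.eq_of_nhds, c2.eq_of_nhds, add_zero, zero_div] at h

lemma tendsto_conductance_div_tau (F : IsFamily H ε₀ C c ρ0 ρ μ0) :
    Tendsto (fun ε => conductance H ε / tau ε) (𝓝[>] 0) (𝓝 (rate H / 2)) :=
  F.doubleWell.tendsto_conductance_div_tau (half_pos F.pos)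
    (F.integrable_exp _ ⟨half_pos F.pos, half_lt_self F.pos⟩)

lemma tendsto_conductance (F : IsFamily H ε₀ C c ρ0 ρ μ0) :
    Tendsto (conductance H) (𝓝[>] 0) (𝓝 0) := by
  have h := F.tendsto_conductance_div_tau.mul tendsto_tau
  rw [mul_zero] at h
  refine h.congr' ?_
  filter_upwards [self_mem_nhdsWithin] with ε hε
  exact div_mul_cancel₀ _ (tau_pos hε).ne'

/-- The difference of the masses of the two wells satisfies the limit equation. -/
lemma tendsto_wellSign [IsProbabilityMeasure μ0] (F : IsFamily H ε₀ C c ρ0 ρ μ0) {t : ℝ}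
    (ht : 0 ≤ t) :
    Tendsto (fun ε => ∫ x, ρ ε t x * wellSign x) (𝓝[>] 0) (𝓝 (limitCurve (rate H) μ0 t - 1)) := by
  set d₀ := 2 * μ0.real (Ioi 0) - 1 with hd₀
  have hk := F.doubleWell.rate_pos
  set K : ℝ → ℝ := fun ε => conductance H ε / tau ε * (wellMass H ε)⁻¹ with hK
  set A : ℝ → ℝ := fun ε => conductance H ε / tau ε *
    (t * Real.sqrt (C * tau ε) * (wellMass H ε)⁻¹) with hA
  set B : ℝ → ℝ := fun ε => Real.sqrt C * Real.sqrt (2 * conductance H ε +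
    ∫ x, {x | 2 ≤ |x|}.indicator (fun _ => 1) x * gam H ε x) with hB
  have hN := F.tendsto_wellMass.inv₀ (by norm_num)
  -- `(k / 2) / (1 / 2) = k`: Kramers' formula divided by the limiting mass of one well.
  have hKlim : Tendsto K (𝓝[>] 0) (𝓝 (rate H)) := by
    have := F.tendsto_conductance_div_tau.mul hN
    convert this using 2
    norm_num
  have hAlim : Tendsto A (𝓝[>] 0) (𝓝 0) := by
    have := F.tendsto_conductance_div_tau.mul
      (((tendsto_tau.const_mul C).sqrt.const_mul t).mul hN)
    simpa using this
  have hBlim : Tendsto B (𝓝[>] 0) (𝓝 0) := by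
    have := (((F.tendsto_conductance.const_mul 2).add F.tendsto_outer_mass).sqrt).const_mul
      (Real.sqrt C)
    simpa using this
  have h0 := F.tendsto_initial_wellSign
  have hlim : Tendsto (fun ε => ((A ε + 2 * B ε) + |(∫ x, ρ ε 0 x * wellSign x) - d₀| +
      |K ε - rate H| * t) * Real.exp (rate H * t)) (𝓝[>] 0) (𝓝 0) := by
    have h1 := (h0.sub_const d₀).abs
    have h2 := (hKlim.sub_const (rate H)).abs.mul_const t
    have h3 := (((hAlim.add (hBlim.const_mul 2)).add h1).add h2).mul_const (Real.exp (rate H * t))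
    simpa [hd₀] using h3
  rw [tendsto_iff_norm_sub_tendsto_zero]
  refine squeeze_zero' (Eventually.of_forall fun _ => norm_nonneg _) ?_ hlim
  filter_upwards [F.eventually_mem] with ε hε
  have hS := F.isSolution ε hε
  have hint := F.integrable_exp ε hε
  have hW := F.wellPrepared ε hε
  have hH := F.doubleWell
  have mσ := IsSolution.memLp_wellSign hH hint
  -- Written through the frozen state, the mass difference is continuous on all of `ℝ`, as the
  -- Gronwall lemma requires.
  set D : ℝ → ℝ := fun s => ⟪state H ε (ρ ε) s, toL2 volume fun x => wt H ε x * wellSign x⟫ with hD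
  have hDc : Continuous D := by
    have := hS.continuous_state hH hint
    fun_prop
  have hDs : ∀ s, 0 ≤ s → D s = ∫ x, ρ ε s x * wellSign x := fun s hs =>
    hS.inner_state hH hint hs mσ
  have hD1 : ∀ s ∈ Icc 0 t, |D s| ≤ 1 := by
    intro s hs
    have h1 := norm_integral_le_integral_norm (μ := volume) fun x => ρ ε s x * wellSign x
    rw [hDs s hs.1]
    refine h1.trans ?_
    rw [← hS.integral_eq_one hH hε.1 hint hW hs.1]
    refine integral_mono_of_nonneg (ae_of_all _ fun x => norm_nonneg _)
      (hS.integrable hH hint hs.1) (ae_of_all _ fun x => ?_)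
    have := hS.nonneg s hs.1 x
    simp only [norm_mul, Real.norm_eq_abs, abs_of_nonneg this]
    exact mul_le_of_le_one_right this (abs_wellSign_le x)
  have hκ := div_pos (conductance_pos hH hint) (tau_pos hε.1)
  have hNp := wellMass_pos hH hint
  -- The committor is replaced by `wellSign` at both times `s` and `0`, whence `2 * B ε`.
  have hbal : ∀ s ∈ Icc 0 t, |D s - D 0 + K ε * ∫ r in (0 : ℝ)..s, D r| ≤ A ε + 2 * B ε := by
    intro s hs
    have h1 := hS.abs_committor_balance_le hH hε.1 hint hW hs.1
    have h2 := hS.abs_integral_committor_sub_le hH hε.1 hint hW hs.1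
    have h3 := hS.abs_integral_committor_sub_le hH hε.1 hint hW le_rfl
    have h4 : conductance H ε / tau ε * (s * Real.sqrt (C * tau ε) * (wellMass H ε)⁻¹) ≤ A ε := by
      simp only [hA]
      have := hs.2
      gcongr
    have e : ∫ r in (0 : ℝ)..s, D r = ∫ r in (0 : ℝ)..s, ∫ x, ρ ε r x * wellSign x := by
      refine intervalIntegral.integral_congr fun r hr => ?_
      rw [uIcc_of_le hs.1] at hr
      exact hDs r hr.1
    rw [e, hDs s hs.1, hDs 0 le_rfl]
    rw [abs_le] at h1 h2 h3 ⊢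
    simp only [hK]
    constructor <;> linarith
  have key := abs_sub_exp_le_of_integral (d₀ := d₀) hk hDc hD1 hbal (right_mem_Icc.2 ht)
  rw [hDs t ht, hDs 0 le_rfl] at key
  rw [limitCurve, add_sub_cancel_left, Real.norm_eq_abs]
  exact key

/-- Weak convergence of the solutions to the limit curve. -/
lemma tendsto_integral_mul [IsProbabilityMeasure μ0] (F : IsFamily H ε₀ C c ρ0 ρ μ0) {t : ℝ}
    (ht : 0 ≤ t) {g : ℝ → ℝ} {M : ℝ} (hg : Measurable g) (hgM : ∀ x, |g x| ≤ M)
    (hgc : ContinuousAt g 1) (hgc' : ContinuousAt g (-1)) :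
    Tendsto (fun ε => ∫ x, ρ ε t x * g x) (𝓝[>] 0)
      (𝓝 ((1 / 2) * (limitCurve (rate H) μ0 t * g 1 + (2 - limitCurve (rate H) μ0 t) * g (-1)))) := by
  -- `a + b * wellSign` interpolates `g` at the two wells; the remainder vanishes there, and unit
  -- mass and the limit of the mass difference give the rest.
  set a := (g 1 + g (-1)) / 2 with ha
  set b := (g 1 - g (-1)) / 2 with hb
  have h1 := F.tendsto_integral_mul_of_eq_zero ht (g := fun x => g x - (a + b * wellSign x))
    (M := M + (|a| + |b| * 1)) (hg.sub (measurable_const.add (measurable_wellSign.const_mul b)))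
    (fun x => (abs_sub _ _).trans (add_le_add (hgM x) ((abs_add_le _ _).trans (by
      rw [abs_mul]; have := abs_wellSign_le x; gcongr))))
    (hgc.sub (continuousAt_const.add (continuousAt_const.mul continuousAt_wellSign.1)))
    (hgc'.sub (continuousAt_const.add (continuousAt_const.mul continuousAt_wellSign.2)))
    (by rw [wellSign_one, ha, hb]; ring) (by rw [wellSign_neg_one, ha, hb]; ring)
  have h2 := h1.add (((F.tendsto_wellSign ht).const_mul b).const_add a)
  have e : (0 : ℝ) + (a + b * (limitCurve (rate H) μ0 t - 1)) =
      (1 / 2) * (limitCurve (rate H) μ0 t * g 1 + (2 - limitCurve (rate H) μ0 t) * g (-1)) := by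
    rw [ha, hb]; ring
  rw [e] at h2
  refine h2.congr' ?_
  filter_upwards [F.eventually_mem] with ε hε
  have hS := F.isSolution ε hε
  have hint := F.integrable_exp ε hε
  have hH := F.doubleWell
  have i1 := hS.integrable_mul hH hint ht (memLp_wt_mul_of_bounded hH hint
    hg.aestronglyMeasurable hgM)
  have i2 := (hS.integrable_mul hH hint ht (IsSolution.memLp_wellSign hH hint)).const_mul b
  have i3 := (hS.integrable hH hint ht).const_mul a
  have e2 : ∫ x, ρ ε t x * (g x - (a + b * wellSign x)) =
      (∫ x, ρ ε t x * g x) - (a * (∫ x, ρ ε t x) + b * ∫ x, ρ ε t x * wellSign x) := by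
    have i4 : Integrable fun x => a * ρ ε t x + b * (ρ ε t x * wellSign x) := i3.add i2
    rw [← integral_const_mul, ← integral_const_mul, ← integral_add i3 i2, ← integral_sub i1 i4]
    congr 1; ext x; ring
  rw [e2, hS.integral_eq_one hH hε.1 hint (F.wellPrepared ε hε) ht]
  ring

/-- The initial mass of both wells is bounded below. -/
lemma mass_bounds [IsProbabilityMeasure μ0] (F : IsFamily H ε₀ C c ρ0 ρ μ0) :
    c ≤ 2 * μ0.real (Ioi 0) ∧ 2 * μ0.real (Ioi 0) ≤ 2 - c := by
  have hH := F.doubleWell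
  -- For `s = ±1` the function `1 + s * wellSign` is nonnegative, with value `2` at one well and `0`
  -- at the other. Integrating it against `ρ⁰ ≥ c γ` and passing to the limit bounds the mass of one
  -- well.
  have key : ∀ s : ℝ, |s| = 1 → c ≤ 1 + s * (2 * μ0.real (Ioi 0) - 1) := by
    intro s hs
    have hb : ∀ x, 0 ≤ 1 + s * wellSign x := fun x => by
      have h1 : |s * wellSign x| ≤ 1 := by rw [abs_mul, hs, one_mul]; exact abs_wellSign_le x
      linarith [(abs_le.1 h1).1]
    have hm : Measurable fun x => 1 + s * wellSign x :=
      measurable_const.add (measurable_wellSign.const_mul s)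
    have hM : ∀ x, |1 + s * wellSign x| ≤ 2 := fun x => by
      have h1 : |s * wellSign x| ≤ 1 := by rw [abs_mul, hs, one_mul]; exact abs_wellSign_le x
      rw [abs_of_nonneg (hb x)]
      linarith [(abs_le.1 h1).2]
    have h1 := (F.tendsto_integral_mul_gam hm hM
      (continuousAt_const.add (continuousAt_const.mul continuousAt_wellSign.1))
      (continuousAt_const.add (continuousAt_const.mul continuousAt_wellSign.2))).const_mul c
    rw [wellSign_one, wellSign_neg_one] at h1
    have h2 := (F.tendsto_initial_wellSign.const_mul s).const_add 1
    have h3 := le_of_tendsto_of_tendsto h1 h2 ?_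
    · linarith
    filter_upwards [F.eventually_mem] with ε hε
    have hS := F.isSolution ε hε
    have hint := F.integrable_exp ε hε
    have hW := F.wellPrepared ε hε
    have mg := memLp_wt_mul_of_bounded hH hint hm.aestronglyMeasurable hM
    have e : 1 + s * ∫ x, ρ ε 0 x * wellSign x = ∫ x, ρ ε 0 x * (1 + s * wellSign x) := by
      have e0 := integral_add (hS.integrable hH hint le_rfl)
        ((hS.integrable_mul hH hint le_rfl (IsSolution.memLp_wellSign hH hint)).const_mul s)
      rw [integral_const_mul, hS.integral_eq_one hH hε.1 hint hW le_rfl] at e0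
      rw [← e0]
      congr 1; ext x; ring
    rw [e, F.integral_initial hε, ← integral_const_mul]
    refine integral_mono_of_nonneg (ae_of_all _ fun x => ?_) ?_ (ae_of_all _ fun x => ?_)
    · exact mul_nonneg F.const_pos.le (mul_nonneg (hb x) (gam_pos hint x).le)
    · refine (hS.integrable_mul hH hint le_rfl mg).congr ?_
      filter_upwards [hS.initial] with x hx
      rw [hx]
    · have h4 := hW.2.2.1 x
      rw [le_div_iff₀ (gam_pos hint x)] at h4
      have := mul_le_mul_of_nonneg_right h4 (hb x)
      simp only
      linarith
  have h1 := key 1 (by simp)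
  have h2 := key (-1) (by simp)
  constructor <;> linarith

end IsFamily

/-! ### Weak time derivatives with uniform energy bounds -/

/-- A bounded test function on the strip, differentiable in time and vanishing near the times `0`
and `T`. -/
structure IsTimeTest (T : ℝ) (ψ ψ' : ℝ × ℝ → ℝ) : Prop where
  measurable : Measurable ψ
  hasDerivAt : ∀ t x, HasDerivAt (fun s => ψ (s, x)) (ψ' (t, x)) t
  bounded : ∃ M, ∀ p, |ψ p| ≤ M ∧ |ψ' p| ≤ M
  support : ∃ δ > 0, ∀ t x, t ∉ Icc δ (T - δ) → ψ (t, x) = 0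

/-- The margin `δ` leaves room to shift test functions in time without leaving `(0, T)`. -/
lemma exists_subset_Icc_of_isCompact {T : ℝ} {K : Set ℝ} (hK : IsCompact K) (hKT : K ⊆ Ioo 0 T) :
    ∃ δ > 0, K ⊆ Icc δ (T - δ) := by
  obtain ⟨δ, hδ, h⟩ := hK.exists_cthickening_subset_open isOpen_Ioo hKT
  refine ⟨δ, hδ, fun t ht => ?_⟩
  have key : ∀ s, |s - t| ≤ δ → s ∈ Ioo 0 T := fun s hs =>
    h (Metric.mem_cthickening_of_dist_le s t δ K ht (by rwa [Real.dist_eq]))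
  have h1 := (key (t - δ) (by simp [abs_of_pos hδ])).1
  have h2 := (key (t + δ) (by simp [abs_of_pos hδ])).2
  constructor <;> linarith

lemma IsTimeTest.of_contDiff {T : ℝ} {ψ : ℝ × ℝ → ℝ} (hψ : ContDiff ℝ ∞ ψ)
    (hs : HasCompactSupport ψ) (hT : tsupport ψ ⊆ Ioo 0 T ×ˢ univ) :
    IsTimeTest T ψ fun p => deriv (fun t => ψ (t, p.2)) p.1 := by
  have hd : ∀ t x, HasDerivAt (fun s => ψ (s, x)) (fderiv ℝ ψ (t, x) (1, 0)) t := fun t x => by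
    have h1 := (hψ.differentiable (by simp) (t, x)).hasFDerivAt
    exact h1.comp_hasDerivAt t ((hasDerivAt_id t).prodMk (hasDerivAt_const t x))
  have hc : Continuous fun p => fderiv ℝ ψ p (1, 0) :=
    (hψ.continuous_fderiv (by simp)).clm_apply continuous_const
  have hcs : HasCompactSupport fun p => fderiv ℝ ψ p (1, 0) := hs.fderiv_apply ℝ (1, 0)
  obtain ⟨M, hM⟩ := hψ.continuous.bounded_above_of_compact_support hs
  obtain ⟨M', hM'⟩ := hc.bounded_above_of_compact_support hcs
  obtain ⟨δ, hδ, h⟩ := exists_subset_Icc_of_isCompact (T := T) (hs.image continuous_fst)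
    (by rintro _ ⟨p, hp, rfl⟩; exact (hT hp).1)
  refine ⟨hψ.continuous.measurable, fun t x => ?_, ⟨max M M', fun p => ⟨?_, ?_⟩⟩, δ, hδ,
    fun t x ht => ?_⟩
  · rw [(hd t x).deriv]; exact hd t x
  · exact (hM p).trans (le_max_left _ _)
  · rw [(hd p.1 p.2).deriv]; exact (hM' p).trans (le_max_right _ _)
  · by_contra h0
    exact ht (h ⟨(t, x), subset_tsupport _ h0, rfl⟩)

/-- No regularity in space is asked of a time test, so indicators of the wells qualify as spatial
factors. -/
lemma IsTimeTest.mul {T : ℝ} {a : ℝ → ℝ} (ha : ContDiff ℝ ∞ a) (hs : HasCompactSupport a)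
    (hT : tsupport a ⊆ Ioo 0 T) {g : ℝ → ℝ} {M : ℝ} (hg : Measurable g) (hgM : ∀ x, |g x| ≤ M) :
    IsTimeTest T (fun p => a p.1 * g p.2) fun p => deriv a p.1 * g p.2 := by
  obtain ⟨A, hA⟩ := ha.continuous.bounded_above_of_compact_support hs
  obtain ⟨A', hA'⟩ := (ha.continuous_deriv (by simp)).bounded_above_of_compact_support hs.deriv
  obtain ⟨δ, hδ, h⟩ := exists_subset_Icc_of_isCompact hs hT
  have hM : 0 ≤ M := (abs_nonneg _).trans (hgM 0)
  refine ⟨(ha.continuous.measurable.comp measurable_fst).mul (hg.comp measurable_snd),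
    fun t x => ((ha.differentiable (by simp) t).hasDerivAt).mul_const (g x),
    ⟨max (A * M) (A' * M), fun p => ⟨?_, ?_⟩⟩, δ, hδ, fun t x ht => ?_⟩
  · rw [abs_mul]
    exact (mul_le_mul (hA _) (hgM _) (abs_nonneg _) ((norm_nonneg _).trans (hA 0))).trans
      (le_max_left _ _)
  · rw [abs_mul]
    exact (mul_le_mul (hA' _) (hgM _) (abs_nonneg _) ((norm_nonneg _).trans (hA' 0))).trans
      (le_max_right _ _)
  · have : a t = 0 := by
      by_contra h0
      exact ht (h (subset_tsupport _ h0))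
    simp [this]

/-- Bounded functions on the strip, after multiplication with the weight. -/
lemma memLp_wt_mul_strip {H : ℝ → ℝ} {ε : ℝ} (hH : IsDoubleWell H)
    (hint : Integrable (fun x => Real.exp (-H x / ε ^ 2))) {T M : ℝ} {ψ : ℝ × ℝ → ℝ}
    (hψ : Measurable ψ) (hM : ∀ p, |ψ p| ≤ M) :
    MemLp (fun p : ℝ × ℝ => wt H ε p.2 * ψ p) 2 (stripMeasure T) := by
  have h1 : MemLp (fun p : ℝ × ℝ => wt H ε p.2 * M) 2 (stripMeasure T) :=
    (memLp_wt_mul_of_bounded hH hint (f := fun _ => M) (M := |M|) aestronglyMeasurable_const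
      (fun _ => le_rfl)).comp_snd _
  refine h1.mono (((continuous_wt hH ε).measurable.comp measurable_snd).mul
    hψ).aestronglyMeasurable (ae_of_all _ fun p => ?_)
  rw [norm_mul, norm_mul]
  gcongr
  exact (hM p).trans (le_abs_self M)

/-- `w` is the weak time derivative of `ρ` on the strip, with the energy bound `C`. -/
structure IsTimeDeriv (H : ℝ → ℝ) (ε C T : ℝ) (ρ w : ℝ → ℝ → ℝ) : Prop where
  memL2Strip : MemL2Strip H ε T w
  integral_sq_le : ∫ p, (w p.1 p.2 / wt H ε p.2) ^ 2 ∂(stripMeasure T) ≤ C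
  weak : ∀ ψ ψ', IsTimeTest T ψ ψ' → ∫ p, w p.1 p.2 * ψ p ∂(stripMeasure T) =
    -∫ p, ρ p.1 p.2 * ψ' p ∂(stripMeasure T)

namespace IsSolution

variable {H : ℝ → ℝ} {ε C c : ℝ} {ρ0 : ℝ → ℝ} {ρ : ℝ → ℝ → ℝ}

lemma aestronglyMeasurable_shift (h : IsSolution H ε ρ0 ρ) {r : ℝ} (hr : 0 ≤ r) (T : ℝ) :
    AEStronglyMeasurable (fun p : ℝ × ℝ => ρ (p.1 + r) p.2) (stripMeasure T) := by
  have h1 : Measure.QuasiMeasurePreserving (fun t : ℝ => t + r) (volume.restrict (Ioo 0 T))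
      (volume.restrict (Ioi 0)) := by
    refine ((measurePreserving_add_right volume r).restrict_preimage
      measurableSet_Ioi).quasiMeasurePreserving.mono_left ?_
    refine Measure.absolutelyContinuous_of_le (Measure.restrict_mono_set _ fun t ht => ?_)
    exact add_pos_of_pos_of_nonneg ht.1 hr
  exact h.meas.comp_quasiMeasurePreserving
    (QuasiMeasurePreserving.prodMap h1 (Measure.QuasiMeasurePreserving.id (volume : Measure ℝ)))

/-- Square-integrability on the strip, from square-integrability in space. -/
lemma memLp_strip_of_norm_eq {T : ℝ} {f : ℝ × ℝ → ℝ} {F : ℝ → L2Line}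
    (hf : AEStronglyMeasurable f (stripMeasure T)) (hF : Continuous F)
    (h : ∀ t ∈ Ioo 0 T, F t =ᵐ[volume] fun x => f (t, x)) :
    MemLp f 2 (stripMeasure T) ∧
      ∫ p, f p ^ 2 ∂(stripMeasure T) = ∫ t in Ioo 0 T, ‖F t‖ ^ 2 := by
  have hm : ∀ t ∈ Ioo 0 T, MemLp (fun x => f (t, x)) 2 := fun t ht =>
    (memLp_congr_ae (h t ht)).1 (Lp.memLp (F t))
  have hn : ∀ t ∈ Ioo 0 T, ∫ x, f (t, x) ^ 2 = ‖F t‖ ^ 2 := fun t ht => by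
    rw [← real_inner_self_eq_norm_sq, inner_eq_integral (h t ht) (h t ht)]
    simp only [sq]
  have hi : Integrable (fun p => f p ^ 2) (stripMeasure T) := by
    refine (integrable_prod_iff (hf.pow 2)).2 ⟨?_, ?_⟩
    · filter_upwards [ae_restrict_mem measurableSet_Ioo] with t ht using (hm t ht).integrable_sq
    · have : IntegrableOn (fun t => ‖F t‖ ^ 2) (Ioo 0 T) :=
        ((hF.norm.pow 2).integrableOn_Icc).mono_set Ioo_subset_Icc_self
      refine this.congr ?_
      filter_upwards [ae_restrict_mem measurableSet_Ioo] with t ht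
      rw [← hn t ht]
      simp
  refine ⟨memLp_two_of_integrable_sq hf hi, ?_⟩
  rw [stripMeasure, integral_prod _ hi]
  exact setIntegral_congr_fun measurableSet_Ioo hn

lemma memLp_shift (h : IsSolution H ε ρ0 ρ) (hH : IsDoubleWell H)
    (hint : Integrable (fun x => Real.exp (-H x / ε ^ 2))) {r : ℝ} (hr : 0 ≤ r) (T : ℝ) :
    MemLp (fun p : ℝ × ℝ => ρ (p.1 + r) p.2 / wt H ε p.2) 2 (stripMeasure T) :=
  (memLp_strip_of_norm_eq (F := fun t => state H ε ρ (t + r))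
    ((h.aestronglyMeasurable_shift hr T).aemeasurable.div
      ((continuous_wt hH ε).measurable.comp measurable_snd).aemeasurable).aestronglyMeasurable
    ((h.continuous_state hH hint).comp (by fun_prop))
    fun t ht => h.coeFn_state hH hint (add_nonneg ht.1.le hr)).1

lemma integrable_shift_mul (h : IsSolution H ε ρ0 ρ) (hH : IsDoubleWell H)
    (hint : Integrable (fun x => Real.exp (-H x / ε ^ 2))) {r : ℝ} (hr : 0 ≤ r) {T M : ℝ}
    {ψ : ℝ × ℝ → ℝ} (hψ : Measurable ψ) (hM : ∀ p, |ψ p| ≤ M) :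
    Integrable (fun p : ℝ × ℝ => ρ (p.1 + r) p.2 * ψ p) (stripMeasure T) := by
  refine (integrable_mul_of_memLp (h.memLp_shift hH hint hr T)
    (memLp_wt_mul_strip hH hint hψ hM)).congr (ae_of_all _ fun p => ?_)
  have := (wt_pos hint p.2).ne'
  field_simp

/-- The flow bound `r² ‖b‖² / (2τ)` meets `‖b‖² ≤ C τ`: the powers of `τ` cancel and the estimate is
uniform in `ε`. This is where the scaling of the initial gradient by `τ` enters. -/
lemma memLp_increment (h : IsSolution H ε ρ0 ρ) (hH : IsDoubleWell H) (hε : 0 < ε)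
    (hint : Integrable (fun x => Real.exp (-H x / ε ^ 2))) (hwp : WellPrepared H ε C c ρ0)
    {r T : ℝ} (hr : 0 ≤ r) (hT : 0 ≤ T) :
    MemLp (fun p : ℝ × ℝ => (ρ (p.1 + r) p.2 - ρ p.1 p.2) / wt H ε p.2) 2 (stripMeasure T) ∧
      ∫ p, ((ρ (p.1 + r) p.2 - ρ p.1 p.2) / wt H ε p.2) ^ 2 ∂(stripMeasure T) ≤
        r ^ 2 * C := by
  have hc := h.continuous_state hH hint
  obtain ⟨Q, hQ, hF⟩ := h.exists_isFormFlow hH hint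
  obtain ⟨-, b, hb, hbC⟩ := h.exists_initial_deriv hH hε hint hwp
  have hτ := tau_pos hε
  have h0 := h.aestronglyMeasurable_shift le_rfl T
  simp only [add_zero] at h0
  have key := memLp_strip_of_norm_eq (T := T)
    (f := fun p : ℝ × ℝ => (ρ (p.1 + r) p.2 - ρ p.1 p.2) / wt H ε p.2)
    (F := fun t => state H ε ρ (t + r) - state H ε ρ t)
    (((h.aestronglyMeasurable_shift hr T).sub h0).aemeasurable.div
      ((continuous_wt hH ε).measurable.comp measurable_snd).aemeasurable).aestronglyMeasurable
    ((hc.comp (by fun_prop)).sub hc) fun t ht => by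
      filter_upwards [h.coeFn_state hH hint (add_nonneg ht.1.le hr),
        h.coeFn_state hH hint ht.1.le,
        Lp.coeFn_sub (state H ε ρ (t + r)) (state H ε ρ t)] with x h1 h2 h3
      rw [h3, Pi.sub_apply, h1, h2, sub_div]
  refine ⟨key.1, key.2.le.trans ?_⟩
  have h2 := hF.integral_norm_sq_increment_le hτ hQ hb hr hT
  rw [intervalIntegral.integral_of_le hT, integral_Ioc_eq_integral_Ioo] at h2
  refine h2.trans ?_
  rw [div_le_iff₀ (by positivity)]
  have : 0 ≤ C * tau ε := (sq_nonneg _).trans hbC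
  nlinarith [mul_le_mul_of_nonneg_left hbC (sq_nonneg r), mul_nonneg (sq_nonneg r) this]

lemma stripMeasure_eq_restrict (T : ℝ) :
    stripMeasure T = (volume : Measure (ℝ × ℝ)).restrict (Ioo 0 T ×ˢ univ) := by
  rw [stripMeasure, Measure.volume_eq_prod, ← Measure.prod_restrict, Measure.restrict_univ]

/-- A time shift may be moved to the test function. -/
lemma integral_shift_mul {T r δ : ℝ} (hr : 0 ≤ r) (hrδ : r < δ) (ρ : ℝ → ℝ → ℝ) {ψ : ℝ × ℝ → ℝ}
    (hψ : ∀ t x, t ∉ Icc δ (T - δ) → ψ (t, x) = 0) :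
    ∫ p, ρ (p.1 + r) p.2 * ψ p ∂(stripMeasure T) =
      ∫ p, ρ p.1 p.2 * ψ (p.1 - r, p.2) ∂(stripMeasure T) := by
  -- Both integrands vanish outside the strip because `r < δ`, so translation invariance on the
  -- whole plane applies.
  rw [stripMeasure_eq_restrict, setIntegral_eq_integral_of_forall_compl_eq_zero,
    setIntegral_eq_integral_of_forall_compl_eq_zero,
    ← integral_add_right_eq_self (fun p : ℝ × ℝ => ρ p.1 p.2 * ψ (p.1 - r, p.2)) (r, 0)]
  · congr 1; ext p; simp
  · rintro ⟨t, x⟩ hp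
    rw [hψ, mul_zero]
    intro ht
    refine hp ⟨⟨?_, ?_⟩, mem_univ _⟩ <;> simp only <;> linarith [ht.1, ht.2]
  · rintro ⟨t, x⟩ hp
    rw [hψ, mul_zero]
    intro ht
    refine hp ⟨⟨?_, ?_⟩, mem_univ _⟩ <;> simp only <;> linarith [ht.1, ht.2]

/-- The weak time derivative of a well-prepared solution. -/
lemma exists_time_deriv (h : IsSolution H ε ρ0 ρ) (hH : IsDoubleWell H) (hε : 0 < ε)
    (hint : Integrable (fun x => Real.exp (-H x / ε ^ 2))) (hwp : WellPrepared H ε C c ρ0)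
    {T : ℝ} (hT : 0 ≤ T) :
    ∃ w : ℝ → ℝ → ℝ, IsTimeDeriv H ε C T ρ w := by
  have hw := fun x => (wt_pos hint x).ne'
  set s : ℕ → ℝ := fun n => 1 / ((n : ℝ) + 1) with hs
  have hs0 : ∀ n, 0 < s n := fun n => Nat.one_div_pos_of_nat
  have hs1 : Tendsto s atTop (𝓝 0) := tendsto_one_div_add_atTop_nhds_zero_nat
  have hC : 0 ≤ C := (sq_nonneg _).trans (h.exists_initial_deriv hH hε hint hwp).1
  have hinc := fun n => h.memLp_increment hH hε hint hwp (hs0 n).le hT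
  set f : ℕ → ℝ × ℝ → ℝ := fun n p =>
    (s n)⁻¹ * ((ρ (p.1 + s n) p.2 - ρ p.1 p.2) / wt H ε p.2) with hf
  have hfm : ∀ n, MemLp (f n) 2 (stripMeasure T) := fun n => (hinc n).1.const_mul _
  -- Difference quotients are bounded by `√C` in `L²(1/γ)`. Multiplied by `√γ`, a weak cluster point
  -- is the time derivative and inherits the bound.
  obtain ⟨y, hy, hyl⟩ := exists_weak_limit (x := fun n => toL2 (stripMeasure T) (f n))
    (R := Real.sqrt C) fun n => by
      refine Real.le_sqrt_of_sq_le ?_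
      rw [norm_toL2_sq (hfm n)]
      simp only [hf, mul_pow]
      rw [integral_const_mul]
      calc _ ≤ (s n)⁻¹ ^ 2 * (s n ^ 2 * C) := by gcongr; exact (hinc n).2
        _ = C := by have := (hs0 n).ne'; field_simp
  have ye : ∀ p : ℝ × ℝ, y p * wt H ε p.2 / wt H ε p.2 = y p :=
    fun p => mul_div_cancel_right₀ _ (hw _)
  have ysq : ∫ p, y p ^ 2 ∂(stripMeasure T) = ‖y‖ ^ 2 := by
    rw [← real_inner_self_eq_norm_sq, inner_eq_integral (ae_eq_refl _) (ae_eq_refl _)]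
    simp only [sq]
  refine ⟨fun t x => y (t, x) * wt H ε x, ⟨?_, ?_⟩, ?_, fun ψ ψ' hψ => ?_⟩
  · exact (Lp.aestronglyMeasurable y).mul
      ((continuous_wt hH ε).comp continuous_snd).aestronglyMeasurable
  · refine (Lp.memLp y).integrable_sq.congr (ae_of_all _ fun p => ?_)
    simp only
    rw [← div_wt_sq hint, ye p]
  · simp only [ye]
    rw [ysq]
    calc ‖y‖ ^ 2 ≤ Real.sqrt C ^ 2 := pow_le_pow_left₀ (norm_nonneg _) hy 2
      _ = C := Real.sq_sqrt hC
  · obtain ⟨M, hM⟩ := hψ.bounded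
    obtain ⟨δ, hδ, hδψ⟩ := hψ.support
    have hψm := memLp_wt_mul_strip hH hint (T := T) hψ.measurable fun p => (hM p).1
    have hi : Integrable (fun p : ℝ × ℝ => ρ p.1 p.2 * M) (stripMeasure T) := by
      simpa using h.integrable_shift_mul hH hint le_rfl (T := T) (ψ := fun _ => M) (M := |M|)
        measurable_const fun _ => le_rfl
    have hi0 : ∀ ψ : ℝ × ℝ → ℝ, Measurable ψ → (∀ p, |ψ p| ≤ M) →
        Integrable (fun p : ℝ × ℝ => ρ p.1 p.2 * ψ p) (stripMeasure T) := fun ψ h1 h2 => by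
      simpa using h.integrable_shift_mul hH hint le_rfl (T := T) h1 h2
    have hsh : ∀ r, Measurable fun p : ℝ × ℝ => ψ (p.1 - r, p.2) := fun r =>
      hψ.measurable.comp ((measurable_fst.sub_const r).prodMk measurable_snd)
    -- Difference quotients of `ψ` converge pointwise to `-ψ'` and are bounded by `M` by the mean
    -- value inequality, so dominated convergence applies with `|ρ M|`, integrable on the strip.
    have lim : Tendsto (fun n => ∫ p, ρ p.1 p.2 *
        ((s n)⁻¹ * (ψ (p.1 - s n, p.2) - ψ p)) ∂(stripMeasure T)) atTop
        (𝓝 (∫ p, ρ p.1 p.2 * -ψ' p ∂(stripMeasure T))) := by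
      have hρm := h.aestronglyMeasurable_shift le_rfl T
      simp only [add_zero] at hρm
      refine tendsto_integral_of_dominated_convergence (fun p => ‖ρ p.1 p.2 * M‖) (fun n => ?_)
        hi.norm (fun n => ae_of_all _ fun p => ?_) (ae_of_all _ fun p => ?_)
      · exact hρm.mul (((hsh _).sub hψ.measurable).const_mul _).aestronglyMeasurable
      · rw [norm_mul, norm_mul _ M]
        gcongr
        rw [norm_mul, norm_inv, Real.norm_of_nonneg (hs0 n).le]
        have := Convex.norm_image_sub_le_of_norm_hasDerivWithin_le (C := M) (s := univ)
          (f := fun t => ψ (t, p.2)) (f' := fun t => ψ' (t, p.2)) (x := p.1) (y := p.1 - s n)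
          (fun t _ => (hψ.hasDerivAt t p.2).hasDerivWithinAt) (fun t _ => (hM (t, p.2)).2)
          convex_univ (mem_univ _) (mem_univ _)
        rw [show p.1 - s n - p.1 = -s n by ring, norm_neg, Real.norm_of_nonneg (hs0 n).le] at this
        calc (s n)⁻¹ * ‖ψ (p.1 - s n, p.2) - ψ p‖ ≤ (s n)⁻¹ * (M * s n) := by
              have := (hs0 n).le; gcongr
          _ = M := by have := (hs0 n).ne'; field_simp
          _ ≤ ‖M‖ := le_abs_self M
      · refine Tendsto.const_mul _ ?_
        have h1 := (hψ.hasDerivAt p.1 p.2).tendsto_slope_zero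
        have h2 : Tendsto (fun n => -s n) atTop (𝓝[≠] 0) := by
          refine tendsto_nhdsWithin_iff.2 ⟨by simpa using hs1.neg, ?_⟩
          exact Eventually.of_forall fun n => neg_ne_zero.2 (hs0 n).ne'
        refine (h1.comp h2).neg.congr fun n => ?_
        simp only [Function.comp_apply, smul_eq_mul, inv_neg, ← sub_eq_add_neg]
        ring
    have key := hyl (toL2 (stripMeasure T) fun p => wt H ε p.2 * ψ p) _ (lim.congr' ?_)
    · rw [inner_eq_integral (ae_eq_refl _) (coeFn_toL2 hψm)] at key
      simp only [mul_neg, integral_neg] at key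
      rw [← key]
      congr 1; ext p; ring
    · filter_upwards [hs1.eventually_lt_const hδ] with n hn
      have i1 := h.integrable_shift_mul hH hint (hs0 n).le (T := T) hψ.measurable
        fun p => (hM p).1
      have i2 := hi0 ψ hψ.measurable fun p => (hM p).1
      have i3 := hi0 _ (hsh (s n)) fun p => (hM _).1
      have e1 : ∫ p, ρ p.1 p.2 * ((s n)⁻¹ * (ψ (p.1 - s n, p.2) - ψ p)) ∂(stripMeasure T) =
          (s n)⁻¹ * ((∫ p, ρ p.1 p.2 * ψ (p.1 - s n, p.2) ∂(stripMeasure T)) -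
            ∫ p, ρ p.1 p.2 * ψ p ∂(stripMeasure T)) := by
        rw [← integral_sub i3 i2, ← integral_const_mul]
        congr 1; ext p; ring
      have e2 : ⟪toL2 (stripMeasure T) (f n), toL2 (stripMeasure T) fun p => wt H ε p.2 * ψ p⟫ =
          (s n)⁻¹ * ((∫ p, ρ (p.1 + s n) p.2 * ψ p ∂(stripMeasure T)) -
            ∫ p, ρ p.1 p.2 * ψ p ∂(stripMeasure T)) := by
        rw [inner_toL2 (hfm n) hψm, ← integral_sub i1 i2, ← integral_const_mul]
        congr 1; ext p
        have := hw p.2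
        simp only [hf]
        field_simp
      rw [e1, e2, integral_shift_mul (hs0 n).le hn ρ hδψ]

end IsSolution

/-! ### Convergence of the time derivatives -/

/-- Test functions are dense in `L²(0, T)`. -/
lemma exists_contDiff_near {T : ℝ} {α : ℝ → ℝ} (hα : MemLp α 2 (volume.restrict (Ioo 0 T)))
    {δ : ℝ} (hδ : 0 < δ) :
    ∃ a : ℝ → ℝ, ContDiff ℝ ∞ a ∧ HasCompactSupport a ∧ tsupport a ⊆ Ioo 0 T ∧
      Real.sqrt (∫ t in Ioo 0 T, (α t - a t) ^ 2) < δ := by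
  set μ := (volume : Measure ℝ).restrict (Ioo 0 T) with hμ
  have hm : ∀ a : ℝ → ℝ, Continuous a → HasCompactSupport a → MemLp a 2 μ := fun a h1 h2 =>
    (h1.memLp_of_hasCompactSupport h2).restrict _
  let K : Submodule ℝ (Lp ℝ 2 μ) :=
    { carrier := {P | ∃ a : ℝ → ℝ, ContDiff ℝ ∞ a ∧ HasCompactSupport a ∧ tsupport a ⊆ Ioo 0 T ∧
        P =ᵐ[μ] a}
      zero_mem' := ⟨0, contDiff_const, HasCompactSupport.zero, by simp [tsupport],
        Lp.coeFn_zero ℝ 2 μ⟩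
      add_mem' := by
        rintro P Q ⟨a, h1, h2, h3, h4⟩ ⟨b, g1, g2, g3, g4⟩
        exact ⟨a + b, h1.add g1, h2.add g2, (tsupport_add a b).trans (union_subset h3 g3),
          (Lp.coeFn_add P Q).trans (h4.add g4)⟩
      smul_mem' := by
        rintro r P ⟨a, h1, h2, h3, h4⟩
        refine ⟨fun x => r * a x, contDiff_const.mul h1, h2.mul_left,
          (tsupport_mul_subset_right).trans h3, ?_⟩
        filter_upwards [Lp.coeFn_smul r P, h4] with x e1 e2
        rw [e1, Pi.smul_apply, e2, smul_eq_mul] }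
  -- A vector orthogonal to all test functions vanishes almost everywhere, by the fundamental lemma
  -- of the calculus of variations.
  have hK : K.topologicalClosure = ⊤ := by
    rw [Submodule.topologicalClosure_eq_top_iff, eq_bot_iff]
    intro P hP
    rw [Submodule.mem_orthogonal] at hP
    have hloc : LocallyIntegrableOn P (Ioo 0 T) := by
      have : IntegrableOn P (Ioo 0 T) := (Lp.memLp P).integrable one_le_two
      exact this.locallyIntegrableOn
    have := isOpen_Ioo.ae_eq_zero_of_integral_contDiff_smul_eq_zero hloc fun a h1 h2 h3 => by
      have h4 := hP (toL2 μ a) ⟨a, h1, h2, h3, coeFn_toL2 (hm a h1.continuous h2)⟩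
      rw [inner_eq_integral (coeFn_toL2 (hm a h1.continuous h2)) (ae_eq_refl _)] at h4
      refine (setIntegral_eq_integral_of_forall_compl_eq_zero fun x hx => ?_).symm.trans h4
      rw [image_eq_zero_of_notMem_tsupport fun h => hx (h3 h), zero_smul]
    refine (Submodule.mem_bot ℝ).2 (Lp.ext ?_)
    filter_upwards [Lp.coeFn_zero ℝ 2 μ, (ae_restrict_iff' measurableSet_Ioo).2 this] with x h1 h2
    rw [h1, h2, Pi.zero_apply]
  have hmem : toL2 μ α ∈ closure (K : Set (Lp ℝ 2 μ)) := by
    rw [← Submodule.topologicalClosure_coe, hK]; trivial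
  obtain ⟨P, ⟨a, h1, h2, h3, h4⟩, hP⟩ := Metric.mem_closure_iff.1 hmem δ hδ
  refine ⟨a, h1, h2, h3, ?_⟩
  have ha := hm a h1.continuous h2
  have e : P = toL2 μ a := Lp.ext (h4.trans (coeFn_toL2 ha).symm)
  rw [dist_eq_norm, e, toL2_sub hα ha] at hP
  rwa [← norm_toL2_sq (f := fun t => α t - a t) (hα.sub ha), Real.sqrt_sq (norm_nonneg _)]

lemma contDiff_limitCurve (k : ℝ) (μ0 : Measure ℝ) : ContDiff ℝ ∞ (limitCurve k μ0) := by
  unfold limitCurve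
  fun_prop

lemma hasDerivAt_limitCurve (k : ℝ) (μ0 : Measure ℝ) (t : ℝ) :
    HasDerivAt (limitCurve k μ0) (-k * (limitCurve k μ0 t - 1)) t := by
  have := ((((hasDerivAt_id t).const_mul (-k)).exp).const_mul
    (2 * μ0.real (Ioi 0) - 1)).const_add 1
  refine this.congr_deriv ?_
  simp only [limitCurve, id_eq, mul_one]
  ring

lemma integral_mul_limitCurve {k T : ℝ} {μ0 : Measure ℝ} {a : ℝ → ℝ} (ha : ContDiff ℝ ∞ a)
    (hs : HasCompactSupport a) (hT : tsupport a ⊆ Ioo 0 T) (p q : ℝ) :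
    ∫ t in Ioo 0 T, a t * ((1 / 2) * (-k * (limitCurve k μ0 t - 1) * (p - q))) =
      -∫ t in Ioo 0 T, deriv a t *
        ((1 / 2) * (limitCurve k μ0 t * p + (2 - limitCurve k μ0 t) * q)) := by
  set f : ℝ → ℝ := fun t => (1 / 2) * (limitCurve k μ0 t * p + (2 - limitCurve k μ0 t) * q)
  have hf : ContDiff ℝ 1 f := by
    have := (contDiff_limitCurve k μ0).of_le (show (1 : WithTop ℕ∞) ≤ ∞ by norm_cast)
    exact contDiff_const.mul ((this.mul contDiff_const).add
      ((contDiff_const.sub this).mul contDiff_const))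
  have hfd : deriv f = fun t => (1 / 2) * (-k * (limitCurve k μ0 t - 1) * (p - q)) := by
    ext t
    have h := hasDerivAt_limitCurve k μ0 t
    exact ((((h.mul_const p).add ((h.const_sub 2).mul_const q)).const_mul (1 / 2)).congr_deriv
      (by ring)).deriv
  have c1 : Continuous (deriv f) := hf.continuous_deriv le_rfl
  have c2 : Continuous (deriv a) := ha.continuous_deriv (by simp)
  have key := (IsPrimitive.of_contDiff (ha.of_le (by norm_cast))).integral_mul_eq_zero
    (IsPrimitive.of_contDiff hf)
    ((c2.mul hf.continuous).integrable_of_hasCompactSupport hs.deriv.mul_right)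
    ((ha.continuous.mul c1).integrable_of_hasCompactSupport hs.mul_right)
    ((ha.continuous.mul hf.continuous).integrable_of_hasCompactSupport hs.mul_right)
  rw [hfd] at key
  rw [setIntegral_eq_integral_of_forall_compl_eq_zero,
    setIntegral_eq_integral_of_forall_compl_eq_zero]
  · linarith
  · intro x hx
    rw [image_eq_zero_of_notMem_tsupport fun h => hx (hT (tsupport_deriv_subset h)), zero_mul]
  · intro x hx
    rw [image_eq_zero_of_notMem_tsupport fun h => hx (hT h), zero_mul]

lemma IsTimeDeriv.abs_integral_mul_le {H : ℝ → ℝ} {ε C T : ℝ} {ρ w : ℝ → ℝ → ℝ}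
    (hw : IsTimeDeriv H ε C T ρ w) (hH : IsDoubleWell H)
    (hint : Integrable (fun x => Real.exp (-H x / ε ^ 2))) {ψ : ℝ × ℝ → ℝ} {M : ℝ}
    (hψ : Measurable ψ) (hM : ∀ p, |ψ p| ≤ M) :
    Integrable (fun p => w p.1 p.2 * ψ p) (stripMeasure T) ∧
      |∫ p, w p.1 p.2 * ψ p ∂(stripMeasure T)| ≤
        Real.sqrt C * Real.sqrt (∫ p, gam H ε p.2 * ψ p ^ 2 ∂(stripMeasure T)) := by
  have m1 := hw.memL2Strip.memLp hH hint
  have m2 := memLp_wt_mul_strip hH hint (T := T) hψ hM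
  have e : (fun p : ℝ × ℝ => w p.1 p.2 / wt H ε p.2 * (wt H ε p.2 * ψ p)) =
      fun p => w p.1 p.2 * ψ p := by
    ext p
    have := (wt_pos hint p.2).ne'
    field_simp
  have h1 := KramersLimit.abs_integral_mul_le m1 m2
  have h2 := integrable_mul_of_memLp m1 m2
  simp only [mul_wt_sq hint] at h1
  rw [e] at h1 h2
  exact ⟨h2, h1.trans (mul_le_mul_of_nonneg_right (Real.sqrt_le_sqrt hw.integral_sq_le)
    (Real.sqrt_nonneg _))⟩

namespace IsFamily

variable {H : ℝ → ℝ} {ε₀ C c : ℝ} {ρ0 : ℝ → ℝ → ℝ} {ρ : ℝ → ℝ → ℝ → ℝ} {μ0 : Measure ℝ}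
  {T : ℝ} {e : ℕ → ℝ} {w : ℕ → ℝ → ℝ → ℝ}

lemma abs_integral_mul_le_of_bounded (F : IsFamily H ε₀ C c ρ0 ρ μ0) {ε : ℝ} (hε : ε ∈ Ioo 0 ε₀)
    {t : ℝ} (ht : 0 ≤ t) {g : ℝ → ℝ} {M : ℝ} (hgM : ∀ x, |g x| ≤ M) :
    |∫ x, ρ ε t x * g x| ≤ M := by
  have hS := F.isSolution ε hε
  have hint := F.integrable_exp ε hε
  have h1 := norm_integral_le_integral_norm (μ := volume) fun x => ρ ε t x * g x
  refine h1.trans ?_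
  calc _ ≤ ∫ x, ρ ε t x * M := by
        refine integral_mono_of_nonneg (ae_of_all _ fun x => norm_nonneg _)
          ((hS.integrable F.doubleWell hint ht).mul_const M) (ae_of_all _ fun x => ?_)
        have := hS.nonneg t ht x
        simp only [norm_mul, Real.norm_eq_abs, abs_of_nonneg this]
        exact mul_le_mul_of_nonneg_left (hgM x) this
    _ = M := by
        rw [integral_mul_const, hS.integral_eq_one F.doubleWell hε.1 hint
          (F.wellPrepared ε hε) ht, one_mul]

/-- The time derivative is moved onto `a`, where the convergence of densities at each time and
dominated convergence apply, and then back onto the limit curve. -/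
lemma tendsto_time_deriv_test [IsProbabilityMeasure μ0] (F : IsFamily H ε₀ C c ρ0 ρ μ0)
    (he : ∀ n, e n ∈ Ioo 0 ε₀) (het : Tendsto e atTop (𝓝[>] 0))
    (hw : ∀ n, IsTimeDeriv H (e n) C T (ρ (e n)) (w n)) {a : ℝ → ℝ} (ha : ContDiff ℝ ∞ a)
    (hs : HasCompactSupport a) (hT : tsupport a ⊆ Ioo 0 T) {g : ℝ → ℝ} {M : ℝ}
    (hg : Measurable g) (hgM : ∀ x, |g x| ≤ M) (hgc : ContinuousAt g 1)
    (hgc' : ContinuousAt g (-1)) :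
    Tendsto (fun n => ∫ p, w n p.1 p.2 * (a p.1 * g p.2) ∂(stripMeasure T)) atTop
      (𝓝 (∫ t in Ioo 0 T, a t *
        ((1 / 2) * (-rate H * (limitCurve (rate H) μ0 t - 1) * (g 1 - g (-1)))))) := by
  have c2 : Continuous (deriv a) := ha.continuous_deriv (by simp)
  obtain ⟨A, hA⟩ := c2.bounded_above_of_compact_support hs.deriv
  have htest := IsTimeTest.mul ha hs hT hg hgM
  have hi : ∀ n, Integrable (fun p : ℝ × ℝ => ρ (e n) p.1 p.2 * (deriv a p.1 * g p.2))
      (stripMeasure T) := fun n => by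
    simpa using (F.isSolution _ (he n)).integrable_shift_mul F.doubleWell
      (F.integrable_exp _ (he n)) le_rfl (T := T)
      (ψ := fun p => deriv a p.1 * g p.2) (M := A * M)
      ((c2.measurable.comp measurable_fst).mul (hg.comp measurable_snd)) fun p => by
        rw [abs_mul]
        exact mul_le_mul (hA _) (hgM _) (abs_nonneg _) ((norm_nonneg _).trans (hA 0))
  have e1 : ∀ n, ∫ p, w n p.1 p.2 * (a p.1 * g p.2) ∂(stripMeasure T) =
      -∫ t in Ioo 0 T, ∫ x, ρ (e n) t x * (deriv a t * g x) := fun n => by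
    rw [(hw n).weak _ _ htest, stripMeasure, integral_prod _ (hi n)]
  have e2 : ∀ n t, ∫ x, ρ (e n) t x * (deriv a t * g x) =
      deriv a t * ∫ x, ρ (e n) t x * g x := fun n t => by
    rw [← integral_const_mul]
    congr 1; ext x; ring
  simp only [e1]
  rw [integral_mul_limitCurve ha hs hT]
  refine Tendsto.neg ?_
  refine tendsto_integral_of_dominated_convergence (fun t => ‖deriv a t‖ * M)
    (fun n => (hi n).integral_prod_left.aestronglyMeasurable)
    ((c2.integrable_of_hasCompactSupport hs.deriv).norm.mul_const M).integrableOn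
    (fun n => ?_) ?_
  · filter_upwards [ae_restrict_mem measurableSet_Ioo] with t ht
    rw [e2, norm_mul]
    gcongr
    exact F.abs_integral_mul_le_of_bounded (he n) ht.1.le hgM
  · filter_upwards [ae_restrict_mem measurableSet_Ioo] with t ht
    simp only [e2]
    exact ((F.tendsto_integral_mul ht.1.le hg hgM hgc hgc').comp het).const_mul _

/-- The energy bound makes the functionals equicontinuous in `α` for the norm of `L²(0, T)`, so
density of test functions removes smoothness and the vanishing of `α` near the end points. -/
lemma tendsto_time_deriv_mul [IsProbabilityMeasure μ0] (F : IsFamily H ε₀ C c ρ0 ρ μ0)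
    (he : ∀ n, e n ∈ Ioo 0 ε₀) (het : Tendsto e atTop (𝓝[>] 0))
    (hw : ∀ n, IsTimeDeriv H (e n) C T (ρ (e n)) (w n)) {α : ℝ → ℝ} {A : ℝ} (hα : Measurable α)
    (hαA : ∀ t, |α t| ≤ A) {g : ℝ → ℝ}
    (hg : Measurable g) (hgM : ∀ x, |g x| ≤ 1) (hgc : ContinuousAt g 1)
    (hgc' : ContinuousAt g (-1)) :
    Tendsto (fun n => ∫ p, w n p.1 p.2 * (α p.1 * g p.2) ∂(stripMeasure T)) atTop
      (𝓝 (∫ t in Ioo 0 T, α t *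
        ((1 / 2) * (-rate H * (limitCurve (rate H) μ0 t - 1) * (g 1 - g (-1)))))) := by
  set μ := (volume : Measure ℝ).restrict (Ioo 0 T) with hμ
  set f : ℝ → ℝ := fun t =>
    (1 / 2) * (-rate H * (limitCurve (rate H) μ0 t - 1) * (g 1 - g (-1))) with hf
  have hfc : Continuous f := by
    have := (contDiff_limitCurve (rate H) μ0).continuous
    fun_prop
  have hfm : MemLp f 2 μ := memLp_two_of_integrable_sq hfc.aestronglyMeasurable
    ((hfc.pow 2).integrableOn_Icc.mono_set Ioo_subset_Icc_self)
  have hαm : MemLp α 2 μ := MemLp.of_bound hα.aestronglyMeasurable A (ae_of_all _ hαA)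
  set R := Real.sqrt (∫ t in Ioo 0 T, f t ^ 2) with hR
  have hpos : 0 < Real.sqrt C + R + 1 := by positivity
  rw [Metric.tendsto_atTop]
  intro κ hκ
  -- The replacement of `α` by `a` costs `√C d` before and `d R` after the limit; this choice makes
  -- their sum less than `κ / 2`.
  obtain ⟨a, ha, hs, hT, had⟩ := exists_contDiff_near hαm
    (show 0 < κ / 2 / (Real.sqrt C + R + 1) by positivity)
  set d := Real.sqrt (∫ t in Ioo 0 T, (α t - a t) ^ 2) with hd
  rw [lt_div_iff₀ hpos] at had
  have hd0 : 0 ≤ d := Real.sqrt_nonneg _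
  obtain ⟨B, hB⟩ := ha.continuous.bounded_above_of_compact_support hs
  have ham : MemLp a 2 μ := (ha.continuous.memLp_of_hasCompactSupport hs).restrict _
  obtain ⟨N, hN⟩ := Metric.tendsto_atTop.1
    (F.tendsto_time_deriv_test he het hw ha hs hT hg hgM hgc hgc') (κ / 2) (half_pos hκ)
  refine ⟨N, fun n hn => ?_⟩
  have h1 := hN n hn
  rw [Real.dist_eq] at h1 ⊢
  have hint := F.integrable_exp _ (he n)
  have mα : Measurable fun p : ℝ × ℝ => α p.1 * g p.2 :=
    (hα.comp measurable_fst).mul (hg.comp measurable_snd)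
  have ma : Measurable fun p : ℝ × ℝ => a p.1 * g p.2 :=
    (ha.continuous.measurable.comp measurable_fst).mul (hg.comp measurable_snd)
  have bound : ∀ (b : ℝ → ℝ) (D : ℝ), (∀ t, |b t| ≤ D) → ∀ p : ℝ × ℝ, |b p.1 * g p.2| ≤ D := by
    intro b D hb p
    rw [abs_mul]
    exact (mul_le_of_le_one_right (abs_nonneg _) (hgM _)).trans (hb _)
  have i1 := ((hw n).abs_integral_mul_le F.doubleWell hint mα (bound α A hαA)).1
  have i2 := ((hw n).abs_integral_mul_le F.doubleWell hint ma (bound a B hB)).1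
  have h2 : |(∫ p, w n p.1 p.2 * (α p.1 * g p.2) ∂(stripMeasure T)) -
      ∫ p, w n p.1 p.2 * (a p.1 * g p.2) ∂(stripMeasure T)| ≤ Real.sqrt C * d := by
    have h3 := ((hw n).abs_integral_mul_le F.doubleWell hint
      (ψ := fun p => (α p.1 - a p.1) * g p.2)
      (((hα.sub ha.continuous.measurable).comp measurable_fst).mul (hg.comp measurable_snd))
      (bound (fun t => α t - a t) (A + B) fun t =>
        (abs_sub _ _).trans (add_le_add (hαA t) (hB t)))).2
    have e1 : ∫ p, gam H (e n) p.2 * ((α p.1 - a p.1) * g p.2) ^ 2 ∂(stripMeasure T) =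
        (∫ t in Ioo 0 T, (α t - a t) ^ 2) * ∫ x, gam H (e n) x * g x ^ 2 := by
      rw [stripMeasure, ← integral_prod_mul]
      congr 1; ext p; ring
    have e2 : ∫ x, gam H (e n) x * g x ^ 2 ≤ 1 := by
      rw [← integral_gam hint]
      refine integral_mono_of_nonneg (ae_of_all _ fun x => ?_) (integrable_gam hint)
        (ae_of_all _ fun x => ?_)
      · exact mul_nonneg (gam_pos hint x).le (sq_nonneg _)
      · exact mul_le_of_le_one_right (gam_pos hint x).le ((sq_le_one_iff_abs_le_one _).2 (hgM x))
    rw [← integral_sub i1 i2]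
    simp only [← mul_sub, ← sub_mul]
    refine h3.trans ?_
    rw [e1]
    refine mul_le_mul_of_nonneg_left (Real.sqrt_le_sqrt ?_) (Real.sqrt_nonneg _)
    exact mul_le_of_le_one_right (integral_nonneg fun t => sq_nonneg _) e2
  have h4 : |(∫ t in Ioo 0 T, a t * f t) - ∫ t in Ioo 0 T, α t * f t| ≤ d * R := by
    rw [abs_sub_comm, ← integral_sub (integrable_mul_of_memLp hαm hfm)
      (integrable_mul_of_memLp ham hfm)]
    simp only [← sub_mul]
    exact KramersLimit.abs_integral_mul_le (hαm.sub ham) hfm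
  rw [abs_lt] at h1 ⊢
  rw [abs_le] at h2 h4
  constructor <;> nlinarith

/-- Weak convergence of the time derivatives. -/
lemma tendsto_time_deriv [IsProbabilityMeasure μ0] (F : IsFamily H ε₀ C c ρ0 ρ μ0)
    (he : ∀ n, e n ∈ Ioo 0 ε₀) (het : Tendsto e atTop (𝓝[>] 0))
    (hw : ∀ n, IsTimeDeriv H (e n) C T (ρ (e n)) (w n)) (Ψ : (ℝ × ℝ) →ᵇ ℝ) :
    Tendsto (fun n => ∫ p, w n p.1 p.2 * Ψ p ∂(stripMeasure T)) atTop
      (𝓝 (∫ t in Ioo 0 T, (1 / 2) * (-rate H * (limitCurve (rate H) μ0 t - 1) * Ψ (t, 1) -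
        -rate H * (limitCurve (rate H) μ0 t - 1) * Ψ (t, -1)))) := by
  have hH := F.doubleWell
  set g₁ : ℝ → ℝ := (Ioi (0 : ℝ)).indicator fun _ => 1 with hg₁
  set g₂ : ℝ → ℝ := (Iic (0 : ℝ)).indicator fun _ => 1 with hg₂
  have m₁ : Measurable g₁ := measurable_const.indicator measurableSet_Ioi
  have m₂ : Measurable g₂ := measurable_const.indicator measurableSet_Iic
  have b₁ : ∀ x, |g₁ x| ≤ 1 := abs_indicator_one_le _
  have b₂ : ∀ x, |g₂ x| ≤ 1 := abs_indicator_one_le _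
  have pos : ∀ᶠ x : ℝ in 𝓝 1, 0 < x := lt_mem_nhds one_pos
  have neg : ∀ᶠ x : ℝ in 𝓝 (-1), x < 0 := gt_mem_nhds (by norm_num)
  have e₁ : g₁ =ᶠ[𝓝 1] fun _ => 1 := by
    filter_upwards [pos] with x hx; simp [hg₁, hx]
  have e₂ : g₁ =ᶠ[𝓝 (-1)] fun _ => 0 := by
    filter_upwards [neg] with x hx; simp [hg₁, hx.le]
  have e₃ : g₂ =ᶠ[𝓝 1] fun _ => 0 := by
    filter_upwards [pos] with x hx; simp [hg₂, hx]
  have e₄ : g₂ =ᶠ[𝓝 (-1)] fun _ => 1 := by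
    filter_upwards [neg] with x hx; simp [hg₂, hx.le]
  have c₁ : ContinuousAt g₁ 1 := continuousAt_const.congr e₁.symm
  have c₂ : ContinuousAt g₁ (-1) := continuousAt_const.congr e₂.symm
  have c₃ : ContinuousAt g₂ 1 := continuousAt_const.congr e₃.symm
  have c₄ : ContinuousAt g₂ (-1) := continuousAt_const.congr e₄.symm
  have hΨ : ∀ p, |Ψ p| ≤ ‖Ψ‖ := Ψ.norm_coe_le_norm
  have hα : ∀ y : ℝ, Continuous fun t => Ψ (t, y) := fun y => Ψ.continuous.comp (by fun_prop)
  have hm : ∀ (y : ℝ) (g : ℝ → ℝ), Measurable g →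
      Measurable fun p : ℝ × ℝ => Ψ (p.1, y) * g p.2 := fun y g hg =>
    ((hα y).measurable.comp measurable_fst).mul (hg.comp measurable_snd)
  have hb : ∀ (y : ℝ) (g : ℝ → ℝ), (∀ x, |g x| ≤ 1) → ∀ p : ℝ × ℝ,
      |Ψ (p.1, y) * g p.2| ≤ ‖Ψ‖ := fun y g hg p => by
    rw [abs_mul]
    exact (mul_le_of_le_one_right (abs_nonneg _) (hg _)).trans (hΨ _)
  -- The remainder after freezing `Ψ` at its values in the wells. It vanishes at `x = ±1` for each
  -- `t`, so `∫ γ G²` tends to zero and the energy bound makes its contribution negligible.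
  set G : ℝ × ℝ → ℝ := fun p => Ψ p - (Ψ (p.1, 1) * g₁ p.2 + Ψ (p.1, -1) * g₂ p.2) with hG
  have hGm : Measurable G :=
    Ψ.continuous.measurable.sub ((hm 1 g₁ m₁).add (hm (-1) g₂ m₂))
  have hGb : ∀ p, |G p| ≤ ‖Ψ‖ + (‖Ψ‖ + ‖Ψ‖) := fun p =>
    (abs_sub _ _).trans (add_le_add (hΨ p) ((abs_add_le _ _).trans
      (add_le_add (hb 1 g₁ b₁ p) (hb (-1) g₂ b₂ p))))
  set B := ‖Ψ‖ + (‖Ψ‖ + ‖Ψ‖) with hB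
  have hGi : ∀ n, Integrable (fun p : ℝ × ℝ => gam H (e n) p.2 * G p ^ 2) (stripMeasure T) :=
    fun n => by
      have := (memLp_wt_mul_strip hH (F.integrable_exp _ (he n)) (T := T) hGm hGb).integrable_sq
      simpa only [mul_wt_sq (F.integrable_exp _ (he n))] using this
  have hGlim : Tendsto (fun n => ∫ p, gam H (e n) p.2 * G p ^ 2 ∂(stripMeasure T)) atTop
      (𝓝 0) := by
    have e0 : ∀ n, ∫ p, gam H (e n) p.2 * G p ^ 2 ∂(stripMeasure T) =
        ∫ t in Ioo 0 T, ∫ x, gam H (e n) x * G (t, x) ^ 2 := fun n => by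
      rw [stripMeasure, integral_prod _ (hGi n)]
    simp only [e0]
    have hsq : ∀ p, G p ^ 2 ≤ B ^ 2 := fun p =>
      sq_le_sq' (abs_le.1 (hGb p)).1 (abs_le.1 (hGb p)).2
    have := tendsto_integral_of_dominated_convergence (μ := volume.restrict (Ioo 0 T))
      (F := fun n t => ∫ x, gam H (e n) x * G (t, x) ^ 2) (f := fun _ => (0 : ℝ))
      (fun _ => B ^ 2) (fun n => (hGi n).integral_prod_left.aestronglyMeasurable)
      (integrable_const _) (fun n => ae_of_all _ fun t => ?_) (ae_of_all _ fun t => ?_)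
    · simpa using this
    · have hint := F.integrable_exp _ (he n)
      have hg := fun x => (gam_pos hint x).le
      rw [Real.norm_of_nonneg (integral_nonneg fun x => mul_nonneg (hg x) (sq_nonneg _))]
      calc _ ≤ ∫ x, gam H (e n) x * B ^ 2 := by
            refine integral_mono_of_nonneg (ae_of_all _ fun x => mul_nonneg (hg x) (sq_nonneg _))
              ((integrable_gam hint).mul_const _) (ae_of_all _ fun x => ?_)
            exact mul_le_mul_of_nonneg_left (hsq _) (hg x)
        _ = B ^ 2 := by rw [integral_mul_const, integral_gam hint, one_mul]
    · have cΨ : ∀ y, ContinuousAt (fun x => Ψ (t, x)) y := fun y =>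
        (Ψ.continuous.comp (by fun_prop : Continuous fun x : ℝ => (t, x))).continuousAt
      have h1 := F.tendsto_integral_mul_gam (g := fun x => G (t, x) ^ 2) (M := B ^ 2)
        ((hGm.comp (measurable_const.prodMk measurable_id)).pow_const 2)
        (fun x => by rw [abs_of_nonneg (sq_nonneg _)]; exact hsq _)
        (((cΨ 1).sub ((continuousAt_const.mul c₁).add (continuousAt_const.mul c₃))).pow 2)
        (((cΨ (-1)).sub ((continuousAt_const.mul c₂).add (continuousAt_const.mul c₄))).pow 2)
      simp only [hG, e₁.eq_of_nhds, e₂.eq_of_nhds, e₃.eq_of_nhds, e₄.eq_of_nhds] at h1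
      simp only [mul_one, mul_zero, add_zero, zero_add, sub_self, ne_eq, OfNat.ofNat_ne_zero,
        not_false_eq_true, zero_pow, zero_div] at h1
      refine (h1.comp het).congr fun n => ?_
      simp only [Function.comp_apply, hG, mul_comm]
  have h1 := F.tendsto_time_deriv_mul he het hw (hα 1).measurable (fun t => hΨ (t, 1)) m₁ b₁ c₁ c₂
  have h2 := F.tendsto_time_deriv_mul he het hw (hα (-1)).measurable (fun t => hΨ (t, -1))
    m₂ b₂ c₃ c₄
  have h3 : Tendsto (fun n => ∫ p, w n p.1 p.2 * G p ∂(stripMeasure T)) atTop (𝓝 0) := by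
    have h4 := hGlim.sqrt.const_mul (Real.sqrt C)
    rw [Real.sqrt_zero, mul_zero] at h4
    exact squeeze_zero_norm (fun n =>
      ((hw n).abs_integral_mul_le hH (F.integrable_exp _ (he n)) hGm hGb).2) h4
  have h5 := h3.add (h1.add h2)
  rw [e₁.eq_of_nhds, e₂.eq_of_nhds, e₃.eq_of_nhds, e₄.eq_of_nhds, zero_add] at h5
  have cu := (contDiff_limitCurve (rate H) μ0).continuous
  have hi : ∀ f : ℝ → ℝ, Continuous f → IntegrableOn f (Ioo 0 T) := fun f hf =>
    hf.integrableOn_Icc.mono_set Ioo_subset_Icc_self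
  have j : ∀ y d : ℝ, IntegrableOn (fun t => Ψ (t, y) *
      ((1 / 2) * (-rate H * (limitCurve (rate H) μ0 t - 1) * d))) (Ioo 0 T) := fun y d =>
    hi _ ((hα y).mul (by fun_prop))
  rw [← integral_add (j 1 (1 - 0)) (j (-1) (0 - 1))] at h5
  convert h5 using 1
  · ext n
    have hint := F.integrable_exp _ (he n)
    have i0 := ((hw n).abs_integral_mul_le hH hint hGm hGb).1
    have i1 := ((hw n).abs_integral_mul_le hH hint (hm 1 g₁ m₁) (hb 1 g₁ b₁)).1
    have i2 := ((hw n).abs_integral_mul_le hH hint (hm (-1) g₂ m₂) (hb (-1) g₂ b₂)).1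
    have i3 : Integrable (fun p => w n p.1 p.2 * (Ψ (p.1, 1) * g₁ p.2) +
      w n p.1 p.2 * (Ψ (p.1, -1) * g₂ p.2)) (stripMeasure T) := i1.add i2
    rw [← integral_add i1 i2, ← integral_add i0 i3]
    congr 1; ext p
    simp only [hG]
    ring
  · congr 2; ext t; ring

end IsFamily

/-! ### The limit metric, energy and Rayleigh functional -/

/-- The density of the limit metric: `g_u(v, w) = v w A(u)`. -/
def metricDensity (k u : ℝ) : ℝ :=
  if u = 1 then 1 / k else Real.log (u / (2 - u)) / (2 * k * (u - 1))

lemma limitMetric_eq (k u v w : ℝ) : limitMetric k u v w = metricDensity k u * (v * w) := by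
  unfold limitMetric metricDensity
  split_ifs <;> ring

lemma measurable_metricDensity (k : ℝ) : Measurable (metricDensity k) := by
  unfold metricDensity
  exact Measurable.ite (measurableSet_singleton 1) measurable_const
    ((Real.measurable_log.comp (measurable_id.div (measurable_const.sub measurable_id))).div
      (measurable_const.mul (measurable_id.sub_const 1)))

/-- `E'(u) = ½ log (u / (2 - u))`, and the metric carries the same logarithm over `2k (u - 1)`. This
compatibility makes the gradient flow linear; at `u = 1` both sides vanish. -/
lemma deriv_limitEnergy {k u : ℝ} (hk : 0 < k) (h0 : 0 < u) (h2 : u < 2) :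
    deriv limitEnergy u = metricDensity k u * (k * (u - 1)) := by
  have h2' : 0 < 2 - u := by linarith
  have h1 : HasDerivAt limitEnergy ((1 / 2) * ((1 * Real.log u + u * u⁻¹) +
      (-1 * Real.log (2 - u) + (2 - u) * (-1 / (2 - u))))) u := by
    have hs : HasDerivAt (fun x : ℝ => 2 - x) (-1) u := (hasDerivAt_id u).const_sub 2
    exact (((hasDerivAt_id u).mul (Real.hasDerivAt_log h0.ne')).add
      (hs.mul (hs.log h2'.ne'))).const_mul (1 / 2)
  rw [h1.deriv, metricDensity]
  split_ifs with hu
  · subst hu; norm_num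
  · have : u - 1 ≠ 0 := sub_ne_zero.2 hu
    rw [Real.log_div h0.ne' h2'.ne']
    field_simp
    ring

/-- `log (x / y) ≤ (x - y) / y` with `x - y = 2 |u - 1|` cancels the zero of the denominator. The
lower bound serves minimality, the upper one integrability. -/
lemma metricDensity_bounds {k δ u : ℝ} (hk : 0 < k) (hδ : 0 < δ) (h1 : δ ≤ u) (h2 : u ≤ 2 - δ) :
    0 ≤ metricDensity k u ∧ metricDensity k u ≤ 1 / (k * δ) := by
  have hu : 0 < u := hδ.trans_le h1
  have hu' : 0 < 2 - u := by linarith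
  have key : ∀ x y : ℝ, δ ≤ y → y < x → 0 ≤ Real.log (x / y) ∧
      Real.log (x / y) ≤ (x - y) / δ := by
    intro x y hy hxy
    have hy0 : 0 < y := hδ.trans_le hy
    refine ⟨Real.log_nonneg ((one_le_div hy0).2 hxy.le), ?_⟩
    refine (Real.log_le_sub_one_of_pos (div_pos (hy0.trans hxy) hy0)).trans ?_
    rw [div_sub_one hy0.ne']
    have : 0 ≤ x - y := by linarith
    gcongr
  unfold metricDensity
  split_ifs with h
  · refine ⟨by positivity, ?_⟩
    have : δ ≤ 1 := by linarith
    apply one_div_le_one_div_of_le (by positivity)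
    nlinarith
  rcases lt_or_gt_of_ne h with hlt | hgt
  · obtain ⟨a, b⟩ := key (2 - u) u h1 (by linarith)
    have e : Real.log (u / (2 - u)) / (2 * k * (u - 1)) =
        Real.log ((2 - u) / u) / (2 * k * (1 - u)) := by
      rw [← inv_div (2 - u) u, Real.log_inv, ← neg_sub 1 u, mul_neg, neg_div_neg_eq]
    have hp : 0 < 1 - u := by linarith
    rw [e]
    refine ⟨by positivity, ?_⟩
    rw [div_le_iff₀ (by positivity)]
    refine b.trans (le_of_eq ?_)
    field_simp
    ring
  · obtain ⟨a, b⟩ := key u (2 - u) (by linarith) (by linarith)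
    have hp : 0 < u - 1 := by linarith
    refine ⟨by positivity, ?_⟩
    rw [div_le_iff₀ (by positivity)]
    refine b.trans (le_of_eq ?_)
    field_simp
    ring

lemma rayleighDensity_eq {k u : ℝ} (hk : 0 < k) (h0 : 0 < u) (h2 : u < 2) (v : ℝ) :
    rayleighDensity k u v = metricDensity k u * ((1 / 2) * v ^ 2 + k * (u - 1) * v) := by
  rw [rayleighDensity, limitMetric_eq, deriv_limitEnergy hk h0 h2]
  ring

lemma limitMetric_add_deriv_eq_zero {k u : ℝ} (hk : 0 < k) (h0 : 0 < u) (h2 : u < 2) (v : ℝ) :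
    limitMetric k u (-k * (u - 1)) v + deriv limitEnergy u * v = 0 := by
  rw [limitMetric_eq, deriv_limitEnergy hk h0 h2]
  ring

/-- Pointwise, `½ v² + k (u - 1) v` is least at `v = -k (u - 1)` by completing the square, and the
weight is nonnegative. The distance from `0` and `2` bounds the weight, so all integrals are finite.
-/
lemma isRayleighMinimizer {k T δ : ℝ} (hk : 0 < k) (hδ : 0 < δ) {u d : ℝ → ℝ}
    (hu : AEMeasurable u (volume.restrict (Ioo 0 T)))
    (hb : ∀ t ∈ Icc 0 T, δ ≤ u t ∧ u t ≤ 2 - δ) (hd : MemLp d 2 (volume.restrict (Ioo 0 T)))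
    (hde : ∀ᵐ t ∂(volume.restrict (Ioo 0 T)), d t = -k * (u t - 1)) :
    IsRayleighMinimizer k T u d := by
  have e : ∀ v : ℝ → ℝ, (fun t => metricDensity k (u t) *
      ((1 / 2) * v t ^ 2 + k * (u t - 1) * v t)) =ᵐ[volume.restrict (Ioo 0 T)]
      fun t => rayleighDensity k (u t) (v t) := fun v => by
    filter_upwards [ae_restrict_mem measurableSet_Ioo] with t ht
    obtain ⟨h1, h2⟩ := hb t (Ioo_subset_Icc_self ht)
    rw [rayleighDensity_eq hk (by linarith) (by linarith)]
  have hi : ∀ v : ℝ → ℝ, MemLp v 2 (volume.restrict (Ioo 0 T)) →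
      IntegrableOn (fun t => rayleighDensity k (u t) (v t)) (Ioo 0 T) := fun v hv => by
    have i1 := hv.integrable_sq
    have i2 : Integrable v (volume.restrict (Ioo 0 T)) := hv.integrable one_le_two
    refine Integrable.congr (Integrable.mono' (((i1.const_mul (1 / 2)).add
      (i2.norm.const_mul k)).const_mul (1 / (k * δ))) ?_ ?_) (e v)
    · have hvm := hv.aestronglyMeasurable.aemeasurable
      exact (((measurable_metricDensity k).comp_aemeasurable hu).mul
        (((hvm.pow_const 2).const_mul (1 / 2)).add
          (((hu.sub_const 1).const_mul k).mul hvm))).aestronglyMeasurable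
    · filter_upwards [ae_restrict_mem measurableSet_Ioo] with t ht
      obtain ⟨h1, h2⟩ := hb t (Ioo_subset_Icc_self ht)
      obtain ⟨h3, h4⟩ := metricDensity_bounds hk hδ h1 h2
      rw [norm_mul, Real.norm_of_nonneg h3]
      refine mul_le_mul h4 ((norm_add_le _ _).trans ?_) (norm_nonneg _) (by positivity)
      simp only [Pi.add_apply]
      refine add_le_add (le_of_eq (Real.norm_of_nonneg (by positivity))) ?_
      rw [norm_mul, norm_mul, Real.norm_of_nonneg hk.le]
      gcongr
      refine mul_le_of_le_one_right hk.le (abs_le.2 ⟨?_, ?_⟩) <;> linarith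
  refine ⟨hd, hi d hd, fun v hv => ⟨hi v hv, ?_⟩⟩
  refine integral_mono_ae (hi d hd) (hi v hv) ?_
  filter_upwards [e d, e v, hde, ae_restrict_mem measurableSet_Ioo] with t h1 h2 h3 ht
  obtain ⟨h4, h5⟩ := hb t (Ioo_subset_Icc_self ht)
  rw [← h1, ← h2, h3]
  refine mul_le_mul_of_nonneg_left ?_ (metricDensity_bounds hk hδ h4 h5).1
  nlinarith [sq_nonneg (v t + k * (u t - 1))]

/-! ### Identification of the limit -/

/-- Weak derivatives are unique. -/
lemma HasWeakDerivOn.ae_eq {u d d' : ℝ → ℝ} {Ω : Set ℝ} (hΩ : IsOpen Ω)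
    (h : HasWeakDerivOn u d Ω) (h' : HasWeakDerivOn u d' Ω) :
    ∀ᵐ t ∂(volume.restrict Ω), d t = d' t := by
  have key := hΩ.ae_eq_zero_of_integral_contDiff_smul_eq_zero (h.2.1.sub h'.2.1)
    fun ψ hψ hs hT => by
      have h1 := h.2.2 ψ hψ hs hT
      have h2 := h'.2.2 ψ hψ hs hT
      have hi : ∀ f : ℝ → ℝ, LocallyIntegrableOn f Ω → IntegrableOn (fun t => f t * ψ t) Ω := by
        intro f hf
        have h3 : IntegrableOn (fun t => f t * ψ t) (tsupport ψ) :=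
          (hf.integrableOn_compact_subset hT hs).mul_continuousOn hψ.continuous.continuousOn hs
        refine (integrableOn_iff_integrable_of_support_subset ?_).1 h3 |>.integrableOn
        exact fun t ht => subset_tsupport ψ (right_ne_zero_of_mul ht)
      have h3 : ∫ t in Ω, (d t * ψ t - d' t * ψ t) = 0 := by
        rw [integral_sub (hi d h.2.1) (hi d' h'.2.1)]; linarith
      rw [← h3, setIntegral_eq_integral_of_forall_compl_eq_zero]
      · congr 1; ext t; simp only [Pi.sub_apply, smul_eq_mul]; ring
      · intro t ht
        rw [image_eq_zero_of_notMem_tsupport fun h => ht (hT h)]; ring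
  rw [ae_restrict_iff' hΩ.measurableSet]
  filter_upwards [key] with t ht hΩt
  exact sub_eq_zero.1 (ht hΩt)

lemma hasWeakDerivOn_limitCurve (k T : ℝ) (μ0 : Measure ℝ) :
    HasWeakDerivOn (limitCurve k μ0) (fun t => -k * (limitCurve k μ0 t - 1)) (Ioo 0 T) := by
  have hc := (contDiff_limitCurve k μ0).continuous
  refine ⟨hc.locallyIntegrable.locallyIntegrableOn _,
    (show Continuous fun t => -k * (limitCurve k μ0 t - 1) by
      fun_prop).locallyIntegrable.locallyIntegrableOn _, fun ψ hψ hs hT => ?_⟩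
  -- The values `2` and `0` at the wells turn the paired observable into the limit curve itself.
  have h := integral_mul_limitCurve (k := k) (μ0 := μ0) hψ hs hT 2 0
  calc _ = ∫ t in Ioo 0 T, deriv ψ t *
        ((1 / 2) * (limitCurve k μ0 t * 2 + (2 - limitCurve k μ0 t) * 0)) := by
        congr 1; ext t; ring
    _ = _ := (neg_eq_iff_eq_neg.2 h).symm
    _ = _ := by congr 2; ext t; ring

/-- A bounded continuous function that separates the wells. -/
def wellTest : ℝ →ᵇ ℝ :=
  BoundedContinuousFunction.ofNormedAddCommGroup (fun x => max 0 (min 1 x)) (by fun_prop) 1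
    fun x => by
      rw [Real.norm_eq_abs, abs_le]
      exact ⟨by linarith [le_max_left 0 (min 1 x)], max_le zero_le_one (min_le_left _ _)⟩

namespace IsFamily

variable {H : ℝ → ℝ} {ε₀ C c : ℝ} {ρ0 : ℝ → ℝ → ℝ} {ρ : ℝ → ℝ → ℝ → ℝ} {μ0 : Measure ℝ}
  {T : ℝ} {e : ℕ → ℝ} {u du : ℝ → ℝ}

lemma tendsto_density [IsProbabilityMeasure μ0] (F : IsFamily H ε₀ C c ρ0 ρ μ0)
    (het : Tendsto e atTop (𝓝[>] 0)) {t : ℝ} (ht : t ∈ Icc 0 T) (ψ : ℝ →ᵇ ℝ) :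
    Tendsto (fun n => ∫ x, ρ (e n) t x * ψ x) atTop
      (𝓝 ((1 / 2) * (limitCurve (rate H) μ0 t * ψ 1 +
        (2 - limitCurve (rate H) μ0 t) * ψ (-1)))) :=
  (F.tendsto_integral_mul ht.1 ψ.continuous.measurable ψ.norm_coe_le_norm
    ψ.continuous.continuousAt ψ.continuous.continuousAt).comp het

lemma isLimit_limitCurve [IsProbabilityMeasure μ0] (F : IsFamily H ε₀ C c ρ0 ρ μ0) (hT : 0 ≤ T)
    (he : ∀ n, e n ∈ Ioo 0 ε₀) (het : Tendsto e atTop (𝓝[>] 0)) :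
    IsLimit H T ρ e (limitCurve (rate H) μ0)
      fun t => -rate H * (limitCurve (rate H) μ0 t - 1) := by
  have hc := (contDiff_limitCurve (rate H) μ0).continuous
  have hm : ∀ f : ℝ → ℝ, Continuous f → MemLp f 2 (volume.restrict (Ioo 0 T)) := fun f hf =>
    memLp_two_of_integrable_sq hf.aestronglyMeasurable
      ((hf.pow 2).integrableOn_Icc.mono_set Ioo_subset_Icc_self)
  choose w hw using fun n => (F.isSolution _ (he n)).exists_time_deriv F.doubleWell (he n).1
    (F.integrable_exp _ (he n)) (F.wellPrepared _ (he n)) hT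
  refine ⟨hm _ hc, hm _ (by fun_prop), hasWeakDerivOn_limitCurve _ _ _, fun n t ht =>
    (F.isSolution _ (he n)).integral_eq_one F.doubleWell (he n).1 (F.integrable_exp _ (he n))
      (F.wellPrepared _ (he n)) ht.1, fun t ht ψ => F.tendsto_density het ht ψ, w,
    fun n => ⟨(hw n).memL2Strip, fun ψ hψ hs hT => ?_⟩, F.tendsto_time_deriv he het hw⟩
  rw [(hw n).weak _ _ (IsTimeTest.of_contDiff hψ hs hT), neg_neg]

/-- Weak limits are unique, and `wellTest`, equal to `1` at `1` and `0` at `-1`, reads off `u t /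
2`. -/
lemma eqOn_limitCurve [IsProbabilityMeasure μ0] (F : IsFamily H ε₀ C c ρ0 ρ μ0)
    (het : Tendsto e atTop (𝓝[>] 0)) (h : IsLimit H T ρ e u du) :
    EqOn u (limitCurve (rate H) μ0) (Icc 0 T) := by
  intro t ht
  have := tendsto_nhds_unique (h.tendsto_density t ht wellTest) (F.tendsto_density het ht wellTest)
  simpa [wellTest] using this

/-- At each time the value is a convex combination of `1` and the initial value, and both lie in
`[c, 2 - c]` by `mass_bounds`. -/
lemma limitCurve_bounds [IsProbabilityMeasure μ0] (F : IsFamily H ε₀ C c ρ0 ρ μ0) {t : ℝ}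
    (ht : 0 ≤ t) :
    c ≤ limitCurve (rate H) μ0 t ∧ limitCurve (rate H) μ0 t ≤ 2 - c := by
  obtain ⟨h1, h2⟩ := F.mass_bounds
  have h3 : Real.exp (-rate H * t) ≤ 1 := Real.exp_le_one_iff.2 (by
    nlinarith [mul_nonneg F.doubleWell.rate_pos.le ht])
  have h4 := Real.exp_pos (-rate H * t)
  unfold limitCurve
  constructor <;> nlinarith

end IsFamily

end KramersLimit

end

/-! ### The main theorem -/

theorem mainTheorem2 (H : ℝ → ℝ) (hH : KramersLimit.IsDoubleWell H)
    (ε₀ : ℝ) (hε₀ : 0 < ε₀)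
    (hint : ∀ ε ∈ Ioo 0 ε₀, Integrable (fun x => Real.exp (-H x / ε ^ 2)))
    (ρ0 : ℝ → ℝ → ℝ) (ρ : ℝ → ℝ → ℝ → ℝ)
    (hsol : ∀ ε ∈ Ioo 0 ε₀, KramersLimit.IsSolution H ε (ρ0 ε) (ρ ε))
    (C c : ℝ) (hc : 0 < c)
    (hwp : ∀ ε ∈ Ioo 0 ε₀, KramersLimit.WellPrepared H ε C c (ρ0 ε))
    (μ0 : Measure ℝ) [IsProbabilityMeasure μ0]
    (hinit : ∀ ψ : ℝ →ᵇ ℝ,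
      Tendsto (fun ε => ∫ x, ρ0 ε x * ψ x) (𝓝[>] 0) (𝓝 (∫ x, ψ x ∂μ0)))
    (T : ℝ) (hT : 0 < T) :
    (∀ e : ℕ → ℝ, (∀ n, e n ∈ Ioo 0 ε₀) → Tendsto e atTop (𝓝 0) →
      ∃ φ : ℕ → ℕ, StrictMono φ ∧ ∃ u du : ℝ → ℝ,
        KramersLimit.IsLimit H T ρ (e ∘ φ) u du) ∧
    (∀ e : ℕ → ℝ, (∀ n, e n ∈ Ioo 0 ε₀) → Tendsto e atTop (𝓝 0) →
      ∀ u du : ℝ → ℝ, KramersLimit.IsLimit H T ρ e u du →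
        (∃ δ > 0, ∀ t ∈ Icc 0 T, δ ≤ u t ∧ u t ≤ 2 - δ) ∧
        KramersLimit.IsRayleighMinimizer (KramersLimit.rate H) T u du ∧
        KramersLimit.IsLimitGradientFlow (KramersLimit.rate H) T u ∧
        (∀ᵐ t ∂(volume.restrict (Ioo 0 T)), du t = -KramersLimit.rate H * (u t - 1)) ∧
        (∀ t ∈ Icc 0 T,
          HasDerivWithinAt u (-KramersLimit.rate H * (u t - 1)) (Icc 0 T) t) ∧
        u 0 = 2 * μ0.real (Ioi 0)) := by
  have F : KramersLimit.IsFamily H ε₀ C c ρ0 ρ μ0 := ⟨hH, hε₀, hint, hsol, hc, hwp, hinit⟩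
  have hk := hH.rate_pos
  have het : ∀ e : ℕ → ℝ, (∀ n, e n ∈ Ioo 0 ε₀) → Tendsto e atTop (𝓝 0) →
      Tendsto e atTop (𝓝[>] 0) := fun e he h =>
    tendsto_nhdsWithin_iff.2 ⟨h, Eventually.of_forall fun n => (he n).1⟩
  -- The whole sequence converges, since the limit curve is determined by the initial measure; no
  -- subsequence is taken.
  refine ⟨fun e he h => ⟨id, strictMono_id, _, _, F.isLimit_limitCurve hT.le he (het e he h)⟩,
    fun e he h u du hu => ?_⟩
  have hue := F.eqOn_limitCurve (het e he h) hu
  have hb : ∀ t ∈ Icc 0 T, c ≤ u t ∧ u t ≤ 2 - c := fun t ht => by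
    rw [hue ht]; exact F.limitCurve_bounds ht.1
  have hd : ∀ t ∈ Icc 0 T, HasDerivWithinAt u (-KramersLimit.rate H * (u t - 1)) (Icc 0 T) t := by
    intro t ht
    rw [hue ht]
    exact (KramersLimit.hasDerivAt_limitCurve _ μ0 t).hasDerivWithinAt.congr hue (hue ht)
  have hdu : ∀ᵐ t ∂(volume.restrict (Ioo 0 T)), du t = -KramersLimit.rate H * (u t - 1) := by
    -- `u` agrees with the limit curve on `[0, T]`, so it has the same weak derivative, and
    -- uniqueness identifies `du` almost everywhere.
    have h1 : KramersLimit.HasWeakDerivOn u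
        (fun t => -KramersLimit.rate H * (KramersLimit.limitCurve (KramersLimit.rate H) μ0 t - 1))
        (Ioo 0 T) := by
      obtain ⟨-, h2, h3⟩ := KramersLimit.hasWeakDerivOn_limitCurve (KramersLimit.rate H) T μ0
      refine ⟨hu.weak_deriv.1, h2, fun ψ hψ hs hT => ?_⟩
      rw [← h3 ψ hψ hs hT]
      exact setIntegral_congr_fun measurableSet_Ioo fun t ht => by
        simp only [hue (Ioo_subset_Icc_self ht)]
    filter_upwards [hu.weak_deriv.ae_eq isOpen_Ioo h1, ae_restrict_mem measurableSet_Ioo]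
      with t h2 ht
    rw [h2, hue (Ioo_subset_Icc_self ht)]
  refine ⟨⟨c, hc, hb⟩, KramersLimit.isRayleighMinimizer hk hc
    hu.memLp.aestronglyMeasurable.aemeasurable hb hu.memLp_deriv hdu, fun t ht => ?_, hdu, hd, ?_⟩
  · obtain ⟨h1, h2⟩ := hb t ht
    exact ⟨⟨by linarith, by linarith⟩, _, hd t ht,
      KramersLimit.limitMetric_add_deriv_eq_zero hk (by linarith) (by linarith)⟩
  · rw [hue (left_mem_Icc.2 hT.le)]
    simp [KramersLimit.limitCurve]
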